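/- Let $t,s_1,s_2,s_3,r_1,r_2\in\mathbb{C}$ with $t\neq 0,1$, $r_1+r_2=s_1+s_2+s_3-1$ and $\operatorname{Re}s_1>1$. Let $$D_x=x(x-1)(x-t)\frac{d^2}{dx^2}+x(x-1)(x-t)\Big(\frac{s_1}{x}+\frac{s_2}{x-1}+\frac{s_3}{x-t}\Big)\frac{d}{dx}+r_1r_2x+\lambda,$$ let $f_\lambda(x)=\sum_{i\ge 0}P_i(\lambda)x^i$ be the unique solution of $D_xf_\lambda=0$ at $x=0$ with $f_\lambda(0)=1$; then $P_i$ is a polynomial of degree $i$. Define $C_{ij}^k\in\mathbb{C}$ by $P_iP_j=\sum_k C_{ij}^kP_k$ and $$K(x_1,x_2,y)=\sum_{i,j,k\ge 0}C_{ij}^k\frac{x_1^ix_2^j}{y^{k+1}}.$$ Put $$u=\frac{x_1x_2}{t},\quad v=\frac{(x_1-1)(x_2-1)(y-1)}{(t-1)^2},\quad w=\frac{(x_1-t)(x_2-t)(y-t)}{t(t-1)^2},\quad Q=(v-w)^2-2(v+w)(uq-1)+(uq-1)^2,$$ and let $F$ be the Gauss hypergeometric function. Then there is $\varepsilon>0$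 such that for all $x_1,x_2$ with $|x_1|,|x_2|<\varepsilon$ the following holds. (0) For every $q\in[0,1]$ the function $Q^{1/2}=\frac{y}{1-t}\sqrt{Q\,(1-t)^2/y^2}$ (principal root) is a continuous square root of $Q$ on $\{y:\ |x_1|,|x_2|<\varepsilon|y|\}$, and $Q^{1/2}\sim v-w$ as $y\to\infty$. (1) For all $y$ with $|x_1|,|x_2|<\varepsilon|y|$ the series for $K$ converges absolutely and $$K=\frac{s_1-1}{1-t}\Big(\frac{2(x_1-1)(x_2-1)}{1-t}\Big)^{1-s_2}\Big(\frac{2(x_1-t)(x_2-t)}{t(t-1)}\Big)^{1-s_3}\int_0^1F(r_1-1,r_2-1,s_1-1,uq)\,q^{s_1-2}Q^{-1/2}\big(-uq-v+w+1+Q^{1/2}\big)^{s_2-1}\big(-uq+v-w+1-Q^{1/2}\big)^{s_3-1}dq,$$ the integral being absolutely convergent. (2) If moreover $1<\operatorname{Re}r_1<\operatorname{Re}s_1$ and $x_1x_2\ne0$, then with $$q_1=\frac{-uq-v+w+1+Q^{1/2}}{2(1-pqu)},\qquad q_2=\frac{-uq+v-w+1-Q^{1/2}}{2(1-pqu)}$$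 and $D$ the image of the square $0\le p,q\le1$ (oriented by $dp\wedge dq$) under $(p,q)\mapsto(q_1,q_2)$, $$K=\Big(\frac{x_1x_2}{t}\Big)^{1-s_1}\Big(\frac{(x_1-1)(x_2-1)}{1-t}\Big)^{1-s_2}\Big(\frac{(x_1-t)(x_2-t)}{t(t-1)}\Big)^{1-s_3}\frac{\Gamma(s_1)}{\Gamma(r_1-1)\Gamma(s_1-r_1)(1-t)}\int_Dq_1^{s_2-1}q_2^{s_3-1}(1-q_1-q_2)^{s_1-r_1-1}\Big(1+\frac v{q_1}+\frac w{q_2}\Big)^{r_1-2}\frac{dq_1}{q_1}\wedge\frac{dq_2}{q_2},$$ the integral (of the 2-form pulled back to the square) being absolutely convergent. (3) Under the same conditions the right-hand side of (2) is an integral over $D$ of the kernel $$K(x_1,x_2,y,q_1,q_2)=(x_1x_2)^{1-s_1}\big((x_1-1)(x_2-1)\big)^{1-s_2}\big((x_1-t)(x_2-t)\big)^{1-s_3}(1-q_1-q_2)^{s_1-r_1-1}q_1^{s_2-r_1}q_2^{s_3-r_1}(q_1q_2+wq_1+vq_2)^{r_1-2},$$ namely $$K(x_1,x_2,y)=t^{s_1-1}(1-t)^{s_2-1}(t(t-1))^{s_3-1}\frac{\Gamma(s_1)}{\Gamma(r_1-1)\Gamma(s_1-r_1)(1-t)}\int_DK(x_1,x_2,y,q_1,q_2)\,dq_1\wedge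 dq_2,$$ again with absolute convergence. Branches: put $c_1=\frac{x_1x_2}{t}$, $c_2=\frac{(x_1-1)(x_2-1)}{1-t}$, $c_3=\frac{(x_1-t)(x_2-t)}{t(t-1)}$. The logarithms of the constants ($2c_2,2c_3$ in (1); $c_1,c_2,c_3$ in (2); $c_1,c_2,c_3$, $t$, $1-t$, $t(t-1)$ in (3)) are arbitrary. In (3) the logarithms of $x_1x_2=c_1t$, $(x_1-1)(x_2-1)=c_2(1-t)$, $(x_1-t)(x_2-t)=c_3t(t-1)$ are the sums of the chosen ones. A power under an integral sign is $z^e=\exp\big(e(\ell+\operatorname{Log}(z/e^\ell))\big)$ with $\operatorname{Log}$ principal, where $\ell$ is the chosen logarithm of $2c_2$, $2c_3$ for the two powers in (1), and in (2), (3) of $c_2$ for $q_1$, of $c_3$ for $q_2$, of $c_1$ for $1-q_1-q_2$ and $1+v/q_1+w/q_2$, and $\ell$ is the sum of the three for $q_1q_2+wq_1+vq_2$; $q^{s_1-2}$ is the principal power. -/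

import Mathlib

noncomputable section

/-- Parameters of the Heun operator
`D_x = x(x-1)(x-t) d²/dx² + x(x-1)(x-t) (s₁/x + s₂/(x-1) + s₃/(x-t)) d/dx + r₁ r₂ x + λ`.
The last condition is what makes the solution analytic at `0` with value `1` there
exist and be unique. -/
structure HeunParams where
  t : ℂ
  s₁ : ℂ
  s₂ : ℂ
  s₃ : ℂ
  r₁ : ℂ
  r₂ : ℂ
  t_ne_zero : t ≠ 0
  t_ne_one : t ≠ 1
  fuchs : r₁ + r₂ = s₁ + s₂ + s₃ - 1
  s₁_ne : ∀ n : ℕ, s₁ ≠ -(n : ℂ)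

namespace HeunParams

variable (H : HeunParams)

/-- The complex number `z` as a constant in `ℂ[λ]⟦x⟧`. -/
abbrev cst (z : ℂ) : PowerSeries (Polynomial ℂ) := PowerSeries.C (Polynomial.C z)

/-- The Heun operator `D_x` on `ℂ[λ]⟦x⟧`; the accessory parameter `λ` is the variable of the
coefficient ring. -/
def heunOp (f : PowerSeries (Polynomial ℂ)) : PowerSeries (Polynomial ℂ) :=
  let x : PowerSeries (Polynomial ℂ) := PowerSeries.X
  let lam : PowerSeries (Polynomial ℂ) := PowerSeries.C Polynomial.X
  let f' := PowerSeries.derivative (Polynomial ℂ) f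
  let f'' := PowerSeries.derivative (Polynomial ℂ) f'
  x * (x - 1) * (x - cst H.t) * f''
    + (cst H.s₁ * ((x - 1) * (x - cst H.t)) + cst H.s₂ * (x * (x - cst H.t))
        + cst H.s₃ * (x * (x - 1))) * f'
    + (cst (H.r₁ * H.r₂) * x + lam) * f

/-- The polynomials `P_i(λ)`: the Taylor coefficients at `x = 0` of the solution `f_λ(x)` of
`D_x f_λ = 0`, `f_λ(0) = 1`. They are given by the Frobenius recursion; `heunSeries_iff` below
shows that they are characterized by the differential equation. -/
def P : ℕ → Polynomial ℂ
  | 0 => 1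
  | 1 => Polynomial.C (1 / (H.t * H.s₁)) * (-Polynomial.X)
  | n + 2 => Polynomial.C (1 / (H.t * (n + 2) * (n + 1 + H.s₁))) *
      ((Polynomial.C ((1 + H.t) * (n + 1) * n
          + (H.s₁ * (1 + H.t) + H.s₂ * H.t + H.s₃) * (n + 1)) - Polynomial.X) * P (n + 1)
        - Polynomial.C ((n + H.r₁) * (n + H.r₂)) * P n)

/-- The generating series `f_λ(x) = ∑ P_i(λ) x^i`. -/
def heunSeries : PowerSeries (Polynomial ℂ) := PowerSeries.mk H.P

theorem add_s₁_ne (n : ℕ) : (n : ℂ) + H.s₁ ≠ 0 := fun h =>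
  H.s₁_ne n (by linear_combination h)

theorem heunOp_eq (f : PowerSeries (Polynomial ℂ)) :
    H.heunOp f =
      PowerSeries.X * (PowerSeries.X * (PowerSeries.X *
          PowerSeries.derivative _ (PowerSeries.derivative _ f)))
      - cst (1 + H.t) * (PowerSeries.X * (PowerSeries.X *
          PowerSeries.derivative _ (PowerSeries.derivative _ f)))
      + cst H.t * (PowerSeries.X * PowerSeries.derivative _ (PowerSeries.derivative _ f))
      + cst (H.s₁ + H.s₂ + H.s₃) * (PowerSeries.X * (PowerSeries.X * PowerSeries.derivative _ f))
      - cst (H.s₁ * (1 + H.t) + H.s₂ * H.t + H.s₃) * (PowerSeries.X * PowerSeries.derivative _ f)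
      + cst (H.s₁ * H.t) * PowerSeries.derivative _ f
      + cst (H.r₁ * H.r₂) * (PowerSeries.X * f) + PowerSeries.C Polynomial.X * f := by
  simp only [heunOp, cst, map_add, map_mul, map_one]
  ring

theorem coeff_heunOp_zero (f : PowerSeries (Polynomial ℂ)) :
    PowerSeries.coeff 0 (H.heunOp f) =
      Polynomial.C (H.t * H.s₁) * PowerSeries.coeff 1 f
        + Polynomial.X * PowerSeries.coeff 0 f := by
  rw [heunOp_eq]
  simp only [cst, LinearMap.map_add, LinearMap.map_sub, PowerSeries.coeff_C_mul, PowerSeries.coeff_zero_X_mul,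
    PowerSeries.coeff_derivative]
  simp only [map_mul]
  push_cast
  ring

theorem coeff_heunOp_succ (f : PowerSeries (Polynomial ℂ)) (n : ℕ) :
    PowerSeries.coeff (n + 1) (H.heunOp f) =
      Polynomial.C (H.t * (n + 2) * (n + 1 + H.s₁)) * PowerSeries.coeff (n + 2) f
        - ((Polynomial.C ((1 + H.t) * (n + 1) * n
          + (H.s₁ * (1 + H.t) + H.s₂ * H.t + H.s₃) * (n + 1)) - Polynomial.X)
            * PowerSeries.coeff (n + 1) f
        - Polynomial.C ((n + H.r₁) * (n + H.r₂)) * PowerSeries.coeff n f) := by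
  have hn : ∀ k : ℕ, (k : Polynomial ℂ) = Polynomial.C (k : ℂ) := fun k => by simp
  have h : Polynomial.C ((n + H.r₁) * (n + H.r₂)) = Polynomial.C ((n : ℂ) * (n - 1))
      + Polynomial.C ((H.s₁ + H.s₂ + H.s₃) * n) + Polynomial.C (H.r₁ * H.r₂) := by
    rw [← map_add, ← map_add]
    congr 1
    linear_combination (n : ℂ) * H.fuchs
  rw [heunOp_eq, h]
  rcases n with _ | _ | n <;>
  · simp only [cst, LinearMap.map_add, LinearMap.map_sub, PowerSeries.coeff_C_mul, PowerSeries.coeff_zero_X_mul,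
      PowerSeries.coeff_succ_X_mul, PowerSeries.coeff_derivative]
    push_cast
    simp only [map_mul, map_add, map_sub, map_one, map_natCast, map_ofNat, map_zero]
    ring

/-- `f_λ` is the unique formal solution of `D_x f = 0` with `f(0) = 1`. -/
theorem heunSeries_iff (f : PowerSeries (Polynomial ℂ)) :
    (PowerSeries.constantCoeff f = 1 ∧ H.heunOp f = 0) ↔ f = H.heunSeries := by
  have h0 : Polynomial.C (H.t * H.s₁) * Polynomial.C (1 / (H.t * H.s₁)) = 1 := by
    rw [← Polynomial.C_mul, mul_one_div_cancel, Polynomial.C_1]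
    exact mul_ne_zero H.t_ne_zero (by simpa using H.add_s₁_ne 0)
  have h1 : ∀ n : ℕ, Polynomial.C (H.t * (n + 2) * (n + 1 + H.s₁))
      * Polynomial.C (1 / (H.t * (n + 2) * (n + 1 + H.s₁))) = 1 := by
    intro n
    rw [← Polynomial.C_mul, mul_one_div_cancel, Polynomial.C_1]
    refine mul_ne_zero (mul_ne_zero H.t_ne_zero ?_) (by simpa using H.add_s₁_ne (n + 1))
    exact_mod_cast (by omega : n + 2 ≠ 0)
  constructor
  · rintro ⟨hc, hf⟩
    ext1 n
    simp only [heunSeries, PowerSeries.coeff_mk]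
    induction n using Nat.twoStepInduction with
    | zero => simpa [P] using hc
    | one =>
      have := H.coeff_heunOp_zero f
      rw [hf, PowerSeries.coeff_zero_eq_constantCoeff_apply f, hc] at this
      simp only [map_zero] at this
      rw [P]
      linear_combination (-(PowerSeries.coeff 1 f)) * h0
        - Polynomial.C (1 / (H.t * H.s₁)) * this
    | more n ih1 ih2 =>
      have := H.coeff_heunOp_succ f n
      rw [hf, ih1, ih2] at this
      simp only [map_zero] at this
      rw [P]
      linear_combination (-(PowerSeries.coeff (n + 2) f)) * h1 n
        - Polynomial.C (1 / (H.t * (n + 2) * (n + 1 + H.s₁))) * this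
  · rintro rfl
    refine ⟨by simp [heunSeries, ← PowerSeries.coeff_zero_eq_constantCoeff_apply, P], ?_⟩
    ext1 n
    rcases n with _ | n
    · rw [coeff_heunOp_zero]
      simp only [heunSeries, PowerSeries.coeff_mk, map_zero, P]
      linear_combination (-Polynomial.X) * h0
    · rw [coeff_heunOp_succ]
      simp only [heunSeries, PowerSeries.coeff_mk, map_zero]
      rw [P]
      linear_combination ((Polynomial.C ((1 + H.t) * (n + 1) * n
          + (H.s₁ * (1 + H.t) + H.s₂ * H.t + H.s₃) * (n + 1)) - Polynomial.X) * H.P (n + 1)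
        - Polynomial.C ((n + H.r₁) * (n + H.r₂)) * H.P n) * h1 n

theorem P_degree (n : ℕ) : (H.P n).degree = n := by
  induction n using Nat.twoStepInduction with
  | zero => simp [P]
  | one =>
    have : H.t * H.s₁ ≠ 0 := mul_ne_zero H.t_ne_zero (by simpa using H.add_s₁_ne 0)
    rw [P, Polynomial.degree_C_mul (one_div_ne_zero this)]
    simp
  | more n ih1 ih2 =>
    have hne : H.t * (n + 2) * (n + 1 + H.s₁) ≠ 0 := by
      refine mul_ne_zero (mul_ne_zero H.t_ne_zero ?_) (by simpa using H.add_s₁_ne (n + 1))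
      exact_mod_cast (by omega : n + 2 ≠ 0)
    have hd : ∀ c : ℂ, ((Polynomial.C c - Polynomial.X) * H.P (n + 1)).degree
        = ((n + 2 : ℕ) : WithBot ℕ) := by
      intro c
      rw [Polynomial.degree_mul, ih2, ← Polynomial.degree_neg, neg_sub, Polynomial.degree_X_sub_C,
        ← Nat.cast_one, ← Nat.cast_add]
      congr 1
      omega
    rw [P, Polynomial.degree_C_mul (one_div_ne_zero hne), Polynomial.degree_sub_eq_left_of_degree_lt,
      hd]
    rw [hd, Polynomial.C_mul']
    refine lt_of_le_of_lt (Polynomial.degree_smul_le _ _) ?_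
    rw [ih1]
    exact_mod_cast (by omega : n < n + 2)

/-- The sequence `P_0, P_1, …`, with `deg P_i = i`. -/
def seq : Polynomial.Sequence ℂ := ⟨H.P, H.P_degree⟩

/-- `P_0, P_1, …` as a basis of `ℂ[λ]`. -/
def basis : Module.Basis ℕ ℂ (Polynomial ℂ) :=
  H.seq.basis fun i => (Polynomial.leadingCoeff_ne_zero.mpr (H.seq.ne_zero i)).isUnit

/-- The structure constants: `P_i P_j = ∑_k C i j k • P_k`. -/
def structConst (i j k : ℕ) : ℂ := H.basis.repr (H.P i * H.P j) k

/-- The terms `C_{ij}^k x₁^i x₂^j / y^{k+1}` of the generating function. -/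
def kernelTerm (x₁ x₂ y : ℂ) (m : ℕ × ℕ × ℕ) : ℂ :=
  H.structConst m.1 m.2.1 m.2.2 * x₁ ^ m.1 * x₂ ^ m.2.1 / y ^ (m.2.2 + 1)

/-- The multiplication kernel `K(x₁,x₂,y)`. -/
def kernel (x₁ x₂ y : ℂ) : ℂ := ∑' m : ℕ × ℕ × ℕ, H.kernelTerm x₁ x₂ y m

/-- `u = x₁ x₂ / t`. -/
def u (x₁ x₂ : ℂ) : ℂ := x₁ * x₂ / H.t

/-- `v = (x₁-1)(x₂-1)(y-1) / (t-1)²`. -/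
def v (x₁ x₂ y : ℂ) : ℂ := (x₁ - 1) * (x₂ - 1) * (y - 1) / (H.t - 1) ^ 2

/-- `w = (x₁-t)(x₂-t)(y-t) / (t(t-1)²)`. -/
def w (x₁ x₂ y : ℂ) : ℂ := (x₁ - H.t) * (x₂ - H.t) * (y - H.t) / (H.t * (H.t - 1) ^ 2)

/-- `Q = (v-w)² - 2(v+w)(uq-1) + (uq-1)²`. -/
def Q (x₁ x₂ y : ℂ) (q : ℝ) : ℂ :=
  (H.v x₁ x₂ y - H.w x₁ x₂ y) ^ 2
    - 2 * (H.v x₁ x₂ y + H.w x₁ x₂ y) * (H.u x₁ x₂ * q - 1) + (H.u x₁ x₂ * q - 1) ^ 2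

/-- The square root `Q^{1/2}`. For small `x₁, x₂` the quotient of `Q` by `(y/(1-t))²` is close to
`1`, and `v - w = (y/(1-t)) (1 - u) + O(1)` as `y → ∞`. -/
def sqrtQ (x₁ x₂ y : ℂ) (q : ℝ) : ℂ :=
  y / (1 - H.t) * (H.Q x₁ x₂ y q * ((1 - H.t) / y) ^ 2) ^ (1 / 2 : ℂ)

/-- `-uq - v + w + 1 + Q^{1/2}`. -/
def A (x₁ x₂ y : ℂ) (q : ℝ) : ℂ :=
  -(H.u x₁ x₂ * q) - H.v x₁ x₂ y + H.w x₁ x₂ y + 1 + H.sqrtQ x₁ x₂ y q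

/-- `-uq + v - w + 1 - Q^{1/2}`. -/
def B (x₁ x₂ y : ℂ) (q : ℝ) : ℂ :=
  -(H.u x₁ x₂ * q) + H.v x₁ x₂ y - H.w x₁ x₂ y + 1 - H.sqrtQ x₁ x₂ y q

/-- The power `z^e` computed with the branch of the logarithm on
`{z | z / exp ℓ ∉ (-∞, 0]}` that takes the value `ℓ` at `exp ℓ`. -/
def branchPow (ℓ z e : ℂ) : ℂ := Complex.exp (e * (ℓ + Complex.log (z / Complex.exp ℓ)))

/-- The integrand of the one-dimensional representation. -/
def integrand₁ (ℓ₂ ℓ₃ x₁ x₂ y : ℂ) (q : ℝ) : ℂ :=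
  ordinaryHypergeometric (H.r₁ - 1) (H.r₂ - 1) (H.s₁ - 1) (H.u x₁ x₂ * q)
    * (q : ℂ) ^ (H.s₁ - 2) * (H.sqrtQ x₁ x₂ y q)⁻¹
    * branchPow ℓ₂ (H.A x₁ x₂ y q) (H.s₂ - 1) * branchPow ℓ₃ (H.B x₁ x₂ y q) (H.s₃ - 1)

/-- `q₁ = (-uq - v + w + 1 + Q^{1/2}) / (2(1 - pqu))`. -/
def q₁ (x₁ x₂ y : ℂ) (p q : ℝ) : ℂ := H.A x₁ x₂ y q / (2 * (1 - p * q * H.u x₁ x₂))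

/-- `q₂ = (-uq + v - w + 1 - Q^{1/2}) / (2(1 - pqu))`. -/
def q₂ (x₁ x₂ y : ℂ) (p q : ℝ) : ℂ := H.B x₁ x₂ y q / (2 * (1 - p * q * H.u x₁ x₂))

/-- The coefficient of `dp ∧ dq` in the pullback of the 2-form `g(q₁,q₂) dq₁ ∧ dq₂` under
`(p,q) ↦ (q₁(p,q), q₂(p,q))`. -/
def pullback (x₁ x₂ y : ℂ) (g : ℂ → ℂ → ℂ) (z : ℝ × ℝ) : ℂ :=
  g (H.q₁ x₁ x₂ y z.1 z.2) (H.q₂ x₁ x₂ y z.1 z.2) *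
    (deriv (fun p => H.q₁ x₁ x₂ y p z.2) z.1 * deriv (fun q => H.q₂ x₁ x₂ y z.1 q) z.2
      - deriv (fun q => H.q₁ x₁ x₂ y z.1 q) z.2 * deriv (fun p => H.q₂ x₁ x₂ y p z.2) z.1)

/-- `∫_D g(q₁,q₂) dq₁ dq₂`, where `D` is the image of the unit square of the `(p,q)`-plane. -/
def integralD (x₁ x₂ y : ℂ) (g : ℂ → ℂ → ℂ) : ℂ :=
  ∫ z in Set.Icc (0 : ℝ) 1 ×ˢ Set.Icc (0 : ℝ) 1, H.pullback x₁ x₂ y g z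

/-- Absolute convergence of `∫_D g(q₁,q₂) dq₁ dq₂`. -/
def IntegrableD (x₁ x₂ y : ℂ) (g : ℂ → ℂ → ℂ) : Prop :=
  MeasureTheory.IntegrableOn (H.pullback x₁ x₂ y g) (Set.Icc (0 : ℝ) 1 ×ˢ Set.Icc (0 : ℝ) 1)

/-- The integrand `q₁^{s₂-1} q₂^{s₃-1} (1-q₁-q₂)^{s₁-r₁-1} (1 + v/q₁ + w/q₂)^{r₁-2} / (q₁ q₂)` of
the two-dimensional representation. -/
def integrand₂ (ℓ₁ ℓ₂ ℓ₃ x₁ x₂ y q₁ q₂ : ℂ) : ℂ :=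
  branchPow ℓ₂ q₁ (H.s₂ - 1) * branchPow ℓ₃ q₂ (H.s₃ - 1)
    * branchPow ℓ₁ (1 - q₁ - q₂) (H.s₁ - H.r₁ - 1)
    * branchPow ℓ₁ (1 + H.v x₁ x₂ y / q₁ + H.w x₁ x₂ y / q₂) (H.r₁ - 2) * (1 / q₁) * (1 / q₂)

/-- The kernel (a multivalued function) with auxiliary variables `q₁, q₂`
`(x₁x₂)^{1-s₁} ((x₁-1)(x₂-1))^{1-s₂} ((x₁-t)(x₂-t))^{1-s₃} (1-q₁-q₂)^{s₁-r-1} q₁^{s₂-r} q₂^{s₃-r}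
(q₁q₂ + w q₁ + v q₂)^{r-2}` with `r = r₁`. Here `m₁, m₂, m₃` are logarithms of `x₁x₂`,
`(x₁-1)(x₂-1)`, `(x₁-t)(x₂-t)`, and `ℓ₁, ℓ₂, ℓ₃` fix the branches of the powers in `q₁, q₂`. -/
def auxKernel (m₁ m₂ m₃ ℓ₁ ℓ₂ ℓ₃ x₁ x₂ y q₁ q₂ : ℂ) : ℂ :=
  Complex.exp ((1 - H.s₁) * m₁) * Complex.exp ((1 - H.s₂) * m₂) * Complex.exp ((1 - H.s₃) * m₃)
    * branchPow ℓ₁ (1 - q₁ - q₂) (H.s₁ - H.r₁ - 1)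
    * branchPow ℓ₂ q₁ (H.s₂ - H.r₁) * branchPow ℓ₃ q₂ (H.s₃ - H.r₁)
    * branchPow (ℓ₁ + ℓ₂ + ℓ₃) (q₁ * q₂ + H.w x₁ x₂ y * q₁ + H.v x₁ x₂ y * q₂) (H.r₁ - 2)

end HeunParams

end

noncomputable section

namespace HeunParams

variable (H : HeunParams)

/-- The coefficient of `x^{n}` contributed by `x^{n+1}` under the Heun operator. -/
def upCoeff (n : ℕ) : ℂ := H.t * (n + 1) * (n + H.s₁)

/-- Minus the diagonal coefficient of the Heun operator. -/
def midCoeff (n : ℕ) : ℂ :=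
  (1 + H.t) * n * (n - 1) + (H.s₁ * (1 + H.t) + H.s₂ * H.t + H.s₃) * n

/-- The coefficient of `x^{n+1}` contributed by `x^n` under the Heun operator. -/
def lowCoeff (n : ℕ) : ℂ := (n + H.r₁) * (n + H.r₂)

/-- Shift of a sequence to the right, with a zero inserted at the front. -/
def shiftRight (a : ℕ → ℂ) : ℕ → ℂ
  | 0 => 0
  | n + 1 => a n

@[simp] theorem shiftRight_zero (a : ℕ → ℂ) : shiftRight a 0 = 0 := rfl

@[simp] theorem shiftRight_succ (a : ℕ → ℂ) (n : ℕ) : shiftRight a (n + 1) = a n := rfl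

theorem upCoeff_ne (n : ℕ) : H.upCoeff n ≠ 0 :=
  mul_ne_zero (mul_ne_zero H.t_ne_zero (Nat.cast_add_one_ne_zero n)) (H.add_s₁_ne n)

theorem X_mul_P_zero : Polynomial.X * H.P 0 = Polynomial.C (H.midCoeff 0) * H.P 0
    - Polynomial.C (H.upCoeff 0) * H.P 1 := by
  have h0 : Polynomial.C (H.t * H.s₁) * Polynomial.C (1 / (H.t * H.s₁)) = 1 := by
    rw [← Polynomial.C_mul, mul_one_div_cancel, Polynomial.C_1]
    exact mul_ne_zero H.t_ne_zero (by simpa using H.add_s₁_ne 0)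
  have e1 : H.upCoeff 0 = H.t * H.s₁ := by simp [upCoeff]
  have e2 : H.midCoeff 0 = 0 := by simp [midCoeff]
  rw [e1, e2, P, P, map_zero]
  linear_combination (-Polynomial.X) * h0

theorem X_mul_P_succ (n : ℕ) : Polynomial.X * H.P (n + 1) =
    Polynomial.C (H.midCoeff (n + 1)) * H.P (n + 1)
    - Polynomial.C (H.upCoeff (n + 1)) * H.P (n + 2) - Polynomial.C (H.lowCoeff n) * H.P n := by
  have h1 : Polynomial.C (H.t * (n + 2) * (n + 1 + H.s₁))
      * Polynomial.C (1 / (H.t * (n + 2) * (n + 1 + H.s₁))) = 1 := by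
    rw [← Polynomial.C_mul, mul_one_div_cancel, Polynomial.C_1]
    refine mul_ne_zero (mul_ne_zero H.t_ne_zero ?_) (by simpa using H.add_s₁_ne (n + 1))
    exact_mod_cast (by omega : n + 2 ≠ 0)
  have e1 : H.upCoeff (n + 1) = H.t * (n + 2) * (n + 1 + H.s₁) := by
    simp only [upCoeff]; push_cast; ring
  have e2 : H.midCoeff (n + 1) = (1 + H.t) * (n + 1) * n
          + (H.s₁ * (1 + H.t) + H.s₂ * H.t + H.s₃) * (n + 1) := by
    simp only [midCoeff]; push_cast; ring
  rw [e1, e2, lowCoeff, P]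
  linear_combination (((Polynomial.C ((1 + H.t) * (n + 1) * n
          + (H.s₁ * (1 + H.t) + H.s₂ * H.t + H.s₃) * (n + 1)) - Polynomial.X) * P H (n + 1)
        - Polynomial.C ((n + H.r₁) * (n + H.r₂)) * P H n)) * h1

theorem basis_apply (n : ℕ) : H.basis n = H.P n := by
  simp [basis, seq]

theorem repr_P (n k : ℕ) : H.basis.repr (H.P n) k = if n = k then 1 else 0 := by
  rw [← basis_apply, Module.Basis.repr_self, Finsupp.single_apply]

/-- Multiplication by `λ` in the basis `P_0, P_1, …`. -/
theorem repr_X_mul (p : Polynomial ℂ) (k : ℕ) :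
    H.basis.repr (Polynomial.X * p) k = H.midCoeff k * H.basis.repr p k
      - shiftRight (fun n => H.upCoeff n * H.basis.repr p n) k
      - H.lowCoeff k * H.basis.repr p (k + 1) := by
  have hC : ∀ (c : ℂ) (q : Polynomial ℂ) (l : ℕ),
      H.basis.repr (Polynomial.C c * q) l = c * H.basis.repr q l := by
    intro c q l
    rw [Polynomial.C_mul', map_smul, Finsupp.smul_apply, smul_eq_mul]
  induction H.basis.mem_span p using Submodule.span_induction with
  | zero => rcases k with _ | k <;> simp
  | add p q _ _ hp hq =>
    have hadd : ∀ (q q' : Polynomial ℂ) (l : ℕ),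
        H.basis.repr (q + q') l = H.basis.repr q l + H.basis.repr q' l := by
      intro q q' l
      rw [map_add, Finsupp.add_apply]
    rw [mul_add, hadd, hp, hq]
    simp only [hadd]
    rcases k with _ | k <;> simp only [shiftRight_zero, shiftRight_succ] <;> ring
  | smul c p _ hp =>
    rw [mul_smul_comm, map_smul, Finsupp.smul_apply, hp, map_smul]
    rcases k with _ | k <;> simp <;> ring
  | mem p hp =>
    obtain ⟨n, rfl⟩ := hp
    rw [basis_apply]
    rcases n with _ | n
    · rw [X_mul_P_zero, map_sub, Finsupp.sub_apply, hC, hC]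
      simp only [repr_P]
      rcases k with _ | _ | k <;> simp
    · rw [X_mul_P_succ, map_sub, map_sub, Finsupp.sub_apply, Finsupp.sub_apply, hC, hC, hC]
      simp only [repr_P]
      rcases k with _ | k
      · rcases n with _ | n <;> simp
      · simp only [shiftRight_succ]
        have e : ∀ a b : ℕ, (a + 1 = b + 1) = (a = b) := fun a b => by simp
        simp only [e]
        by_cases h1 : n + 1 = k
        · subst h1
          simp [show ¬ n = n + 1 + 1 by omega]
        · by_cases h2 : n = k + 1
          · subst h2
            simp [show ¬ k + 1 + 1 = k by omega]
          · by_cases h3 : n = k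
            · subst h3; simp
            · simp [h1, h2, h3]

theorem structConst_comm (i j k : ℕ) : H.structConst i j k = H.structConst j i k := by
  rw [structConst, structConst, mul_comm]

theorem structConst_zero (j k : ℕ) : H.structConst 0 j k = if j = k then 1 else 0 := by
  rw [structConst, P, one_mul, repr_P]

/-- The recursion for the structure constants, from the associativity `(λ P_i) P_j = λ (P_i P_j)`. -/
theorem structConst_succ (i j k : ℕ) :
    H.upCoeff i * H.structConst (i + 1) j k =
      (H.midCoeff i - H.midCoeff k) * H.structConst i j k
      - shiftRight (fun n => H.lowCoeff n * H.structConst n j k) i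
      + shiftRight (fun n => H.upCoeff n * H.structConst i j n) k
      + H.lowCoeff k * H.structConst i j (k + 1) := by
  have hC : ∀ (c : ℂ) (q : Polynomial ℂ) (l : ℕ),
      H.basis.repr (Polynomial.C c * q) l = c * H.basis.repr q l := by
    intro c q l
    rw [Polynomial.C_mul', map_smul, Finsupp.smul_apply, smul_eq_mul]
  have h := H.repr_X_mul (H.P i * H.P j) k
  rw [← mul_assoc] at h
  rcases i with _ | i
  · rw [X_mul_P_zero, sub_mul, mul_assoc, mul_assoc, map_sub, Finsupp.sub_apply, hC, hC] at h
    simp only [structConst, shiftRight_zero]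
    linear_combination -h
  · rw [X_mul_P_succ, sub_mul, sub_mul, mul_assoc, mul_assoc, mul_assoc, map_sub, map_sub,
      Finsupp.sub_apply, Finsupp.sub_apply, hC, hC, hC] at h
    simp only [structConst, shiftRight_succ]
    linear_combination -h


theorem norm_coeffs_le (n : ℕ) :
    ‖H.upCoeff n‖ ≤ ‖H.t‖ * (1 + ‖H.s₁‖) * (n + 1) ^ 2 ∧
    ‖H.midCoeff n‖ ≤
      (‖1 + H.t‖ + ‖H.s₁ * (1 + H.t) + H.s₂ * H.t + H.s₃‖) * (n + 1) ^ 2 ∧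
    ‖H.lowCoeff n‖ ≤ (1 + ‖H.r₁‖) * (1 + ‖H.r₂‖) * (n + 1) ^ 2 := by
  have hn : ‖(n : ℂ)‖ = n := by simp
  have hn0 : (0 : ℝ) ≤ n := n.cast_nonneg
  have key : ∀ r : ℂ, ‖(n : ℂ) + r‖ ≤ (1 + ‖r‖) * (n + 1) := by
    intro r
    refine (norm_add_le _ _).trans ?_
    rw [hn]
    nlinarith [norm_nonneg r]
  refine ⟨?_, ?_, ?_⟩
  · have h1 : ‖(n : ℂ) + 1‖ = n + 1 := by
      rw [← Nat.cast_add_one, Complex.norm_natCast, Nat.cast_add_one]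
    rw [upCoeff, norm_mul, norm_mul, h1]
    calc ‖H.t‖ * (n + 1) * ‖(n : ℂ) + H.s₁‖ ≤ ‖H.t‖ * (n + 1) * ((1 + ‖H.s₁‖) * (n + 1)) := by
          gcongr; exact key _
      _ = _ := by ring
  · have h1 : ‖(n : ℂ) - 1‖ ≤ n + 1 := by
      refine (norm_sub_le _ _).trans ?_
      simp
    rw [midCoeff]
    refine (norm_add_le _ _).trans ?_
    rw [norm_mul, norm_mul, norm_mul, hn, add_mul]
    gcongr ?_ + ?_
    · calc ‖1 + H.t‖ * n * ‖(n : ℂ) - 1‖ ≤ ‖1 + H.t‖ * (n + 1) * (n + 1) := by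
            gcongr; linarith
        _ = _ := by ring
    · gcongr
      nlinarith
  · rw [lowCoeff, norm_mul]
    calc ‖(n : ℂ) + H.r₁‖ * ‖(n : ℂ) + H.r₂‖
        ≤ ((1 + ‖H.r₁‖) * (n + 1)) * ((1 + ‖H.r₂‖) * (n + 1)) := by
          gcongr <;> exact key _
      _ = _ := by ring

theorem norm_upCoeff_ge (hs : 1 < H.s₁.re) (n : ℕ) :
    ‖H.t‖ * (n + 1) ^ 2 ≤ ‖H.upCoeff n‖ := by
  have h1 : ‖(n : ℂ) + 1‖ = n + 1 := by
    rw [← Nat.cast_add_one, Complex.norm_natCast, Nat.cast_add_one]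
  have h2 : (n : ℝ) + 1 ≤ ‖(n : ℂ) + H.s₁‖ := by
    refine le_trans ?_ (Complex.re_le_norm _)
    simp
    linarith
  rw [upCoeff, norm_mul, norm_mul, h1]
  calc ‖H.t‖ * (n + 1) ^ 2 = ‖H.t‖ * (n + 1) * (n + 1) := by ring
    _ ≤ _ := by gcongr

/-- The structure constants grow at most geometrically and are supported on `k ≤ i + j`. -/
theorem exists_structConst_bound (hs : 1 < H.s₁.re) :
    ∃ M : ℝ, 1 ≤ M ∧ ∀ i j k : ℕ, ‖H.structConst i j k‖ ≤ M ^ (i + j) ∧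
      (i + j < k → H.structConst i j k = 0) := by
  obtain ⟨c, hc0, hc⟩ : ∃ c : ℝ, 0 ≤ c ∧ ∀ n : ℕ, ‖H.upCoeff n‖ ≤ c * (n + 1) ^ 2 ∧
      ‖H.midCoeff n‖ ≤ c * (n + 1) ^ 2 ∧ ‖H.lowCoeff n‖ ≤ c * (n + 1) ^ 2 := by
    set A := ‖H.t‖ * (1 + ‖H.s₁‖)
    set B := ‖1 + H.t‖ + ‖H.s₁ * (1 + H.t) + H.s₂ * H.t + H.s₃‖
    set C := (1 + ‖H.r₁‖) * (1 + ‖H.r₂‖)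
    have hA : 0 ≤ A := by positivity
    have hB : 0 ≤ B := by positivity
    have hC : 0 ≤ C := by positivity
    refine ⟨A + B + C, by positivity, fun n => ?_⟩
    obtain ⟨h1, h2, h3⟩ := H.norm_coeffs_le n
    have hn : (0 : ℝ) ≤ (n + 1) ^ 2 := by positivity
    exact ⟨h1.trans (mul_le_mul_of_nonneg_right (by linarith) hn),
      h2.trans (mul_le_mul_of_nonneg_right (by linarith) hn),
      h3.trans (mul_le_mul_of_nonneg_right (by linarith) hn)⟩
  have ht : 0 < ‖H.t‖ := norm_pos_iff.mpr H.t_ne_zero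
  set M : ℝ := 1 + 45 * c / ‖H.t‖ with hM
  have hM1 : 1 ≤ M := by
    have : 0 ≤ 45 * c / ‖H.t‖ := by positivity
    linarith
  refine ⟨M, hM1, ?_⟩
  have main : ∀ n i j : ℕ, i + j ≤ n → ∀ k, ‖H.structConst i j k‖ ≤ M ^ (i + j) ∧
      (i + j < k → H.structConst i j k = 0) := by
    intro n
    induction n with
    | zero =>
      intro i j hij k
      obtain rfl : i = 0 := by omega
      obtain rfl : j = 0 := by omega
      rw [structConst_zero]
      split_ifs with h
      · simp [← h]
      · simp
    | succ n ih =>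
      have wlog_step : ∀ i j : ℕ, i + 1 + j ≤ n + 1 → j ≤ i + 1 → ∀ k,
          ‖H.structConst (i + 1) j k‖ ≤ M ^ (i + 1 + j) ∧
          (i + 1 + j < k → H.structConst (i + 1) j k = 0) := by
        intro i j hij hji k
        have hrec := H.structConst_succ i j k
        have h0 : i + 1 + j < k → H.structConst (i + 1) j k = 0 := by
          intro hk
          have e1 := (ih i j (by omega) k).2 (by omega)
          have e2 := (ih i j (by omega) (k + 1)).2 (by omega)
          have e3 : shiftRight (fun n => H.lowCoeff n * H.structConst n j k) i = 0 := by
            rcases i with _ | i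
            · rfl
            · rw [shiftRight_succ, (ih i j (by omega) k).2 (by omega), mul_zero]
          have e4 : shiftRight (fun n => H.upCoeff n * H.structConst i j n) k = 0 := by
            rcases k with _ | k
            · rfl
            · rw [shiftRight_succ, (ih i j (by omega) k).2 (by omega), mul_zero]
          rw [e1, e2, e3, e4] at hrec
          simpa [H.upCoeff_ne i] using hrec
        refine ⟨?_, h0⟩
        by_cases hk : i + 1 + j < k
        · rw [h0 hk]
          simp only [norm_zero]
          positivity
        have hki : (k : ℝ) + 1 ≤ 3 * (i + 1) := by
          have : k + 1 ≤ 3 * (i + 1) := by omega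
          exact_mod_cast this
        set T : ℝ := 9 * c * (i + 1) ^ 2 with hT
        have hT0 : 0 ≤ T := by positivity
        have hsq : ∀ l : ℕ, (l : ℝ) + 1 ≤ 3 * (i + 1) → c * ((l : ℝ) + 1) ^ 2 ≤ T := by
          intro l hl
          rw [hT]
          calc c * ((l : ℝ) + 1) ^ 2 ≤ c * (3 * (i + 1)) ^ 2 := by gcongr
            _ = _ := by ring
        have hi1 : (0 : ℝ) ≤ i := i.cast_nonneg
        have hMn : 0 ≤ M ^ (i + j) := by positivity
        have b1 : ‖(H.midCoeff i - H.midCoeff k) * H.structConst i j k‖ ≤ (T + T) * M ^ (i + j) := by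
          rw [norm_mul]
          gcongr
          · refine (norm_sub_le _ _).trans ?_
            gcongr
            · exact (hc i).2.1.trans (hsq i (by linarith))
            · exact (hc k).2.1.trans (hsq k hki)
          · exact (ih i j (by omega) k).1
        have b2 : ‖shiftRight (fun n => H.lowCoeff n * H.structConst n j k) i‖
            ≤ T * M ^ (i + j) := by
          rcases i with _ | i
          · simp only [shiftRight_zero, norm_zero]; positivity
          · rw [shiftRight_succ, norm_mul]
            gcongr
            · refine (hc i).2.2.trans (hsq i ?_)
              push_cast
              linarith [(Nat.cast_nonneg i : (0 : ℝ) ≤ i)]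
            · refine (ih i j (by omega) k).1.trans ?_
              exact pow_le_pow_right₀ hM1 (by omega)
        have b3 : ‖shiftRight (fun n => H.upCoeff n * H.structConst i j n) k‖
            ≤ T * M ^ (i + j) := by
          rcases k with _ | k
          · simp only [shiftRight_zero, norm_zero]; positivity
          · rw [shiftRight_succ, norm_mul]
            gcongr
            · refine (hc k).1.trans (hsq k ?_)
              push_cast at hki
              linarith
            · exact (ih i j (by omega) k).1
        have b4 : ‖H.lowCoeff k * H.structConst i j (k + 1)‖ ≤ T * M ^ (i + j) := by
          rw [norm_mul]
          gcongr
          · exact (hc k).2.2.trans (hsq k hki)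
          · exact (ih i j (by omega) (k + 1)).1
        have hle : ‖H.upCoeff i‖ * ‖H.structConst (i + 1) j k‖ ≤ 5 * T * M ^ (i + j) := by
          rw [← norm_mul, hrec]
          refine (norm_add_le _ _).trans ?_
          refine (add_le_add_left (norm_add_le _ _) _).trans ?_
          refine (add_le_add_left (add_le_add_left (norm_sub_le _ _) _) _).trans ?_
          linarith
        have hlow := H.norm_upCoeff_ge hs i
        have hpos : 0 < ‖H.t‖ * ((i : ℝ) + 1) ^ 2 := by positivity
        have h3 : ‖H.t‖ * ((i : ℝ) + 1) ^ 2 * ‖H.structConst (i + 1) j k‖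
            ≤ ‖H.t‖ * ((i : ℝ) + 1) ^ 2 * (45 * c / ‖H.t‖ * M ^ (i + j)) := by
          refine (mul_le_mul_of_nonneg_right hlow (norm_nonneg _)).trans (hle.trans (le_of_eq ?_))
          rw [hT]
          field_simp
          ring
        refine (le_of_mul_le_mul_left h3 hpos).trans ?_
        rw [show i + 1 + j = i + j + 1 by ring, pow_succ, mul_comm]
        gcongr
        rw [hM]
        linarith
      intro i j hij k
      rcases Nat.lt_or_ge i j with hlt | hge
      · obtain ⟨j, rfl⟩ : ∃ j', j = j' + 1 := ⟨j - 1, by omega⟩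
        rw [structConst_comm, add_comm i (j + 1)]
        exact wlog_step j i (by omega) (by omega) k
      · rcases i with _ | i
        · exact ih 0 j (by omega) k
        · exact wlog_step i j hij (by omega) k
  exact fun i j k => main (i + j) i j le_rfl k

end HeunParams

end

noncomputable section

namespace HeunParams

/-- The sum of the power series with coefficients `a`. -/
def pser (a : ℕ → ℂ) (z : ℂ) : ℂ := ∑' n, a n * z ^ n

/-- The power series with coefficients `a` converges on the disc of radius `r`. -/
def SumOn (a : ℕ → ℂ) (r : ℝ) : Prop := ∀ z : ℂ, ‖z‖ < r → Summable fun n => a n * z ^ n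

/-- The coefficients of the derivative of a power series. -/
def dcoef (a : ℕ → ℂ) (n : ℕ) : ℂ := (n + 1) * a (n + 1)

theorem SumOn.hasSum {a : ℕ → ℂ} {r : ℝ} (h : SumOn a r) {z : ℂ} (hz : ‖z‖ < r) :
    HasSum (fun n => a n * z ^ n) (pser a z) := (h z hz).hasSum

theorem sumOn_of_le {a : ℕ → ℂ} {C M : ℝ} (hM : 0 < M) (h : ∀ n, ‖a n‖ ≤ C * M ^ n) :
    SumOn a (1 / M) := by
  intro z hz
  have h1 : M * ‖z‖ < 1 := by rwa [lt_div_iff₀ hM, mul_comm] at hz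
  refine Summable.of_norm_bounded
    ((summable_geometric_of_lt_one (by positivity) h1).mul_left C) fun n => ?_
  rw [norm_mul, norm_pow, mul_pow, ← mul_assoc]
  gcongr
  exact h n

theorem SumOn.hasSum_shiftRight {a : ℕ → ℂ} {r : ℝ} (ha : SumOn a r) {z : ℂ} (hz : ‖z‖ < r) :
    HasSum (fun n => shiftRight a n * z ^ n) (z * pser a z) := by
  rw [← hasSum_nat_add_iff' 1]
  simp only [shiftRight_succ, Finset.range_one, Finset.sum_singleton, shiftRight_zero, zero_mul,
    sub_zero]
  refine ((ha.hasSum hz).mul_left z).congr_fun ?_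
  intro n
  ring

theorem SumOn.shiftRight {a : ℕ → ℂ} {r : ℝ} (ha : SumOn a r) : SumOn (shiftRight a) r :=
  fun _ hz => (ha.hasSum_shiftRight hz).summable

theorem pser_shiftRight {a : ℕ → ℂ} {r : ℝ} (ha : SumOn a r) {z : ℂ} (hz : ‖z‖ < r) :
    pser (HeunParams.shiftRight a) z = z * pser a z := (ha.hasSum_shiftRight hz).tsum_eq

theorem pser_zero (a : ℕ → ℂ) : pser a 0 = a 0 := by
  rw [pser, tsum_eq_single 0]
  · simp
  · intro n hn
    simp [hn]

theorem SumOn.aux {a : ℕ → ℂ} {r : ℝ} (ha : SumOn a r) {z : ℂ} (hz : ‖z‖ < r) :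
    HasSum (fun n => dcoef a n * z ^ n) (deriv (pser a) z) ∧ DifferentiableAt ℂ (pser a) z := by
  obtain ⟨ρ, hzρ, hρr⟩ := exists_between hz
  have hρ : 0 < ρ := (norm_nonneg z).trans_lt hzρ
  have hu : Summable fun n => ‖a n‖ * ρ ^ n := by
    have := (ha (ρ : ℂ) (by rwa [Complex.norm_real, Real.norm_of_nonneg hρ.le])).norm
    simpa [norm_mul, norm_pow, abs_of_pos hρ] using this
  have hd : ∀ n : ℕ, DifferentiableOn ℂ (fun w : ℂ => a n * w ^ n) (Metric.ball 0 ρ) :=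
    fun n => by fun_prop
  have hle : ∀ (n : ℕ) (w : ℂ), w ∈ Metric.ball (0 : ℂ) ρ → ‖a n * w ^ n‖ ≤ ‖a n‖ * ρ ^ n := by
    intro n w hw
    rw [mem_ball_zero_iff] at hw
    rw [norm_mul, norm_pow]
    gcongr
  have hzm : z ∈ Metric.ball (0 : ℂ) ρ := by simpa using hzρ
  constructor
  · have h := Complex.hasSum_deriv_of_summable_norm hu hd Metric.isOpen_ball hle hzm
    have e : ∀ n : ℕ, deriv (fun w : ℂ => a n * w ^ n) z = a n * (n * z ^ (n - 1)) := by
      intro n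
      simp
    simp only [e] at h
    rw [← hasSum_nat_add_iff' 1] at h
    simp only [Finset.range_one, Finset.sum_singleton, Nat.cast_zero, zero_mul, mul_zero, sub_zero,
      Nat.add_sub_cancel] at h
    refine h.congr_fun ?_
    intro n
    rw [dcoef]
    push_cast
    ring
  · exact (Complex.differentiableOn_tsum_of_summable_norm hu hd Metric.isOpen_ball hle).differentiableAt
      (Metric.isOpen_ball.mem_nhds hzm)

theorem SumOn.dcoef {a : ℕ → ℂ} {r : ℝ} (ha : SumOn a r) : SumOn (dcoef a) r :=
  fun _ hz => (ha.aux hz).1.summable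

theorem SumOn.hasDerivAt {a : ℕ → ℂ} {r : ℝ} (ha : SumOn a r) {z : ℂ} (hz : ‖z‖ < r) :
    HasDerivAt (pser a) (pser (HeunParams.dcoef a) z) z := by
  have := (ha.aux hz).2.hasDerivAt
  rwa [← (ha.aux hz).1.tsum_eq] at this

/-- The coefficients of the Gauss hypergeometric series. -/
def hypCoef (a b c : ℂ) (n : ℕ) : ℂ := ordinaryHypergeometricCoefficient a b c n

theorem ordinaryHypergeometric_eq_pser (a b c : ℂ) :
    (ordinaryHypergeometric a b c : ℂ → ℂ) = pser (hypCoef a b c) := by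
  rw [ordinaryHypergeometric_eq_tsum]
  rfl

theorem add_natCast_ne {c : ℂ} (hc : 0 < c.re) (n : ℕ) : c + n ≠ 0 := by
  intro h
  have := congrArg Complex.re h
  simp at this
  linarith [(Nat.cast_nonneg n : (0 : ℝ) ≤ n)]

theorem hypCoef_zero (a b c : ℂ) : hypCoef a b c 0 = 1 := by
  simp [hypCoef, ordinaryHypergeometricCoefficient]

theorem hypCoef_succ (a b : ℂ) {c : ℂ} (hc : 0 < c.re) (n : ℕ) :
    (n + 1) * (c + n) * hypCoef a b c (n + 1) = (a + n) * (b + n) * hypCoef a b c n := by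
  have h1 := add_natCast_ne hc n
  have h2 : (n : ℂ) + 1 ≠ 0 := Nat.cast_add_one_ne_zero n
  have h3 : (n.factorial : ℂ) ≠ 0 := by exact_mod_cast n.factorial_ne_zero
  simp only [hypCoef, ordinaryHypergeometricCoefficient, ascPochhammer_succ_eval, Nat.factorial_succ,
    Nat.cast_mul, Nat.cast_add_one, mul_inv]
  field_simp

theorem exists_hypCoef_bound (a b : ℂ) {c : ℂ} (hc : 0 < c.re) :
    ∃ M : ℝ, 1 ≤ M ∧ ∀ n, ‖hypCoef a b c n‖ ≤ M ^ n := by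
  set d := min 1 c.re with hd
  have hd0 : 0 < d := lt_min one_pos hc
  have hd1 : d ≤ 1 := min_le_left _ _
  set M := (1 + ‖a‖) * (1 + ‖b‖) / d with hM
  have hab : 1 ≤ (1 + ‖a‖) * (1 + ‖b‖) := by nlinarith [norm_nonneg a, norm_nonneg b]
  refine ⟨M, ?_, fun n => ?_⟩
  · rw [hM, le_div_iff₀ hd0]
    linarith
  induction n with
  | zero => simp [hypCoef_zero]
  | succ n ih =>
    have hn : (0 : ℝ) ≤ n := n.cast_nonneg
    have key : ∀ r : ℂ, ‖r + n‖ ≤ (1 + ‖r‖) * (n + 1) := by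
      intro r
      refine (norm_add_le _ _).trans ?_
      rw [Complex.norm_natCast]
      nlinarith [norm_nonneg r]
    have hcn : d * (n + 1) ≤ ‖c + n‖ := by
      refine le_trans ?_ (Complex.re_le_norm _)
      simp only [Complex.add_re, Complex.natCast_re]
      nlinarith [min_le_right (1 : ℝ) c.re]
    have h := congrArg norm (hypCoef_succ a b hc n)
    rw [norm_mul, norm_mul, norm_mul, norm_mul] at h
    have hn1 : ‖(n : ℂ) + 1‖ = n + 1 := by
      rw [← Nat.cast_add_one, Complex.norm_natCast, Nat.cast_add_one]
    rw [hn1] at h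
    have hpos : 0 < ((n : ℝ) + 1) * (d * (n + 1)) := by positivity
    refine le_of_mul_le_mul_left ?_ hpos
    calc ((n : ℝ) + 1) * (d * (n + 1)) * ‖hypCoef a b c (n + 1)‖
        ≤ ((n : ℝ) + 1) * ‖c + n‖ * ‖hypCoef a b c (n + 1)‖ := by gcongr
      _ = ‖a + n‖ * ‖b + n‖ * ‖hypCoef a b c n‖ := h
      _ ≤ ((1 + ‖a‖) * (n + 1)) * ((1 + ‖b‖) * (n + 1)) * M ^ n := by
        gcongr <;> exact key _
      _ = ((n : ℝ) + 1) * (d * (n + 1)) * M ^ (n + 1) := by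
        rw [pow_succ, hM]
        field_simp

/-- The hypergeometric differential equation. -/
theorem hypergeometric_ode (a b : ℂ) {c : ℂ} (hc : 0 < c.re) {r : ℝ}
    (hr : SumOn (hypCoef a b c) r) {z : ℂ} (hz : ‖z‖ < r) :
    z * (1 - z) * pser (dcoef (dcoef (hypCoef a b c))) z
      + (c - (a + b + 1) * z) * pser (dcoef (hypCoef a b c)) z
      - a * b * pser (hypCoef a b c) z = 0 := by
  set A := hypCoef a b c
  have h0 := hr.hasSum hz
  have h1 := hr.dcoef.hasSum hz
  have h2 := hr.dcoef.dcoef.hasSum_shiftRight hz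
  have h3 := hr.dcoef.dcoef.shiftRight.hasSum_shiftRight hz
  have h4 := hr.dcoef.hasSum_shiftRight hz
  rw [pser_shiftRight hr.dcoef.dcoef hz] at h3
  have h := (((h2.sub h3).add (h1.mul_left c)).sub (h4.mul_left (a + b + 1))).sub (h0.mul_left (a * b))
  have e : ∀ n : ℕ, shiftRight (dcoef (dcoef A)) n * z ^ n
      - shiftRight (shiftRight (dcoef (dcoef A))) n * z ^ n + c * (dcoef A n * z ^ n)
      - (a + b + 1) * (shiftRight (dcoef A) n * z ^ n) - a * b * (A n * z ^ n) = 0 := by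
    intro n
    have hrec := hypCoef_succ a b hc n
    change _ * A (n + 1) = _ * A n at hrec
    rcases n with _ | _ | n
    · simp [dcoef] at hrec ⊢
      linear_combination hrec
    · simp [dcoef] at hrec ⊢
      linear_combination z * hrec
    · simp only [shiftRight_succ, dcoef] at hrec ⊢
      push_cast at hrec ⊢
      linear_combination z ^ (n + 2) * hrec
  simp only [e] at h
  have := h.unique hasSum_zero
  linear_combination this

end HeunParams

end

open MeasureTheory in
/-- Differentiation under the integral sign for a dominated family of holomorphic functions. -/
theorem hasDerivAt_integral_of_holomorphic {α : Type*} [MeasurableSpace α] {μ : Measure α}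
    {U : Set ℂ} (hU : IsOpen U) {f : ℂ → α → ℂ} {b : α → ℝ} (hb : Integrable b μ)
    (hm : ∀ z ∈ U, AEStronglyMeasurable (f z) μ)
    (hd : ∀ᵐ q ∂μ, DifferentiableOn ℂ (fun z => f z q) U)
    (hle : ∀ᵐ q ∂μ, ∀ z ∈ U, ‖f z q‖ ≤ b q) {z₀ : ℂ} (hz₀ : z₀ ∈ U) :
    Integrable (fun q => deriv (fun z => f z q) z₀) μ ∧
      HasDerivAt (fun z => ∫ q, f z q ∂μ) (∫ q, deriv (fun z => f z q) z₀ ∂μ) z₀ := by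
  obtain ⟨r, hr, hrU⟩ := Metric.isOpen_iff.mp hU z₀ hz₀
  have hr2 : 0 < r / 2 := by positivity
  have hsub : ∀ z ∈ Metric.ball z₀ (r / 2), ∀ w ∈ Metric.closedBall z (r / 3), w ∈ U := by
    intro z hz w hw
    apply hrU
    rw [Metric.mem_ball] at hz ⊢
    rw [Metric.mem_closedBall] at hw
    linarith [dist_triangle w z z₀]
  have hmem : ∀ z ∈ Metric.ball z₀ (r / 2), z ∈ U := fun z hz =>
    hsub z hz z (Metric.mem_closedBall_self (by positivity))
  refine hasDerivAt_integral_of_dominated_loc_of_deriv_le (F := f)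
    (F' := fun z q => deriv (fun z => f z q) z) (bound := fun q => b q / (r / 3))
    (Metric.ball_mem_nhds z₀ hr2) ?_ ?_ ?_ ?_ (hb.div_const _) ?_
  · filter_upwards [Metric.ball_mem_nhds z₀ hr2] with z hz
    exact hm z (hmem z hz)
  · exact hb.mono' (hm z₀ hz₀) (hle.mono fun q hq => hq z₀ hz₀)
  · have hseq : ∀ n : ℕ, z₀ + ((r / 3 / (n + 1) : ℝ) : ℂ) ∈ U := by
      intro n
      apply hrU
      rw [Metric.mem_ball, dist_eq_norm, add_sub_cancel_left, Complex.norm_real,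
        Real.norm_of_nonneg (by positivity)]
      have : r / 3 / ((n : ℝ) + 1) ≤ r / 3 :=
        div_le_self (by positivity) (by linarith [(Nat.cast_nonneg n : (0 : ℝ) ≤ n)])
      linarith
    refine aestronglyMeasurable_of_tendsto_ae Filter.atTop
      (f := fun (n : ℕ) q => (((r / 3 / (n + 1) : ℝ) : ℂ))⁻¹ •
        (f (z₀ + ((r / 3 / (n + 1) : ℝ) : ℂ)) q - f z₀ q)) ?_ ?_
    · intro n
      exact ((hm _ (hseq n)).sub (hm _ hz₀)).const_smul (((r / 3 / (n + 1) : ℝ) : ℂ))⁻¹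
    · filter_upwards [hd] with q hq
      have h := (hq.differentiableAt (hU.mem_nhds hz₀)).hasDerivAt
      rw [hasDerivAt_iff_tendsto_slope_zero] at h
      refine h.comp (tendsto_nhdsWithin_iff.mpr ⟨?_, ?_⟩)
      · have h1 : Filter.Tendsto (fun n : ℕ => r / 3 / ((n : ℝ) + 1)) Filter.atTop (nhds 0) :=
          (tendsto_const_div_atTop_nhds_zero_nat (r / 3)).comp (Filter.tendsto_add_atTop_nat 1)
            |>.congr fun n => by simp
        exact_mod_cast (Complex.continuous_ofReal.tendsto 0).comp h1
      · refine Filter.Eventually.of_forall fun n => ?_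
        have : (0 : ℝ) < r / 3 / ((n : ℝ) + 1) := by positivity
        exact Complex.ofReal_ne_zero.mpr this.ne'
  · filter_upwards [hd, hle] with q hq hq' z hz
    refine Complex.norm_deriv_le_of_forall_mem_sphere_norm_le (by positivity) ?_ fun w hw =>
      hq' w (hsub z hz w (Metric.sphere_subset_closedBall hw))
    exact DifferentiableOn.diffContOnCl (hq.mono fun w hw => hsub z hz w
      (Metric.closure_ball_subset_closedBall hw))
  · filter_upwards [hd] with q hq z hz
    exact (hq.differentiableAt (hU.mem_nhds (hmem z hz))).hasDerivAt

open MeasureTheory in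
theorem hasDerivAt_deriv_integral_of_holomorphic {α : Type*} [MeasurableSpace α] {μ : Measure α}
    {U : Set ℂ} (hU : IsOpen U) {f : ℂ → α → ℂ} {b : α → ℝ} (hb : Integrable b μ)
    (hm : ∀ z ∈ U, AEStronglyMeasurable (f z) μ)
    (hd : ∀ᵐ q ∂μ, DifferentiableOn ℂ (fun z => f z q) U)
    (hle : ∀ᵐ q ∂μ, ∀ z ∈ U, ‖f z q‖ ≤ b q) {z₀ : ℂ} (hz₀ : z₀ ∈ U) :
    Integrable (fun q => deriv (deriv (fun z => f z q)) z₀) μ ∧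
      HasDerivAt (deriv (fun z => ∫ q, f z q ∂μ))
        (∫ q, deriv (deriv (fun z => f z q)) z₀ ∂μ) z₀ := by
  have h1 := fun z (hz : z ∈ U) => hasDerivAt_integral_of_holomorphic hU hb hm hd hle hz
  obtain ⟨r, hr, hrU⟩ := Metric.isOpen_iff.mp hU z₀ hz₀
  have hsub : ∀ z ∈ Metric.ball z₀ (r / 2), ∀ w ∈ Metric.closedBall z (r / 3), w ∈ U := by
    intro z hz w hw
    apply hrU
    rw [Metric.mem_ball] at hz ⊢
    rw [Metric.mem_closedBall] at hw
    linarith [dist_triangle w z z₀]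
  have hmem : ∀ z ∈ Metric.ball z₀ (r / 2), z ∈ U := fun z hz =>
    hsub z hz z (Metric.mem_closedBall_self (by positivity))
  have hz' : z₀ ∈ Metric.ball z₀ (r / 2) := Metric.mem_ball_self (by positivity)
  have h2 := hasDerivAt_integral_of_holomorphic (μ := μ) (Metric.isOpen_ball (x := z₀) (ε := r / 2))
    (f := fun z q => deriv (fun z => f z q) z) (hb.div_const (r / 3))
    (fun z hz => (h1 z (hmem z hz)).1.aestronglyMeasurable)
    (hd.mono fun q hq => (hq.deriv hU).mono hmem) ?_ hz'
  · refine ⟨h2.1, h2.2.congr_of_eventuallyEq ?_⟩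
    filter_upwards [Metric.isOpen_ball.mem_nhds hz'] with z hz
    exact (h1 z (hmem z hz)).2.deriv
  · filter_upwards [hd, hle] with q hq hq' z hz
    refine Complex.norm_deriv_le_of_forall_mem_sphere_norm_le (by positivity) ?_ fun w hw =>
      hq' w (hsub z hz w (Metric.sphere_subset_closedBall hw))
    exact DifferentiableOn.diffContOnCl (hq.mono fun w hw => hsub z hz w
      (Metric.closure_ball_subset_closedBall hw))

noncomputable section

namespace HeunParams

/-- The derivative of the root `a` of `a b + v b + w a = 0`, `a + b = Z`, in the direction
`(Z', v', w')`, where `Δ = a - b + v - w`. -/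
def aD (a b v Δ Z' v' w' : ℂ) : ℂ := ((a + v) * Z' + b * v' + a * w') / Δ

/-- The derivative of `b` in the direction `(Z', v', w')`. -/
def bD (a b w Δ Z' v' w' : ℂ) : ℂ := -((b + w) * Z' + b * v' + a * w') / Δ

/-- The derivative of `Δ` in the direction `(Z', v', w')`. -/
def deltaD (a b v w Δ Z' v' w' : ℂ) : ℂ := aD a b v Δ Z' v' w' - bD a b w Δ Z' v' w' + v' - w'

/-- The logarithmic derivative of `a ^ m * b ^ n / Δ` in the direction `(Z', v', w')`. -/
def logD (m n a b v w Δ Z' v' w' : ℂ) : ℂ :=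
  m * aD a b v Δ Z' v' w' / a + n * bD a b w Δ Z' v' w' / b - deltaD a b v w Δ Z' v' w' / Δ

/-- The second derivative of `a` in the directions `(Z₁, v₁, w₁)`, `(Z₂, v₂, w₂)`. -/
def aDD (a b v w Δ Z₁ v₁ w₁ Z₂ v₂ w₂ : ℂ) : ℂ :=
  ((aD a b v Δ Z₂ v₂ w₂ + v₂) * Z₁ + bD a b w Δ Z₂ v₂ w₂ * v₁ + aD a b v Δ Z₂ v₂ w₂ * w₁
    - aD a b v Δ Z₁ v₁ w₁ * deltaD a b v w Δ Z₂ v₂ w₂) / Δ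

/-- The second derivative of `b` in the directions `(Z₁, v₁, w₁)`, `(Z₂, v₂, w₂)`. -/
def bDD (a b v w Δ Z₁ v₁ w₁ Z₂ v₂ w₂ : ℂ) : ℂ :=
  -((bD a b w Δ Z₂ v₂ w₂ + w₂) * Z₁ + bD a b w Δ Z₂ v₂ w₂ * v₁ + aD a b v Δ Z₂ v₂ w₂ * w₁
    + bD a b w Δ Z₁ v₁ w₁ * deltaD a b v w Δ Z₂ v₂ w₂) / Δ

/-- The second derivative of `log (a ^ m * b ^ n / Δ)` in the directions `(Z₁, v₁, w₁)`,
`(Z₂, v₂, w₂)`. -/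
def logDD (m n a b v w Δ Z₁ v₁ w₁ Z₂ v₂ w₂ : ℂ) : ℂ :=
  m * (aDD a b v w Δ Z₁ v₁ w₁ Z₂ v₂ w₂ / a - aD a b v Δ Z₁ v₁ w₁ * aD a b v Δ Z₂ v₂ w₂ / a ^ 2)
  + n * (bDD a b v w Δ Z₁ v₁ w₁ Z₂ v₂ w₂ / b - bD a b w Δ Z₁ v₁ w₁ * bD a b w Δ Z₂ v₂ w₂ / b ^ 2)
  - ((aDD a b v w Δ Z₁ v₁ w₁ Z₂ v₂ w₂ - bDD a b v w Δ Z₁ v₁ w₁ Z₂ v₂ w₂) / Δ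
    - deltaD a b v w Δ Z₁ v₁ w₁ * deltaD a b v w Δ Z₂ v₂ w₂ / Δ ^ 2)

theorem logD_lin (m n a b v w Δ Z' v' w' : ℂ) :
    logD m n a b v w Δ Z' v' w' = logD m n a b v w Δ 1 0 0 * Z'
      + logD m n a b v w Δ 0 1 0 * v' + logD m n a b v w Δ 0 0 1 * w' := by
  simp only [logD, deltaD, aD, bD]
  ring

theorem logDD_lin (m n a b v w Δ Z₁ v₁ w₁ Z₂ v₂ w₂ : ℂ) :
    logDD m n a b v w Δ Z₁ v₁ w₁ Z₂ v₂ w₂ =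
      logDD m n a b v w Δ 1 0 0 1 0 0 * (Z₁ * Z₂)
      + logDD m n a b v w Δ 1 0 0 0 1 0 * (Z₁ * v₂)
      + logDD m n a b v w Δ 1 0 0 0 0 1 * (Z₁ * w₂)
      + logDD m n a b v w Δ 0 1 0 1 0 0 * (v₁ * Z₂)
      + logDD m n a b v w Δ 0 1 0 0 1 0 * (v₁ * v₂)
      + logDD m n a b v w Δ 0 1 0 0 0 1 * (v₁ * w₂)
      + logDD m n a b v w Δ 0 0 1 1 0 0 * (w₁ * Z₂)
      + logDD m n a b v w Δ 0 0 1 0 1 0 * (w₁ * v₂)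
      + logDD m n a b v w Δ 0 0 1 0 0 1 * (w₁ * w₂) := by
  simp only [logDD, aDD, bDD, deltaD, aD, bD]
  ring

set_option maxHeartbeats 4000000 in
theorem log_identity_homogeneous {m n s A B Δ : ℂ} (hA : A ≠ 0) (hB : B ≠ 0) (hΔ : Δ ≠ 0)
    (hZ : A + B ≠ 0) :
    let a := A * Δ; let b := B * Δ
    let v := -(A * (A - 1) / (A + B)) * Δ; let w := -(B * (B + 1) / (A + B)) * Δ
    let p2 := logD m n a b v w Δ 0 1 0 * v
    let p3 := logD m n a b v w Δ 0 0 1 * w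
    let p22 := logDD m n a b v w Δ 0 1 0 0 1 0 * (v * v) + p2 * p2
    let p23 := logDD m n a b v w Δ 0 1 0 0 0 1 * (v * w) + p2 * p3
    let p33 := logDD m n a b v w Δ 0 0 1 0 0 1 * (w * w) + p3 * p3
    let h1 := logD m n a b v w Δ 1 0 0 * (a + b)
    let h2 := logDD m n a b v w Δ 1 0 0 1 0 0 * ((a + b) * (a + b)) + h1 * h1
    (p22 - 2 * m * p2 + m * (m + 1)) + 2 * (p23 - n * p2 - m * p3 + m * n)
        + (p33 - 2 * n * p3 + n * (n + 1)) + (m + n + 4 - s) * ((p2 - m) + (p3 - n))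
        + (1 - s) * (m + n + 2) =
      -s - m - n - (s - 1) * (m + n - h1) - ((m + n - 1) * h1 - h2) := by
  intro a b v w p2 p3 p22 p23 p33 h1 h2
  simp only [a, b, v, w, p2, p3, p22, p23, p33, h1, h2, logD, logDD, aDD, bDD, deltaD, aD, bD]
  field_simp
  ring

set_option maxHeartbeats 4000000 in
theorem log_identity_bessel₁ {m n A B Δ : ℂ} (hA : A ≠ 0) (hB : B ≠ 0) (hΔ : Δ ≠ 0)
    (hZ : A + B ≠ 0) :
    let a := A * Δ; let b := B * Δ
    let v := -(A * (A - 1) / (A + B)) * Δ; let w := -(B * (B + 1) / (A + B)) * Δ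
    let p2 := logD m n a b v w Δ 0 1 0 * v
    let p22 := logDD m n a b v w Δ 0 1 0 0 1 0 * (v * v) + p2 * p2
    let h1 := logD m n a b v w Δ 1 0 0 * (a + b)
    let h2 := logDD m n a b v w Δ 1 0 0 1 0 0 * ((a + b) * (a + b)) + h1 * h1
    (a + b) * (p22 + (1 - m) * p2) = v * ((m + n - 1) * h1 - h2) := by
  intro a b v w p2 p22 h1 h2
  simp only [a, b, v, w, p2, p22, h1, h2, logD, logDD, aDD, bDD, deltaD, aD, bD]
  field_simp
  ring

set_option maxHeartbeats 4000000 in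
theorem log_identity_bessel₂ {m n A B Δ : ℂ} (hA : A ≠ 0) (hB : B ≠ 0) (hΔ : Δ ≠ 0)
    (hZ : A + B ≠ 0) :
    let a := A * Δ; let b := B * Δ
    let v := -(A * (A - 1) / (A + B)) * Δ; let w := -(B * (B + 1) / (A + B)) * Δ
    let p3 := logD m n a b v w Δ 0 0 1 * w
    let p33 := logDD m n a b v w Δ 0 0 1 0 0 1 * (w * w) + p3 * p3
    let h1 := logD m n a b v w Δ 1 0 0 * (a + b)
    let h2 := logDD m n a b v w Δ 1 0 0 1 0 0 * ((a + b) * (a + b)) + h1 * h1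
    (a + b) * (p33 + (1 - n) * p3) = w * ((m + n - 1) * h1 - h2) := by
  intro a b v w p3 p33 h1 h2
  simp only [a, b, v, w, p3, p33, h1, h2, logD, logDD, aDD, bDD, deltaD, aD, bD]
  field_simp
  ring

end HeunParams

end

noncomputable section

namespace HeunParams

set_option maxHeartbeats 4000000 in
theorem logDD_symm {m n A B Δ : ℂ} (hA : A ≠ 0) (hB : B ≠ 0) (hΔ : Δ ≠ 0) (hZ : A + B ≠ 0) :
    let a := A * Δ; let b := B * Δ
    let v := -(A * (A - 1) / (A + B)) * Δ; let w := -(B * (B + 1) / (A + B)) * Δ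
    logDD m n a b v w Δ 1 0 0 0 1 0 = logDD m n a b v w Δ 0 1 0 1 0 0 ∧
    logDD m n a b v w Δ 1 0 0 0 0 1 = logDD m n a b v w Δ 0 0 1 1 0 0 ∧
    logDD m n a b v w Δ 0 1 0 0 0 1 = logDD m n a b v w Δ 0 0 1 0 1 0 := by
  intro a b v w
  simp only [a, b, v, w, logDD, aDD, bDD, deltaD, aD, bD]
  refine ⟨?_, ?_, ?_⟩ <;>
  · field_simp
    ring

/-- The discriminant of `a ↦ a (Z - a) + v (Z - a) + w a`. -/
def disc (Z v w : ℂ) : ℂ := (v - w) ^ 2 + 2 * (v + w) * Z + Z ^ 2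

/-- The branch of the square root of the discriminant that is close to `η`. -/
def rootDisc (η Z v w : ℂ) : ℂ := η * (disc Z v w * (1 / η) ^ 2) ^ (1 / 2 : ℂ)

theorem rootDisc_sq {η : ℂ} (hη : η ≠ 0) (Z v w : ℂ) : rootDisc η Z v w ^ 2 = disc Z v w := by
  rw [rootDisc, mul_pow, ← Complex.cpow_nat_mul]
  norm_num
  field_simp

theorem disc_ne {η Z v w : ℂ} (hs : disc Z v w * (1 / η) ^ 2 ∈ Complex.slitPlane) :
    disc Z v w ≠ 0 := by
  intro h
  rw [h, zero_mul] at hs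
  exact Complex.slitPlane_ne_zero hs rfl

theorem rootDisc_ne {η Z v w : ℂ} (hη : η ≠ 0)
    (hs : disc Z v w * (1 / η) ^ 2 ∈ Complex.slitPlane) : rootDisc η Z v w ≠ 0 := by
  intro h
  have := rootDisc_sq hη Z v w
  rw [h] at this
  exact disc_ne hs (by rw [← this]; simp)

/-- The root `a` of `a b + v b + w a = 0`, `a + b = Z`, for the square root `Δ` of the
discriminant. -/
def rootA (Z v w Δ : ℂ) : ℂ := (Z - v + w + Δ) / 2

/-- The root `b` of `a b + v b + w a = 0`, `a + b = Z`, for the square root `Δ` of the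
discriminant. -/
def rootB (Z v w Δ : ℂ) : ℂ := (Z + v - w - Δ) / 2

section Path

variable {Z v w η : ℂ → ℂ} {Z' v' w' η' s : ℂ}

theorem hasDerivAt_rootDisc (hZ : HasDerivAt Z Z' s) (hv : HasDerivAt v v' s)
    (hw : HasDerivAt w w' s) (hη : HasDerivAt η η' s) (hη0 : η s ≠ 0)
    (hs : disc (Z s) (v s) (w s) * (1 / η s) ^ 2 ∈ Complex.slitPlane) :
    HasDerivAt (fun s => rootDisc (η s) (Z s) (v s) (w s))
      (((Z s + v s + w s) * Z' + (Z s + v s - w s) * v' + (Z s - v s + w s) * w')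
        / rootDisc (η s) (Z s) (v s) (w s)) s := by
  have hdisc : HasDerivAt (fun s => disc (Z s) (v s) (w s))
      (2 * ((Z s + v s + w s) * Z' + (Z s + v s - w s) * v' + (Z s - v s + w s) * w')) s := by
    have := (((hv.sub hw).pow 2).add (((hv.add hw).const_mul 2).mul hZ)).add (hZ.pow 2)
    refine (this.congr_deriv ?_).congr_of_eventuallyEq (Filter.Eventually.of_forall fun s => ?_)
    · simp only [Pi.add_apply, Pi.sub_apply]
      push_cast
      ring
    · simp [disc]
  have h1 := (((hη.inv hη0).pow 2).fun_mul hdisc).congr_deriv rfl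
  have hs' : ((η⁻¹ ^ 2) s * disc (Z s) (v s) (w s)) ∈ Complex.slitPlane := by
    simpa [mul_comm] using hs
  have h2 := hη.fun_mul (h1.cpow_const (c := 1 / 2) hs')
  have hΔ := rootDisc_ne hη0 hs
  have hD := disc_ne hs
  have hsq := rootDisc_sq hη0 (Z s) (v s) (w s)
  have e : (fun s => rootDisc (η s) (Z s) (v s) (w s)) =
      fun s => η s * ((η⁻¹ ^ 2) s * disc (Z s) (v s) (w s)) ^ (1 / 2 : ℂ) := by
    funext s
    simp [rootDisc, mul_comm]
  rw [e]
  refine h2.congr_deriv ?_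
  have hpow : ((η⁻¹ ^ 2) s * disc (Z s) (v s) (w s)) ^ (1 / 2 - 1 : ℂ) =
      rootDisc (η s) (Z s) (v s) (w s) / η s / ((η⁻¹ ^ 2) s * disc (Z s) (v s) (w s)) := by
    rw [Complex.cpow_sub _ _ (Complex.slitPlane_ne_zero hs'), Complex.cpow_one, rootDisc]
    congr 1
    rw [mul_div_cancel_left₀ _ hη0]
    congr 1
    simp [mul_comm]
  have hpow0 : ((η⁻¹ ^ 2) s * disc (Z s) (v s) (w s)) ^ (1 / 2 : ℂ) =
      rootDisc (η s) (Z s) (v s) (w s) / η s := by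
    rw [rootDisc, mul_div_cancel_left₀ _ hη0]
    congr 1
    simp [mul_comm]
  rw [hpow, hpow0]
  simp only [Pi.pow_apply, Pi.inv_apply, Nat.add_one_sub_one, pow_one, Nat.cast_ofNat]
  generalize rootDisc (η s) (Z s) (v s) (w s) = Δ at hsq hΔ ⊢
  rw [← hsq] at hD ⊢
  field_simp
  ring

theorem hasDerivAt_rootA {Δ : ℂ → ℂ} (hZ : HasDerivAt Z Z' s) (hv : HasDerivAt v v' s)
    (hw : HasDerivAt w w' s) (hΔ0 : Δ s ≠ 0)
    (hΔ : HasDerivAt Δ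
      (((Z s + v s + w s) * Z' + (Z s + v s - w s) * v' + (Z s - v s + w s) * w') / Δ s) s) :
    HasDerivAt (fun s => rootA (Z s) (v s) (w s) (Δ s))
      (aD (rootA (Z s) (v s) (w s) (Δ s)) (rootB (Z s) (v s) (w s) (Δ s)) (v s) (Δ s) Z' v' w') s := by
  refine ((((hZ.sub hv).add hw).add hΔ).div_const 2).congr_deriv ?_
  simp only [aD, rootA, rootB]
  field_simp
  ring

theorem hasDerivAt_rootB {Δ : ℂ → ℂ} (hZ : HasDerivAt Z Z' s) (hv : HasDerivAt v v' s)
    (hw : HasDerivAt w w' s) (hΔ0 : Δ s ≠ 0)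
    (hΔ : HasDerivAt Δ
      (((Z s + v s + w s) * Z' + (Z s + v s - w s) * v' + (Z s - v s + w s) * w') / Δ s) s) :
    HasDerivAt (fun s => rootB (Z s) (v s) (w s) (Δ s))
      (bD (rootA (Z s) (v s) (w s) (Δ s)) (rootB (Z s) (v s) (w s) (Δ s)) (w s) (Δ s) Z' v' w') s := by
  refine ((((hZ.add hv).sub hw).sub hΔ).div_const 2).congr_deriv ?_
  simp only [bD, rootA, rootB]
  field_simp
  ring

theorem deltaD_eq {Z v w Δ Z' v' w' : ℂ} (hΔ0 : Δ ≠ 0) :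
    deltaD (rootA Z v w Δ) (rootB Z v w Δ) v w Δ Z' v' w' =
      ((Z + v + w) * Z' + (Z + v - w) * v' + (Z - v + w) * w') / Δ := by
  simp only [deltaD, aD, bD, rootA, rootB]
  field_simp
  ring

/-- The logarithmic derivative along a path. -/
theorem hasDerivAt_logD {a b Δ : ℂ → ℂ} (m n Z₁ v₁ w₁ : ℂ)
    (hv : HasDerivAt v v' s) (hw : HasDerivAt w w' s)
    (ha : HasDerivAt a (aD (a s) (b s) (v s) (Δ s) Z' v' w') s)
    (hb : HasDerivAt b (bD (a s) (b s) (w s) (Δ s) Z' v' w') s)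
    (hΔ : HasDerivAt Δ (deltaD (a s) (b s) (v s) (w s) (Δ s) Z' v' w') s)
    (ha0 : a s ≠ 0) (hb0 : b s ≠ 0) (hΔ0 : Δ s ≠ 0) :
    HasDerivAt (fun s => logD m n (a s) (b s) (v s) (w s) (Δ s) Z₁ v₁ w₁)
      (logDD m n (a s) (b s) (v s) (w s) (Δ s) Z₁ v₁ w₁ Z' v' w') s := by
  have hA : HasDerivAt (fun s => aD (a s) (b s) (v s) (Δ s) Z₁ v₁ w₁)
      (aDD (a s) (b s) (v s) (w s) (Δ s) Z₁ v₁ w₁ Z' v' w') s := by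
    refine (((((ha.fun_add hv).mul_const Z₁).fun_add (hb.mul_const v₁)).fun_add
      (ha.mul_const w₁)).fun_div hΔ hΔ0).congr_deriv ?_
    rw [aDD]
    generalize aD (a s) (b s) (v s) (Δ s) Z' v' w' = a'
    generalize bD (a s) (b s) (w s) (Δ s) Z' v' w' = b'
    generalize deltaD (a s) (b s) (v s) (w s) (Δ s) Z' v' w' = Δ'
    rw [aD]
    field_simp
  have hB : HasDerivAt (fun s => bD (a s) (b s) (w s) (Δ s) Z₁ v₁ w₁)
      (bDD (a s) (b s) (v s) (w s) (Δ s) Z₁ v₁ w₁ Z' v' w') s := by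
    refine (((((hb.fun_add hw).mul_const Z₁).fun_add (hb.mul_const v₁)).fun_add
      (ha.mul_const w₁)).fun_neg.fun_div hΔ hΔ0).congr_deriv ?_
    rw [bDD]
    generalize aD (a s) (b s) (v s) (Δ s) Z' v' w' = a'
    generalize bD (a s) (b s) (w s) (Δ s) Z' v' w' = b'
    generalize deltaD (a s) (b s) (v s) (w s) (Δ s) Z' v' w' = Δ'
    rw [bD]
    field_simp
    ring
  have hD : HasDerivAt (fun s => deltaD (a s) (b s) (v s) (w s) (Δ s) Z₁ v₁ w₁)
      (aDD (a s) (b s) (v s) (w s) (Δ s) Z₁ v₁ w₁ Z' v' w'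
        - bDD (a s) (b s) (v s) (w s) (Δ s) Z₁ v₁ w₁ Z' v' w') s :=
    ((hA.fun_sub hB).add_const v₁).sub_const w₁
  refine (((((hA.const_mul m).fun_div ha ha0)).fun_add ((hB.const_mul n).fun_div hb hb0)).fun_sub
    (hD.fun_div hΔ hΔ0)).congr_deriv ?_
  rw [logDD]
  field_simp

/-- The derivative of `(a / c₂) ^ m * (b / c₃) ^ n / Δ` along a path. -/
theorem hasDerivAt_powers {a b Δ c₂ c₃ : ℂ → ℂ} {c₂' c₃' : ℂ} (m n : ℂ)
    (ha : HasDerivAt a (aD (a s) (b s) (v s) (Δ s) Z' v' w') s)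
    (hb : HasDerivAt b (bD (a s) (b s) (w s) (Δ s) Z' v' w') s)
    (hΔ : HasDerivAt Δ (deltaD (a s) (b s) (v s) (w s) (Δ s) Z' v' w') s)
    (hc₂ : HasDerivAt c₂ c₂' s) (hc₃ : HasDerivAt c₃ c₃' s) (hc₂0 : c₂ s ≠ 0) (hc₃0 : c₃ s ≠ 0)
    (ha0 : a s / c₂ s ∈ Complex.slitPlane) (hb0 : b s / c₃ s ∈ Complex.slitPlane)
    (hΔ0 : Δ s ≠ 0) :
    HasDerivAt (fun s => (a s / c₂ s) ^ m * (b s / c₃ s) ^ n / Δ s)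
      ((a s / c₂ s) ^ m * (b s / c₃ s) ^ n / Δ s *
        (logD m n (a s) (b s) (v s) (w s) (Δ s) Z' v' w' - m * (c₂' / c₂ s) - n * (c₃' / c₃ s)))
      s := by
  have h1 := (ha.fun_div hc₂ hc₂0).cpow_const (c := m) ha0
  have h2 := (hb.fun_div hc₃ hc₃0).cpow_const (c := n) hb0
  refine ((h1.fun_mul h2).fun_div hΔ hΔ0).congr_deriv ?_
  have ha1 := Complex.slitPlane_ne_zero ha0
  have hb1 := Complex.slitPlane_ne_zero hb0
  have ha2 : a s ≠ 0 := fun h => ha1 (by rw [h, zero_div])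
  have hb2 : b s ≠ 0 := fun h => hb1 (by rw [h, zero_div])
  rw [Complex.cpow_sub _ _ ha1, Complex.cpow_sub _ _ hb1, Complex.cpow_one, Complex.cpow_one, logD]
  generalize aD (a s) (b s) (v s) (Δ s) Z' v' w' = a'
  generalize bD (a s) (b s) (w s) (Δ s) Z' v' w' = b'
  generalize deltaD (a s) (b s) (v s) (w s) (Δ s) Z' v' w' = Δ'
  generalize (a s / c₂ s) ^ m = p
  generalize (b s / c₃ s) ^ n = q
  field_simp
  ring

end Path

end HeunParams

end

noncomputable section

namespace HeunParams

/-- The differential equation in `x, y` and `Z` of the kernel `a ^ m * b ^ n / Δ` with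
`v, w` the products of linear functions, in terms of logarithmic derivatives. -/
theorem kernel_identity {t s m n rr x y x₂ v w p₂ p₃ p₂₃ g l Z : ℂ}
    (ht : t ≠ 0) (ht1 : t - 1 ≠ 0) (hx1 : x - 1 ≠ 0) (hxt : x - t ≠ 0) (hy1 : y - 1 ≠ 0)
    (hyt : y - t ≠ 0)
    (hv : v = (x - 1) * (x₂ - 1) * (y - 1) / (t - 1) ^ 2)
    (hw : w = (x - t) * (x₂ - t) * (y - t) / (t * (t - 1) ^ 2))
    (hom : ((v * g - (1 - m) * p₂) - 2 * m * p₂ + m * (m + 1))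
        + 2 * (p₂₃ - n * p₂ - m * p₃ + m * n)
        + ((w * g - (1 - n) * p₃) - 2 * n * p₃ + n * (n + 1))
        + (m + n + 4 - s) * ((p₂ - m) + (p₃ - n)) + (1 - s) * (m + n + 2) =
      -s - m - n - (s - 1) * (m + n - l) - Z * g) :
    x * ((x - 1) * (x - t)) *
        (((v * g - (1 - m) * p₂) - 2 * m * p₂ + m * (m + 1)) / (x - 1) ^ 2
          + 2 * (p₂₃ - n * p₂ - m * p₃ + m * n) / ((x - 1) * (x - t))
          + ((w * g - (1 - n) * p₃) - 2 * n * p₃ + n * (n + 1)) / (x - t) ^ 2)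
      + ((2 - s) * ((x - 1) * (x - t)) + x * ((m + 1) * (x - t) + (n + 1) * (x - 1)))
        * ((p₂ - m) / (x - 1) + (p₃ - n) / (x - t))
      + (1 - s) * ((m + 1) * (x - t) + (n + 1) * (x - 1)) + rr * x
      - (y * (y - 1) * (y - t) * ((v * g - (1 - m) * p₂) / (y - 1) ^ 2
          + 2 * p₂₃ / ((y - 1) * (y - t)) + (w * g - (1 - n) * p₃) / (y - t) ^ 2)
        + (2 * ((y - 1) * (y - t) + y * (y - t) + y * (y - 1))
          - (s * (y - 1) * (y - t) + (m + 1) * y * (y - t) + (n + 1) * y * (y - 1)))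
          * (p₂ / (y - 1) + p₃ / (y - t))
        + (6 * y - 2 - 2 * t
          - (s * (2 * y - 1 - t) + (m + 1) * (2 * y - t) + (n + 1) * (2 * y - 1)) + rr * y))
      = (x - y) * (rr - s - m - n - (s - 1) * (m + n - l) + (1 - Z) * g) := by
  have hg : p₂₃ = ((-s - m - n - (s - 1) * (m + n - l) - Z * g)
      - (((v * g - (1 - m) * p₂) - 2 * m * p₂ + m * (m + 1))
        + 2 * (- n * p₂ - m * p₃ + m * n)
        + ((w * g - (1 - n) * p₃) - 2 * n * p₃ + n * (n + 1))
        + (m + n + 4 - s) * ((p₂ - m) + (p₃ - n)) + (1 - s) * (m + n + 2))) / 2 := by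
    linear_combination hom / 2
  rw [hg, hv, hw]
  field_simp
  ring

/-- The total derivative identity for the integrand, in terms of logarithmic derivatives. -/
theorem total_derivative_identity
    {x y q κ p σ s m n rr Z Ex Exx ExZ lZ dZZ DY F₀ F₁ F₂ : ℂ}
    (hZ : Z = 1 - κ * x * q)
    (hk : x * p * (Exx + Ex ^ 2) + ((2 - s) * p + x * σ) * Ex + (1 - s) * σ + rr * x - DY
      = (x - y) * (rr - s - m - n - (s - 1) * (m + n - Z * lZ)
        + (1 - Z) * ((m + n - 1) * lZ - Z * (dZZ + lZ ^ 2))))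
    (hode : (1 - Z) * Z * F₂ + (s - 1 - (s + m + n) * (1 - Z)) * F₁ - (rr - s - m - n) * F₀ = 0) :
    x * p * (F₂ * κ ^ 2 * q ^ 2 + 2 * κ * q * F₁ * (Ex - κ * q * lZ)
        + F₀ * ((Ex - κ * q * lZ) ^ 2 + (Exx - 2 * κ * q * ExZ + κ ^ 2 * q ^ 2 * dZZ)))
      + (s * p + x * σ) * (κ * q * F₁ + F₀ * (Ex - κ * q * lZ)) + rr * x * F₀ - F₀ * DY
    = (s - 1) * (F₀ * ((x - y) * (Z * lZ - (m + n)) + 2 * p * Ex + σ - κ * p * q * lZ)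
        + F₁ * ((x - y) * Z + κ * p * q))
      + q * (-κ * x * lZ * (F₀ * ((x - y) * (Z * lZ - (m + n)) + 2 * p * Ex + σ - κ * p * q * lZ)
          + F₁ * ((x - y) * Z + κ * p * q))
        + κ * x * (F₁ * ((x - y) * (Z * lZ - (m + n)) + 2 * p * Ex + σ - κ * p * q * lZ)
          + F₂ * ((x - y) * Z + κ * p * q))
        + F₀ * ((x - y) * (-κ * x * lZ - κ * x * Z * dZZ) - 2 * p * κ * x * ExZ - κ * p * lZ
          + κ ^ 2 * p * q * x * dZZ)
        + F₁ * (-(x - y) * κ * x + κ * p)) := by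
  subst hZ
  linear_combination F₀ * hk - (x - y) * hode

end HeunParams

end

noncomputable section

namespace HeunParams

variable (H : HeunParams)

/-- `Z = 1 - u q`. -/
def zC (x₁ x₂ q : ℂ) : ℂ := 1 - H.u x₁ x₂ * q

/-- `Q^{1/2}` for complex `q`. -/
def rtC (x₁ x₂ y q : ℂ) : ℂ :=
  rootDisc (y / (1 - H.t)) (H.zC x₁ x₂ q) (H.v x₁ x₂ y) (H.w x₁ x₂ y)

/-- Half of `A`, for complex `q`. -/
def aC (x₁ x₂ y q : ℂ) : ℂ :=
  rootA (H.zC x₁ x₂ q) (H.v x₁ x₂ y) (H.w x₁ x₂ y) (H.rtC x₁ x₂ y q)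

/-- Half of `B`, for complex `q`. -/
def bC (x₁ x₂ y q : ℂ) : ℂ :=
  rootB (H.zC x₁ x₂ q) (H.v x₁ x₂ y) (H.w x₁ x₂ y) (H.rtC x₁ x₂ y q)

/-- `(x₁ - 1) (x₂ - 1) / (1 - t)`, the value of `a` at `q = 1`. -/
def c₂ (x₁ x₂ : ℂ) : ℂ := (x₁ - 1) * (x₂ - 1) / (1 - H.t)

/-- `(x₁ - t) (x₂ - t) / (t (t - 1))`, the value of `b` at `q = 1`. -/
def c₃ (x₁ x₂ : ℂ) : ℂ := (x₁ - H.t) * (x₂ - H.t) / (H.t * (H.t - 1))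

/-- The algebraic part `(a / c₂)^{s₂-1} (b / c₃)^{s₃-1} Q^{-1/2}` of the integrand. -/
def eC (x₁ x₂ y q : ℂ) : ℂ :=
  (H.aC x₁ x₂ y q / H.c₂ x₁ x₂) ^ (H.s₂ - 1) * (H.bC x₁ x₂ y q / H.c₃ x₁ x₂) ^ (H.s₃ - 1)
    / H.rtC x₁ x₂ y q

/-- The coefficients of the hypergeometric function in the integrand. -/
def hc : ℕ → ℂ := hypCoef (H.r₁ - 1) (H.r₂ - 1) (H.s₁ - 1)

/-- The integrand divided by `q^{s₁-2}`. -/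
def fC (x₁ x₂ y q : ℂ) : ℂ := pser H.hc (H.u x₁ x₂ * q) * H.eC x₁ x₂ y q

/-- The conditions under which the integrand is holomorphic near a point. -/
structure Good (r : ℝ) (x₁ x₂ y q : ℂ) : Prop where
  y_ne : y ≠ 0
  x₁_ne_one : x₁ - 1 ≠ 0
  x₁_ne_t : x₁ - H.t ≠ 0
  x₂_ne_one : x₂ - 1 ≠ 0
  x₂_ne_t : x₂ - H.t ≠ 0
  disc_mem : disc (H.zC x₁ x₂ q) (H.v x₁ x₂ y) (H.w x₁ x₂ y) * (1 / (y / (1 - H.t))) ^ 2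
    ∈ Complex.slitPlane
  a_mem : H.aC x₁ x₂ y q / H.c₂ x₁ x₂ ∈ Complex.slitPlane
  b_mem : H.bC x₁ x₂ y q / H.c₃ x₁ x₂ ∈ Complex.slitPlane
  u_lt : ‖H.u x₁ x₂ * q‖ < r

theorem one_sub_t_ne : 1 - H.t ≠ 0 := sub_ne_zero.mpr H.t_ne_one.symm

theorem t_sub_one_ne : H.t - 1 ≠ 0 := sub_ne_zero.mpr H.t_ne_one

/-- Directional logarithmic derivative of `eC` without the constants. -/
def lD (x₁ x₂ y q Z' v' w' : ℂ) : ℂ :=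
  logD (H.s₂ - 1) (H.s₃ - 1) (H.aC x₁ x₂ y q) (H.bC x₁ x₂ y q) (H.v x₁ x₂ y) (H.w x₁ x₂ y)
    (H.rtC x₁ x₂ y q) Z' v' w'

/-- Second directional logarithmic derivative of `eC` without the constants. -/
def lDD (x₁ x₂ y q Z₁ v₁ w₁ Z₂ v₂ w₂ : ℂ) : ℂ :=
  logDD (H.s₂ - 1) (H.s₃ - 1) (H.aC x₁ x₂ y q) (H.bC x₁ x₂ y q) (H.v x₁ x₂ y) (H.w x₁ x₂ y)
    (H.rtC x₁ x₂ y q) Z₁ v₁ w₁ Z₂ v₂ w₂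

/-- `∂v/∂x₁`. -/
def vX (x₂ y : ℂ) : ℂ := (x₂ - 1) * (y - 1) / (H.t - 1) ^ 2
/-- `∂w/∂x₁`. -/
def wX (x₂ y : ℂ) : ℂ := (x₂ - H.t) * (y - H.t) / (H.t * (H.t - 1) ^ 2)
/-- `∂v/∂y`. -/
def vY (x₁ x₂ : ℂ) : ℂ := (x₁ - 1) * (x₂ - 1) / (H.t - 1) ^ 2
/-- `∂w/∂y`. -/
def wY (x₁ x₂ : ℂ) : ℂ := (x₁ - H.t) * (x₂ - H.t) / (H.t * (H.t - 1) ^ 2)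

variable {H}

theorem Good.rt_ne {r : ℝ} {x₁ x₂ y q : ℂ} (h : H.Good r x₁ x₂ y q) : H.rtC x₁ x₂ y q ≠ 0 :=
  rootDisc_ne (div_ne_zero h.y_ne H.one_sub_t_ne) h.disc_mem

theorem Good.a_ne {r : ℝ} {x₁ x₂ y q : ℂ} (h : H.Good r x₁ x₂ y q) : H.aC x₁ x₂ y q ≠ 0 :=
  fun h' => Complex.slitPlane_ne_zero h.a_mem (by rw [h', zero_div])

theorem Good.b_ne {r : ℝ} {x₁ x₂ y q : ℂ} (h : H.Good r x₁ x₂ y q) : H.bC x₁ x₂ y q ≠ 0 :=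
  fun h' => Complex.slitPlane_ne_zero h.b_mem (by rw [h', zero_div])

theorem Good.c₂_ne {r : ℝ} {x₁ x₂ y q : ℂ} (h : H.Good r x₁ x₂ y q) : H.c₂ x₁ x₂ ≠ 0 :=
  div_ne_zero (mul_ne_zero h.x₁_ne_one h.x₂_ne_one) H.one_sub_t_ne

theorem Good.c₃_ne {r : ℝ} {x₁ x₂ y q : ℂ} (h : H.Good r x₁ x₂ y q) : H.c₃ x₁ x₂ ≠ 0 :=
  div_ne_zero (mul_ne_zero h.x₁_ne_t h.x₂_ne_t) (mul_ne_zero H.t_ne_zero H.t_sub_one_ne)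

variable (H) in
theorem aC_add_bC (x₁ x₂ y q : ℂ) : H.aC x₁ x₂ y q + H.bC x₁ x₂ y q = H.zC x₁ x₂ q := by
  simp only [aC, bC, rootA, rootB]
  ring

variable (H) in
theorem rtC_eq (x₁ x₂ y q : ℂ) : H.rtC x₁ x₂ y q =
    H.aC x₁ x₂ y q - H.bC x₁ x₂ y q + H.v x₁ x₂ y - H.w x₁ x₂ y := by
  simp only [aC, bC, rootA, rootB]
  ring

variable (H) in
theorem rtC_sq (x₁ x₂ : ℂ) {y : ℂ} (hy : y ≠ 0) (q : ℂ) :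
    H.rtC x₁ x₂ y q ^ 2 = disc (H.zC x₁ x₂ q) (H.v x₁ x₂ y) (H.w x₁ x₂ y) :=
  rootDisc_sq (div_ne_zero hy H.one_sub_t_ne) _ _ _

variable (H) in
theorem root_equation (x₁ x₂ : ℂ) {y : ℂ} (hy : y ≠ 0) (q : ℂ) :
    H.aC x₁ x₂ y q * H.bC x₁ x₂ y q + H.v x₁ x₂ y * H.bC x₁ x₂ y q
      + H.w x₁ x₂ y * H.aC x₁ x₂ y q = 0 := by
  have h := H.rtC_sq x₁ x₂ hy q
  simp only [aC, bC, rootA, rootB, disc] at h ⊢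
  linear_combination (-1 / 4) * h

section Path

variable {r : ℝ} {X Y Q : ℂ → ℂ} {X' Y' Q' s x₂ : ℂ}

set_option maxHeartbeats 1600000 in
theorem Good.hasDerivAt_path (hX : HasDerivAt X X' s) (hY : HasDerivAt Y Y' s)
    (hQ : HasDerivAt Q Q' s) (h : H.Good r (X s) x₂ (Y s) (Q s))
    {Z' v' w' : ℂ} (hZ' : Z' = -(x₂ / H.t * (X' * Q s + X s * Q')))
    (hv' : v' = H.vX x₂ (Y s) * X' + H.vY (X s) x₂ * Y')
    (hw' : w' = H.wX x₂ (Y s) * X' + H.wY (X s) x₂ * Y') :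
    HasDerivAt (fun s => H.v (X s) x₂ (Y s)) v' s ∧ HasDerivAt (fun s => H.w (X s) x₂ (Y s)) w' s ∧
    HasDerivAt (fun s => H.rtC (X s) x₂ (Y s) (Q s))
      (deltaD (H.aC (X s) x₂ (Y s) (Q s)) (H.bC (X s) x₂ (Y s) (Q s)) (H.v (X s) x₂ (Y s))
        (H.w (X s) x₂ (Y s)) (H.rtC (X s) x₂ (Y s) (Q s)) Z' v' w') s ∧
    HasDerivAt (fun s => H.aC (X s) x₂ (Y s) (Q s))
      (aD (H.aC (X s) x₂ (Y s) (Q s)) (H.bC (X s) x₂ (Y s) (Q s)) (H.v (X s) x₂ (Y s))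
        (H.rtC (X s) x₂ (Y s) (Q s)) Z' v' w') s ∧
    HasDerivAt (fun s => H.bC (X s) x₂ (Y s) (Q s))
      (bD (H.aC (X s) x₂ (Y s) (Q s)) (H.bC (X s) x₂ (Y s) (Q s)) (H.w (X s) x₂ (Y s))
        (H.rtC (X s) x₂ (Y s) (Q s)) Z' v' w') s ∧
    HasDerivAt (fun s => H.eC (X s) x₂ (Y s) (Q s))
      (H.eC (X s) x₂ (Y s) (Q s) * (H.lD (X s) x₂ (Y s) (Q s) Z' v' w'
        - (H.s₂ - 1) * (X' / (X s - 1)) - (H.s₃ - 1) * (X' / (X s - H.t)))) s := by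
  have ht := H.t_ne_zero
  have ht1 := H.t_sub_one_ne
  have ht2 := H.one_sub_t_ne
  have hv : HasDerivAt (fun s => H.v (X s) x₂ (Y s)) v' s := by
    have := ((((hX.sub_const 1).mul_const (x₂ - 1)).fun_mul (hY.sub_const 1)).div_const
      ((H.t - 1) ^ 2))
    refine this.congr_deriv ?_
    rw [hv', vX, vY]
    field_simp
  have hw : HasDerivAt (fun s => H.w (X s) x₂ (Y s)) w' s := by
    have := ((((hX.sub_const H.t).mul_const (x₂ - H.t)).fun_mul (hY.sub_const H.t)).div_const
      (H.t * (H.t - 1) ^ 2))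
    refine this.congr_deriv ?_
    rw [hw', wX, wY]
    field_simp
  have hZ : HasDerivAt (fun s => H.zC (X s) x₂ (Q s)) Z' s := by
    have := ((((hX.mul_const x₂).div_const H.t).fun_mul hQ).const_sub 1)
    refine this.congr_deriv ?_
    rw [hZ']
    field_simp
  have hη0 : Y s / (1 - H.t) ≠ 0 := div_ne_zero h.y_ne H.one_sub_t_ne
  have hΔ := hasDerivAt_rootDisc hZ hv hw (hY.div_const (1 - H.t)) hη0 h.disc_mem
  have ha := hasDerivAt_rootA hZ hv hw h.rt_ne hΔ
  have hb := hasDerivAt_rootB hZ hv hw h.rt_ne hΔ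
  have hΔ' := hΔ.congr_deriv (deltaD_eq h.rt_ne).symm
  have hc2 : HasDerivAt (fun s => H.c₂ (X s) x₂) (X' * (x₂ - 1) / (1 - H.t)) s :=
    ((hX.sub_const 1).mul_const (x₂ - 1)).div_const (1 - H.t)
  have hc3 : HasDerivAt (fun s => H.c₃ (X s) x₂) (X' * (x₂ - H.t) / (H.t * (H.t - 1))) s :=
    ((hX.sub_const H.t).mul_const (x₂ - H.t)).div_const (H.t * (H.t - 1))
  refine ⟨hv, hw, hΔ', ha, hb, ?_⟩
  refine (hasDerivAt_powers (a := fun s => H.aC (X s) x₂ (Y s) (Q s)) (b := fun s => H.bC (X s) x₂ (Y s) (Q s))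
    (Δ := fun s => H.rtC (X s) x₂ (Y s) (Q s)) (c₂ := fun s => H.c₂ (X s) x₂)
    (c₃ := fun s => H.c₃ (X s) x₂) (v := fun s => H.v (X s) x₂ (Y s)) (w := fun s => H.w (X s) x₂ (Y s))
    (H.s₂ - 1) (H.s₃ - 1) ha hb hΔ' hc2 hc3 h.c₂_ne h.c₃_ne h.a_mem h.b_mem h.rt_ne).congr_deriv ?_
  have e2 : X' * (x₂ - 1) / (1 - H.t) / H.c₂ (X s) x₂ = X' / (X s - 1) := by
    have h1 := h.x₁_ne_one
    have h2 := h.x₂_ne_one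
    rw [c₂]
    field_simp
  have e3 : X' * (x₂ - H.t) / (H.t * (H.t - 1)) / H.c₃ (X s) x₂ = X' / (X s - H.t) := by
    have h1 := h.x₁_ne_t
    have h2 := h.x₂_ne_t
    rw [c₃]
    field_simp
  rw [e2, e3]
  rfl

theorem Good.hasDerivAt_lD (hX : HasDerivAt X X' s) (hY : HasDerivAt Y Y' s)
    (hQ : HasDerivAt Q Q' s) (h : H.Good r (X s) x₂ (Y s) (Q s))
    {Z' v' w' : ℂ} (hZ' : Z' = -(x₂ / H.t * (X' * Q s + X s * Q')))
    (hv' : v' = H.vX x₂ (Y s) * X' + H.vY (X s) x₂ * Y')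
    (hw' : w' = H.wX x₂ (Y s) * X' + H.wY (X s) x₂ * Y') (Z₁ v₁ w₁ : ℂ) :
    HasDerivAt (fun s => H.lD (X s) x₂ (Y s) (Q s) Z₁ v₁ w₁)
      (H.lDD (X s) x₂ (Y s) (Q s) Z₁ v₁ w₁ Z' v' w') s := by
  obtain ⟨hv, hw, hΔ, ha, hb, -⟩ := h.hasDerivAt_path hX hY hQ hZ' hv' hw'
  exact HeunParams.hasDerivAt_logD _ _ Z₁ v₁ w₁ hv hw ha hb hΔ h.a_ne h.b_ne h.rt_ne

end Path

end HeunParams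

end

noncomputable section

namespace HeunParams

variable (H : HeunParams)

/-- The leading coefficient of the Heun operator. -/
def cubic (x : ℂ) : ℂ := x * ((x - 1) * (x - H.t))

/-- The coefficient of the first derivative in the Heun operator. -/
def quad (x : ℂ) : ℂ :=
  H.s₁ * ((x - 1) * (x - H.t)) + H.s₂ * (x * (x - H.t)) + H.s₃ * (x * (x - 1))

/-- The coefficient of the first derivative in the adjoint of the Heun operator. -/
def adjLin (y : ℂ) : ℂ :=
  2 * ((y - 1) * (y - H.t) + y * (y - H.t) + y * (y - 1)) - H.quad y

/-- The coefficient of order zero in the adjoint of the Heun operator. -/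
def adjZero (y : ℂ) : ℂ :=
  6 * y - 2 - 2 * H.t - (H.s₁ * (2 * y - 1 - H.t) + H.s₂ * (2 * y - H.t) + H.s₃ * (2 * y - 1))
    + H.r₁ * H.r₂ * y

/-- Logarithmic `x₁`-derivative of `eC`. -/
def lX (x₁ x₂ y q : ℂ) : ℂ :=
  H.lD x₁ x₂ y q (-(x₂ / H.t * q)) (H.vX x₂ y) (H.wX x₂ y)
    - (H.s₂ - 1) / (x₁ - 1) - (H.s₃ - 1) / (x₁ - H.t)

/-- The `x₁`-derivative of `lX`. -/
def lXX (x₁ x₂ y q : ℂ) : ℂ :=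
  H.lDD x₁ x₂ y q (-(x₂ / H.t * q)) (H.vX x₂ y) (H.wX x₂ y) (-(x₂ / H.t * q)) (H.vX x₂ y)
    (H.wX x₂ y) + (H.s₂ - 1) / (x₁ - 1) ^ 2 + (H.s₃ - 1) / (x₁ - H.t) ^ 2

/-- The `x₁`-derivative of `fC`. -/
def fX (x₁ x₂ y q : ℂ) : ℂ :=
  H.eC x₁ x₂ y q * (x₂ / H.t * q * pser (dcoef H.hc) (H.u x₁ x₂ * q)
    + pser H.hc (H.u x₁ x₂ * q) * H.lX x₁ x₂ y q)

/-- The second `x₁`-derivative of `fC`. -/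
def fXX (x₁ x₂ y q : ℂ) : ℂ :=
  H.eC x₁ x₂ y q * ((x₂ / H.t * q) ^ 2 * pser (dcoef (dcoef H.hc)) (H.u x₁ x₂ * q)
    + 2 * (x₂ / H.t * q) * pser (dcoef H.hc) (H.u x₁ x₂ * q) * H.lX x₁ x₂ y q
    + pser H.hc (H.u x₁ x₂ * q) * (H.lX x₁ x₂ y q ^ 2 + H.lXX x₁ x₂ y q))

/-- The `y`-derivative of `fC`. -/
def fY (x₁ x₂ y q : ℂ) : ℂ :=
  H.eC x₁ x₂ y q * (pser H.hc (H.u x₁ x₂ * q) * H.lD x₁ x₂ y q 0 (H.vY x₁ x₂) (H.wY x₁ x₂))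

/-- The second `y`-derivative of `fC`. -/
def fYY (x₁ x₂ y q : ℂ) : ℂ :=
  H.eC x₁ x₂ y q * (pser H.hc (H.u x₁ x₂ * q) *
    (H.lD x₁ x₂ y q 0 (H.vY x₁ x₂) (H.wY x₁ x₂) ^ 2
      + H.lDD x₁ x₂ y q 0 (H.vY x₁ x₂) (H.wY x₁ x₂) 0 (H.vY x₁ x₂) (H.wY x₁ x₂)))

/-- The coefficient of the hypergeometric function in `flux`. -/
def lam (x₁ x₂ y q : ℂ) : ℂ :=
  (x₁ - y) * (H.zC x₁ x₂ q * H.lD x₁ x₂ y q 1 0 0 - (H.s₂ - 1 + (H.s₃ - 1)))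
    + 2 * ((x₁ - 1) * (x₁ - H.t)) * (H.lD x₁ x₂ y q 0 (H.vX x₂ y) (H.wX x₂ y)
      - (H.s₂ - 1) / (x₁ - 1) - (H.s₃ - 1) / (x₁ - H.t))
    + (H.s₂ * (x₁ - H.t) + H.s₃ * (x₁ - 1))
    - x₂ / H.t * ((x₁ - 1) * (x₁ - H.t)) * q * H.lD x₁ x₂ y q 1 0 0

/-- The coefficient of the derivative of the hypergeometric function in `flux`. -/
def nu (x₁ x₂ y q : ℂ) : ℂ :=
  (x₁ - y) * H.zC x₁ x₂ q + x₂ / H.t * ((x₁ - 1) * (x₁ - H.t)) * q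

/-- The function `w` for which `q^{s₁-1} w` is a primitive of the Heun operator in `x₁` minus the
adjoint Heun operator in `y`, applied to the integrand. -/
def flux (x₁ x₂ y q : ℂ) : ℂ :=
  H.eC x₁ x₂ y q * (pser H.hc (H.u x₁ x₂ * q) * H.lam x₁ x₂ y q
    + pser (dcoef H.hc) (H.u x₁ x₂ * q) * H.nu x₁ x₂ y q)

/-- The `q`-derivative of `lam`. -/
def lamQ (x₁ x₂ y q : ℂ) : ℂ :=
  (x₁ - y) * (-(x₂ / H.t * x₁) * H.lD x₁ x₂ y q 1 0 0
      + H.zC x₁ x₂ q * H.lDD x₁ x₂ y q 1 0 0 (-(x₂ / H.t * x₁)) 0 0)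
    + 2 * ((x₁ - 1) * (x₁ - H.t)) *
      H.lDD x₁ x₂ y q 0 (H.vX x₂ y) (H.wX x₂ y) (-(x₂ / H.t * x₁)) 0 0
    - x₂ / H.t * ((x₁ - 1) * (x₁ - H.t)) * (H.lD x₁ x₂ y q 1 0 0
      + q * H.lDD x₁ x₂ y q 1 0 0 (-(x₂ / H.t * x₁)) 0 0)

/-- The `q`-derivative of `flux`. -/
def fluxQ (x₁ x₂ y q : ℂ) : ℂ :=
  H.eC x₁ x₂ y q * (H.lD x₁ x₂ y q (-(x₂ / H.t * x₁)) 0 0 *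
    (pser H.hc (H.u x₁ x₂ * q) * H.lam x₁ x₂ y q
      + pser (dcoef H.hc) (H.u x₁ x₂ * q) * H.nu x₁ x₂ y q)
    + x₂ / H.t * x₁ * (pser (dcoef H.hc) (H.u x₁ x₂ * q) * H.lam x₁ x₂ y q
      + pser (dcoef (dcoef H.hc)) (H.u x₁ x₂ * q) * H.nu x₁ x₂ y q)
    + pser H.hc (H.u x₁ x₂ * q) * H.lamQ x₁ x₂ y q
    + pser (dcoef H.hc) (H.u x₁ x₂ * q) * (-(x₁ - y) * (x₂ / H.t * x₁)
      + x₂ / H.t * ((x₁ - 1) * (x₁ - H.t))))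

variable {H} {r : ℝ} {x₁ x₂ y q : ℂ}

theorem hasDerivAt_pser_x {a : ℕ → ℂ} (ha : SumOn a r) (h : H.Good r x₁ x₂ y q) :
    HasDerivAt (fun x => pser a (H.u x x₂ * q))
      (x₂ / H.t * q * pser (dcoef a) (H.u x₁ x₂ * q)) x₁ := by
  have h1 : HasDerivAt (fun x => H.u x x₂ * q) (x₂ / H.t * q) x₁ := by
    refine ((((hasDerivAt_id x₁).mul_const x₂).div_const H.t).mul_const q).congr_deriv ?_
    ring
  exact ((ha.hasDerivAt h.u_lt).comp x₁ h1).congr_deriv (mul_comm _ _)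

theorem hasDerivAt_pser_q {a : ℕ → ℂ} (ha : SumOn a r) (h : H.Good r x₁ x₂ y q) :
    HasDerivAt (fun q => pser a (H.u x₁ x₂ * q))
      (x₂ / H.t * x₁ * pser (dcoef a) (H.u x₁ x₂ * q)) q := by
  have h1 : HasDerivAt (fun q => H.u x₁ x₂ * q) (x₂ / H.t * x₁) q := by
    refine ((hasDerivAt_id q).const_mul (H.u x₁ x₂)).congr_deriv ?_
    rw [u]
    ring
  exact ((ha.hasDerivAt h.u_lt).comp q h1).congr_deriv (mul_comm _ _)

theorem Good.hasDerivAt_eC_x (h : H.Good r x₁ x₂ y q) :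
    HasDerivAt (fun x => H.eC x x₂ y q) (H.eC x₁ x₂ y q * H.lX x₁ x₂ y q) x₁ := by
  have := (h.hasDerivAt_path (hasDerivAt_id x₁) (hasDerivAt_const x₁ y) (hasDerivAt_const x₁ q)
    (Z' := -(x₂ / H.t * q)) (v' := H.vX x₂ y) (w' := H.wX x₂ y)
    (by simp) (by simp) (by simp)).2.2.2.2.2
  refine this.congr_deriv ?_
  rw [lX]
  simp only [id]
  ring

theorem Good.hasDerivAt_lX (h : H.Good r x₁ x₂ y q) :
    HasDerivAt (fun x => H.lX x x₂ y q) (H.lXX x₁ x₂ y q) x₁ := by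
  have h1 := h.hasDerivAt_lD (hasDerivAt_id x₁) (hasDerivAt_const x₁ y) (hasDerivAt_const x₁ q)
    (Z' := -(x₂ / H.t * q)) (v' := H.vX x₂ y) (w' := H.wX x₂ y)
    (by simp) (by simp) (by simp) (-(x₂ / H.t * q)) (H.vX x₂ y) (H.wX x₂ y)
  have h2 := (((hasDerivAt_id x₁).sub_const 1).fun_inv h.x₁_ne_one).const_mul (H.s₂ - 1)
  have h3 := (((hasDerivAt_id x₁).sub_const H.t).fun_inv h.x₁_ne_t).const_mul (H.s₃ - 1)
  refine ((h1.fun_sub h2).fun_sub h3).congr_deriv ?_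
  rw [lXX]
  simp only [id]
  ring

theorem Good.hasDerivAt_fC_x (hr : SumOn H.hc r) (h : H.Good r x₁ x₂ y q) :
    HasDerivAt (fun x => H.fC x x₂ y q) (H.fX x₁ x₂ y q) x₁ := by
  refine ((hasDerivAt_pser_x hr h).fun_mul h.hasDerivAt_eC_x).congr_deriv ?_
  rw [fX]
  ring

theorem Good.hasDerivAt_fX (hr : SumOn H.hc r) (h : H.Good r x₁ x₂ y q) :
    HasDerivAt (fun x => H.fX x x₂ y q) (H.fXX x₁ x₂ y q) x₁ := by
  refine (h.hasDerivAt_eC_x.fun_mul (((hasDerivAt_pser_x hr.dcoef h).const_mul (x₂ / H.t * q)).fun_add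
    ((hasDerivAt_pser_x hr h).fun_mul h.hasDerivAt_lX))).congr_deriv ?_
  rw [fXX]
  ring

theorem Good.hasDerivAt_eC_y (h : H.Good r x₁ x₂ y q) :
    HasDerivAt (fun y => H.eC x₁ x₂ y q)
      (H.eC x₁ x₂ y q * H.lD x₁ x₂ y q 0 (H.vY x₁ x₂) (H.wY x₁ x₂)) y := by
  have := (h.hasDerivAt_path (hasDerivAt_const y x₁) (hasDerivAt_id y) (hasDerivAt_const y q)
    (Z' := 0) (v' := H.vY x₁ x₂) (w' := H.wY x₁ x₂) (by simp) (by simp) (by simp)).2.2.2.2.2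
  refine this.congr_deriv ?_
  simp

theorem Good.hasDerivAt_fC_y (h : H.Good r x₁ x₂ y q) :
    HasDerivAt (fun y => H.fC x₁ x₂ y q) (H.fY x₁ x₂ y q) y := by
  refine (h.hasDerivAt_eC_y.const_mul _).congr_deriv ?_
  rw [fY]
  ring

theorem Good.hasDerivAt_fY (h : H.Good r x₁ x₂ y q) :
    HasDerivAt (fun y => H.fY x₁ x₂ y q) (H.fYY x₁ x₂ y q) y := by
  have h1 := h.hasDerivAt_lD (hasDerivAt_const y x₁) (hasDerivAt_id y) (hasDerivAt_const y q)
    (Z' := 0) (v' := H.vY x₁ x₂) (w' := H.wY x₁ x₂) (by simp) (by simp) (by simp) 0 (H.vY x₁ x₂)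
    (H.wY x₁ x₂)
  refine (h.hasDerivAt_eC_y.fun_mul (h1.const_mul (pser H.hc (H.u x₁ x₂ * q)))).congr_deriv ?_
  rw [fYY]
  simp only [id]
  ring

theorem Good.hasDerivAt_flux (hr : SumOn H.hc r) (h : H.Good r x₁ x₂ y q) :
    HasDerivAt (fun q => H.flux x₁ x₂ y q) (H.fluxQ x₁ x₂ y q) q := by
  have hl := fun Z₁ v₁ w₁ => h.hasDerivAt_lD (hasDerivAt_const q x₁) (hasDerivAt_const q y)
    (hasDerivAt_id q) (Z' := -(x₂ / H.t * x₁)) (v' := 0) (w' := 0) (by simp) (by simp) (by simp)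
    Z₁ v₁ w₁
  have he := (h.hasDerivAt_path (hasDerivAt_const q x₁) (hasDerivAt_const q y)
    (hasDerivAt_id q) (Z' := -(x₂ / H.t * x₁)) (v' := 0) (w' := 0) (by simp) (by simp)
    (by simp)).2.2.2.2.2
  simp only [id, zero_div, mul_zero, sub_zero] at hl he
  have hz : HasDerivAt (fun q => H.zC x₁ x₂ q) (-(x₂ / H.t * x₁)) q := by
    refine (((hasDerivAt_id q).const_mul (H.u x₁ x₂)).const_sub 1).congr_deriv ?_
    rw [u]
    ring
  have hlam : HasDerivAt (fun q => H.lam x₁ x₂ y q) (H.lamQ x₁ x₂ y q) q := by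
    have h1 := ((hz.fun_mul (hl 1 0 0)).sub_const (H.s₂ - 1 + (H.s₃ - 1))).const_mul (x₁ - y)
    have h2 := (((hl 0 (H.vX x₂ y) (H.wX x₂ y)).sub_const ((H.s₂ - 1) / (x₁ - 1))).sub_const
      ((H.s₃ - 1) / (x₁ - H.t))).const_mul (2 * ((x₁ - 1) * (x₁ - H.t)))
    have h3 := (((hasDerivAt_id q).const_mul (x₂ / H.t * ((x₁ - 1) * (x₁ - H.t)))).fun_mul
      (hl 1 0 0))
    refine (((h1.fun_add h2).add_const
      (H.s₂ * (x₁ - H.t) + H.s₃ * (x₁ - 1))).fun_sub h3).congr_deriv ?_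
    rw [lamQ]
    simp only [id]
    ring
  have hnu : HasDerivAt (fun q => H.nu x₁ x₂ y q) (-(x₁ - y) * (x₂ / H.t * x₁)
      + x₂ / H.t * ((x₁ - 1) * (x₁ - H.t))) q := by
    refine ((hz.const_mul (x₁ - y)).fun_add
      ((hasDerivAt_id q).const_mul (x₂ / H.t * ((x₁ - 1) * (x₁ - H.t))))).congr_deriv ?_
    ring
  refine (he.fun_mul (((hasDerivAt_pser_q hr h).fun_mul hlam).fun_add
    ((hasDerivAt_pser_q hr.dcoef h).fun_mul hnu))).congr_deriv ?_
  rw [fluxQ]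
  ring

end HeunParams

end

noncomputable section

namespace HeunParams

/-- The identities between the logarithmic derivatives, for roots `a, b`. -/
theorem log_identities {m n s a b v w Δ Z : ℂ} (ha : a ≠ 0) (hb : b ≠ 0) (hΔ : Δ ≠ 0) (hZ : Z ≠ 0)
    (hab : a + b = Z) (hroot : a * b + v * b + w * a = 0) (hD : Δ = a - b + v - w)
    {L1 L2 L3 M11 M22 M23 M33 g : ℂ} (hL1 : L1 = logD m n a b v w Δ 1 0 0)
    (hL2 : L2 = logD m n a b v w Δ 0 1 0) (hL3 : L3 = logD m n a b v w Δ 0 0 1)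
    (hM11 : M11 = logDD m n a b v w Δ 1 0 0 1 0 0) (hM22 : M22 = logDD m n a b v w Δ 0 1 0 0 1 0)
    (hM23 : M23 = logDD m n a b v w Δ 0 1 0 0 0 1) (hM33 : M33 = logDD m n a b v w Δ 0 0 1 0 0 1)
    (hg : g = (m + n - 1) * L1 - Z * (M11 + L1 ^ 2)) :
    M22 * v ^ 2 + (L2 * v) ^ 2 = v * g - (1 - m) * (L2 * v) ∧
    M33 * w ^ 2 + (L3 * w) ^ 2 = w * g - (1 - n) * (L3 * w) ∧
    (((v * g - (1 - m) * (L2 * v)) - 2 * m * (L2 * v) + m * (m + 1))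
        + 2 * ((M23 * (v * w) + L2 * v * (L3 * w)) - n * (L2 * v) - m * (L3 * w) + m * n)
        + ((w * g - (1 - n) * (L3 * w)) - 2 * n * (L3 * w) + n * (n + 1))
        + (m + n + 4 - s) * ((L2 * v - m) + (L3 * w - n)) + (1 - s) * (m + n + 2) =
      -s - m - n - (s - 1) * (m + n - Z * L1) - Z * g) ∧
    logDD m n a b v w Δ 1 0 0 0 1 0 = logDD m n a b v w Δ 0 1 0 1 0 0 ∧
    logDD m n a b v w Δ 1 0 0 0 0 1 = logDD m n a b v w Δ 0 0 1 1 0 0 ∧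
    logDD m n a b v w Δ 0 1 0 0 0 1 = logDD m n a b v w Δ 0 0 1 0 1 0 := by
  have hA : a / Δ ≠ 0 := div_ne_zero ha hΔ
  have hB : b / Δ ≠ 0 := div_ne_zero hb hΔ
  have hAB : a / Δ + b / Δ ≠ 0 := by rw [← add_div, hab]; exact div_ne_zero hZ hΔ
  have hab' : a + b ≠ 0 := hab ▸ hZ
  have ea : a / Δ * Δ = a := div_mul_cancel₀ a hΔ
  have eb : b / Δ * Δ = b := div_mul_cancel₀ b hΔ
  have ev : -(a / Δ * (a / Δ - 1) / (a / Δ + b / Δ)) * Δ = v := by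
    rw [← add_div]
    field_simp
    rw [hD]
    linear_combination (-1 : ℂ) * hroot
  have ew : -(b / Δ * (b / Δ + 1) / (a / Δ + b / Δ)) * Δ = w := by
    rw [← add_div]
    field_simp
    rw [hD]
    linear_combination (-1 : ℂ) * hroot
  have h0 := log_identity_homogeneous (m := m) (n := n) (s := s) hA hB hΔ hAB
  have h1 := log_identity_bessel₁ (m := m) (n := n) hA hB hΔ hAB
  have h2 := log_identity_bessel₂ (m := m) (n := n) hA hB hΔ hAB
  have h3 := logDD_symm (m := m) (n := n) hA hB hΔ hAB
  simp only [ea, eb, ev, ew] at h0 h1 h2 h3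
  rw [hab, ← hL1, ← hM11] at h0 h1 h2
  rw [← hL2, ← hM22] at h0 h1
  rw [← hL3, ← hM33] at h0 h2
  rw [← hM23] at h0
  have k1 : M22 * v ^ 2 + (L2 * v) ^ 2 = v * g - (1 - m) * (L2 * v) := by
    apply mul_left_cancel₀ hZ
    rw [hg]
    linear_combination h1
  have k2 : M33 * w ^ 2 + (L3 * w) ^ 2 = w * g - (1 - n) * (L3 * w) := by
    apply mul_left_cancel₀ hZ
    rw [hg]
    linear_combination h2
  refine ⟨k1, k2, ?_, h3⟩
  linear_combination h0 - k1 - k2 + Z * hg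

variable {H : HeunParams} {r : ℝ} {x₁ x₂ y q : ℂ}

theorem Good.zC_ne (hr1 : r ≤ 1) (h : H.Good r x₁ x₂ y q) : H.zC x₁ x₂ q ≠ 0 := by
  intro h0
  have h1 : H.u x₁ x₂ * q = 1 := by rw [zC] at h0; linear_combination -h0
  have := h.u_lt
  rw [h1, norm_one] at this
  linarith

set_option maxHeartbeats 4000000 in
/-- The Heun operator in `x₁` minus its adjoint in `y`, applied to the integrand, is a total
derivative. -/
theorem Good.pde (hr : SumOn H.hc r) (hr1 : r ≤ 1) (hs : 0 < (H.s₁ - 1).re)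
    (h : H.Good r x₁ x₂ y q) (hy1 : y - 1 ≠ 0) (hyt : y - H.t ≠ 0) :
    H.cubic x₁ * H.fXX x₁ x₂ y q + H.quad x₁ * H.fX x₁ x₂ y q
        + H.r₁ * H.r₂ * x₁ * H.fC x₁ x₂ y q
      - (H.cubic y * H.fYY x₁ x₂ y q + H.adjLin y * H.fY x₁ x₂ y q
        + H.adjZero y * H.fC x₁ x₂ y q) =
    (H.s₁ - 1) * H.flux x₁ x₂ y q + q * H.fluxQ x₁ x₂ y q := by
  obtain ⟨k1, k2, hom, s12, s13, s23⟩ := log_identities (m := H.s₂ - 1) (n := H.s₃ - 1) (s := H.s₁)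
    h.a_ne h.b_ne h.rt_ne (h.zC_ne hr1) (H.aC_add_bC x₁ x₂ y q) (H.root_equation x₁ x₂ h.y_ne q)
    (H.rtC_eq x₁ x₂ y q) rfl rfl rfl rfl rfl rfl rfl rfl
  have ker := kernel_identity (rr := H.r₁ * H.r₂) H.t_ne_zero H.t_sub_one_ne h.x₁_ne_one
    h.x₁_ne_t hy1 hyt (rfl : H.v x₁ x₂ y = _) (rfl : H.w x₁ x₂ y = _) hom
  have ode := hypergeometric_ode (H.r₁ - 1) (H.r₂ - 1) hs hr h.u_lt
  change _ + _ * pser (dcoef H.hc) _ - _ * pser H.hc _ = 0 at ode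
  change _ * pser (dcoef (dcoef H.hc)) _ + _ - _ = 0 at ode
  have hvX : H.vX x₂ y = H.v x₁ x₂ y / (x₁ - 1) := by
    have := h.x₁_ne_one
    rw [vX, v]; field_simp
  have hwX : H.wX x₂ y = H.w x₁ x₂ y / (x₁ - H.t) := by
    have := h.x₁_ne_t
    rw [wX, w]; field_simp
  have hvY : H.vY x₁ x₂ = H.v x₁ x₂ y / (y - 1) := by
    rw [vY, v]; field_simp
  have hwY : H.wY x₁ x₂ = H.w x₁ x₂ y / (y - H.t) := by
    rw [wY, w]; field_simp
  have eu : H.u x₁ x₂ = x₂ / H.t * x₁ := by rw [u]; ring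
  have hlD : ∀ Z' v' w', H.lD x₁ x₂ y q Z' v' w' = H.lD x₁ x₂ y q 1 0 0 * Z'
      + H.lD x₁ x₂ y q 0 1 0 * v' + H.lD x₁ x₂ y q 0 0 1 * w' := fun _ _ _ => logD_lin ..
  have hlDD : ∀ Z₁ v₁ w₁ Z₂ v₂ w₂, H.lDD x₁ x₂ y q Z₁ v₁ w₁ Z₂ v₂ w₂ =
      H.lDD x₁ x₂ y q 1 0 0 1 0 0 * (Z₁ * Z₂)
      + H.lDD x₁ x₂ y q 1 0 0 0 1 0 * (Z₁ * v₂)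
      + H.lDD x₁ x₂ y q 1 0 0 0 0 1 * (Z₁ * w₂)
      + H.lDD x₁ x₂ y q 1 0 0 0 1 0 * (v₁ * Z₂)
      + H.lDD x₁ x₂ y q 0 1 0 0 1 0 * (v₁ * v₂)
      + H.lDD x₁ x₂ y q 0 1 0 0 0 1 * (v₁ * w₂)
      + H.lDD x₁ x₂ y q 1 0 0 0 0 1 * (w₁ * Z₂)
      + H.lDD x₁ x₂ y q 0 1 0 0 0 1 * (w₁ * v₂)
      + H.lDD x₁ x₂ y q 0 0 1 0 0 1 * (w₁ * w₂) := by
    intro Z₁ v₁ w₁ Z₂ v₂ w₂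
    have := logDD_lin (H.s₂ - 1) (H.s₃ - 1) (H.aC x₁ x₂ y q) (H.bC x₁ x₂ y q) (H.v x₁ x₂ y)
      (H.w x₁ x₂ y) (H.rtC x₁ x₂ y q) Z₁ v₁ w₁ Z₂ v₂ w₂
    rw [← s12, ← s13, ← s23] at this
    exact this
  simp only [fXX, fX, fC, fYY, fY, flux, fluxQ, lXX, lX, lam, lamQ, nu]
  simp only [hlD _ (H.vX x₂ y) _, hlD _ (H.vY x₁ x₂) _, hlD (-(x₂ / H.t * x₁)) _ _,
    hlDD _ _ _ _ (H.vX x₂ y) _, hlDD _ _ _ _ (H.vY x₁ x₂) _, hlDD _ _ _ (-(x₂ / H.t * x₁)) _ _]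
  change H.lDD x₁ x₂ y q 0 1 0 0 1 0 * _ + (H.lD x₁ x₂ y q 0 1 0 * _) ^ 2 =
    _ * (_ * H.lD x₁ x₂ y q 1 0 0 - _ * (H.lDD x₁ x₂ y q 1 0 0 1 0 0 + H.lD x₁ x₂ y q 1 0 0 ^ 2))
     - _ * (H.lD x₁ x₂ y q 0 1 0 * _) at k1
  change H.lDD x₁ x₂ y q 0 0 1 0 0 1 * _ + (H.lD x₁ x₂ y q 0 0 1 * _) ^ 2 =
    _ * (_ * H.lD x₁ x₂ y q 1 0 0 - _ * (H.lDD x₁ x₂ y q 1 0 0 1 0 0 + H.lD x₁ x₂ y q 1 0 0 ^ 2))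
     - _ * (H.lD x₁ x₂ y q 0 0 1 * _) at k2
  simp only [← show ∀ Z' v' w', H.lD x₁ x₂ y q Z' v' w' = logD (H.s₂ - 1) (H.s₃ - 1) (H.aC x₁ x₂ y q)
    (H.bC x₁ x₂ y q) (H.v x₁ x₂ y) (H.w x₁ x₂ y) (H.rtC x₁ x₂ y q) Z' v' w' from fun _ _ _ => rfl,
    ← show ∀ Z₁ v₁ w₁ Z₂ v₂ w₂, H.lDD x₁ x₂ y q Z₁ v₁ w₁ Z₂ v₂ w₂ = logDD (H.s₂ - 1) (H.s₃ - 1)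
    (H.aC x₁ x₂ y q) (H.bC x₁ x₂ y q) (H.v x₁ x₂ y) (H.w x₁ x₂ y) (H.rtC x₁ x₂ y q)
    Z₁ v₁ w₁ Z₂ v₂ w₂ from fun _ _ _ _ _ _ => rfl] at ker
  rw [hvX, hwX, hvY, hwY]
  generalize H.lDD x₁ x₂ y q 1 0 0 1 0 0 = M11 at *
  generalize H.lDD x₁ x₂ y q 1 0 0 0 1 0 = M12 at *
  generalize H.lDD x₁ x₂ y q 1 0 0 0 0 1 = M13 at *
  generalize H.lDD x₁ x₂ y q 0 1 0 0 1 0 = M22 at *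
  generalize H.lDD x₁ x₂ y q 0 1 0 0 0 1 = M23 at *
  generalize H.lDD x₁ x₂ y q 0 0 1 0 0 1 = M33 at *
  generalize H.lD x₁ x₂ y q 1 0 0 = L1 at *
  generalize H.lD x₁ x₂ y q 0 1 0 = L2 at *
  generalize H.lD x₁ x₂ y q 0 0 1 = L3 at *
  have hx1 := h.x₁_ne_one
  have hxt := h.x₁_ne_t
  have hZ : H.zC x₁ x₂ q = 1 - x₂ / H.t * x₁ * q := by rw [zC, eu]
  have eu' : H.u x₁ x₂ * q = 1 - H.zC x₁ x₂ q := by rw [zC]; ring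
  rw [eu'] at ode ⊢
  generalize pser H.hc (1 - H.zC x₁ x₂ q) = F₀ at *
  generalize pser (dcoef H.hc) (1 - H.zC x₁ x₂ q) = F₁ at *
  generalize pser (dcoef (dcoef H.hc)) (1 - H.zC x₁ x₂ q) = F₂ at *
  generalize H.eC x₁ x₂ y q = E at *
  generalize H.v x₁ x₂ y = v at *
  generalize H.w x₁ x₂ y = w at *
  generalize H.zC x₁ x₂ q = Z at *
  generalize x₂ / H.t = κ at *
  clear hlD hlDD s12 s13 s23 hom hr h hvX hvY hwX hwY
  rw [← k1, ← k2] at ker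
  have tot := total_derivative_identity (x := x₁) (y := y) (q := q) (κ := κ)
    (p := (x₁ - 1) * (x₁ - H.t)) (σ := H.s₂ * (x₁ - H.t) + H.s₃ * (x₁ - 1)) (s := H.s₁)
    (m := H.s₂ - 1) (n := H.s₃ - 1) (rr := H.r₁ * H.r₂)
    (Ex := (L2 * v - (H.s₂ - 1)) / (x₁ - 1) + (L3 * w - (H.s₃ - 1)) / (x₁ - H.t))
    (Exx := M22 * (v / (x₁ - 1)) ^ 2 + 2 * M23 * (v / (x₁ - 1)) * (w / (x₁ - H.t))
      + M33 * (w / (x₁ - H.t)) ^ 2 + (H.s₂ - 1) / (x₁ - 1) ^ 2 + (H.s₃ - 1) / (x₁ - H.t) ^ 2)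
    (ExZ := M12 * (v / (x₁ - 1)) + M13 * (w / (x₁ - H.t)))
    (lZ := L1) (dZZ := M11) (F₀ := F₀) (F₁ := F₁) (F₂ := F₂)
    (DY := H.cubic y * ((L2 * (v / (y - 1)) + L3 * (w / (y - H.t))) ^ 2 +
        (M22 * (v / (y - 1)) ^ 2 + 2 * M23 * (v / (y - 1)) * (w / (y - H.t))
          + M33 * (w / (y - H.t)) ^ 2))
      + H.adjLin y * (L2 * (v / (y - 1)) + L3 * (w / (y - H.t))) + H.adjZero y)
    hZ ?_ ?_
  · rw [cubic.eq_def H x₁, quad.eq_def H x₁]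
    linear_combination E * tot
  · rw [cubic, adjLin, adjZero, quad]
    have hmul : ∀ z w : ℂ, (z * w)⁻¹ = z⁻¹ * w⁻¹ := mul_inv
    simp only [div_eq_mul_inv, ← inv_pow, mul_pow, hmul] at ker ⊢
    clear ode hZ k1 k2 hmul
    generalize (x₁ - 1)⁻¹ = i₁ at *
    generalize (x₁ - H.t)⁻¹ = i₂ at *
    generalize (y - 1)⁻¹ = j₁ at *
    generalize (y - H.t)⁻¹ = j₂ at *
    linear_combination ker
  · linear_combination ode + F₁ * (1 - Z) * H.fuchs - F₀ * H.fuchs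

end HeunParams

end

noncomputable section

namespace HeunParams

open Filter Topology

variable (H : HeunParams)

/-- The square root of the discriminant at `q = 1`, divided by `y / (1 - t)`, in terms of
`ξ₁ = x₁ / y` and `ξ₂ = x₂ / y`. -/
def g₁ (x₁ x₂ ξ₁ ξ₂ : ℂ) : ℂ := 1 - H.u x₁ x₂ - ξ₁ - ξ₂ + x₁ * ξ₂ / H.t * (1 + H.t)

/-- `2 (v + w) + 2 - u - u q` at `y = 0`. -/
def S₀ (x₁ x₂ q : ℂ) : ℂ :=
  2 - 2 * ((x₁ - 1) * (x₂ - 1) / (H.t - 1) ^ 2 + (x₁ - H.t) * (x₂ - H.t) / (H.t - 1) ^ 2)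
    - H.u x₁ x₂ - H.u x₁ x₂ * q

/-- The coefficient of `y` in `2 (v + w) + 2 - u - u q`. -/
def S₁ (x₁ x₂ : ℂ) : ℂ :=
  2 * ((x₁ - 1) * (x₂ - 1) / (H.t - 1) ^ 2 + (x₁ - H.t) * (x₂ - H.t) / (H.t * (H.t - 1) ^ 2))

/-- The discriminant divided by `(y / (1 - t))²`. -/
def gQ (x₁ x₂ ξ₁ ξ₂ q : ℂ) : ℂ :=
  H.g₁ x₁ x₂ ξ₁ ξ₂ ^ 2 + (1 - H.t) ^ 2 * (1 - q) *
    (ξ₁ * ξ₂ / H.t * H.S₀ x₁ x₂ q + x₁ * ξ₂ / H.t * H.S₁ x₁ x₂)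

/-- The change of the square root of the discriminant between `q` and `1`. -/
def gΔ (x₁ x₂ ξ₁ ξ₂ q : ℂ) : ℂ :=
  (1 - H.t) * (1 - q) * (x₁ * ξ₂ / H.t * H.S₀ x₁ x₂ q + H.u x₁ x₂ * H.S₁ x₁ x₂)
    / (H.gQ x₁ x₂ ξ₁ ξ₂ q ^ (1 / 2 : ℂ) + H.g₁ x₁ x₂ ξ₁ ξ₂)

/-- `a / c₂`. -/
def gA (x₁ x₂ ξ₁ ξ₂ q : ℂ) : ℂ :=
  1 + (H.u x₁ x₂ * (1 - q) + H.gΔ x₁ x₂ ξ₁ ξ₂ q) / (2 * H.c₂ x₁ x₂)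

/-- `b / c₃`. -/
def gB (x₁ x₂ ξ₁ ξ₂ q : ℂ) : ℂ :=
  1 + (H.u x₁ x₂ * (1 - q) - H.gΔ x₁ x₂ ξ₁ ξ₂ q) / (2 * H.c₃ x₁ x₂)

theorem disc_eq_gQ (x₁ x₂ : ℂ) {y : ℂ} (hy : y ≠ 0) (q : ℂ) :
    disc (H.zC x₁ x₂ q) (H.v x₁ x₂ y) (H.w x₁ x₂ y) * (1 / (y / (1 - H.t))) ^ 2 =
      H.gQ x₁ x₂ (x₁ / y) (x₂ / y) q := by
  have h1 := H.t_ne_zero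
  have h2 := H.t_sub_one_ne
  have h3 := H.one_sub_t_ne
  rw [gQ, g₁, S₀, S₁, disc, zC, v, w, u]
  field_simp
  ring

theorem rtC_eq_gQ (x₁ x₂ : ℂ) {y : ℂ} (hy : y ≠ 0) (q : ℂ) :
    H.rtC x₁ x₂ y q = y / (1 - H.t) * H.gQ x₁ x₂ (x₁ / y) (x₂ / y) q ^ (1 / 2 : ℂ) := by
  rw [rtC, rootDisc, H.disc_eq_gQ x₁ x₂ hy]

theorem rtC_eq_gΔ (x₁ x₂ : ℂ) {y : ℂ} (hy : y ≠ 0) (q : ℂ)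
    (h0 : H.gQ x₁ x₂ (x₁ / y) (x₂ / y) q ^ (1 / 2 : ℂ) + H.g₁ x₁ x₂ (x₁ / y) (x₂ / y) ≠ 0) :
    H.rtC x₁ x₂ y q = y / (1 - H.t) * H.g₁ x₁ x₂ (x₁ / y) (x₂ / y)
      + H.gΔ x₁ x₂ (x₁ / y) (x₂ / y) q := by
  have h1 := H.t_ne_zero
  have h3 := H.one_sub_t_ne
  have hsq : (H.gQ x₁ x₂ (x₁ / y) (x₂ / y) q ^ (1 / 2 : ℂ)) ^ 2 =
      H.gQ x₁ x₂ (x₁ / y) (x₂ / y) q := by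
    rw [← Complex.cpow_nat_mul]
    norm_num
  rw [H.rtC_eq_gQ x₁ x₂ hy, gΔ]
  nth_rewrite 2 [gQ] at hsq
  generalize H.gQ x₁ x₂ (x₁ / y) (x₂ / y) q ^ (1 / 2 : ℂ) = G at *
  generalize H.g₁ x₁ x₂ (x₁ / y) (x₂ / y) = g at *
  rw [u]
  field_simp
  field_simp at hsq
  linear_combination hsq

theorem aC_eq_gA (x₁ x₂ : ℂ) {y : ℂ} (hy : y ≠ 0) (q : ℂ) (hc : H.c₂ x₁ x₂ ≠ 0)
    (h0 : H.gQ x₁ x₂ (x₁ / y) (x₂ / y) q ^ (1 / 2 : ℂ) + H.g₁ x₁ x₂ (x₁ / y) (x₂ / y) ≠ 0) :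
    H.aC x₁ x₂ y q / H.c₂ x₁ x₂ = H.gA x₁ x₂ (x₁ / y) (x₂ / y) q := by
  have h1 := H.t_ne_zero
  have h2 := H.t_sub_one_ne
  have h3 := H.one_sub_t_ne
  rw [aC, rootA, H.rtC_eq_gΔ x₁ x₂ hy q h0, gA]
  have : H.zC x₁ x₂ q - H.v x₁ x₂ y + H.w x₁ x₂ y + y / (1 - H.t) * H.g₁ x₁ x₂ (x₁ / y) (x₂ / y)
      = 2 * H.c₂ x₁ x₂ + H.u x₁ x₂ * (1 - q) := by
    rw [zC, v, w, g₁, c₂, u]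
    field_simp
    ring
  rw [← add_assoc, this]
  field_simp
  ring

theorem bC_eq_gB (x₁ x₂ : ℂ) {y : ℂ} (hy : y ≠ 0) (q : ℂ) (hc : H.c₃ x₁ x₂ ≠ 0)
    (h0 : H.gQ x₁ x₂ (x₁ / y) (x₂ / y) q ^ (1 / 2 : ℂ) + H.g₁ x₁ x₂ (x₁ / y) (x₂ / y) ≠ 0) :
    H.bC x₁ x₂ y q / H.c₃ x₁ x₂ = H.gB x₁ x₂ (x₁ / y) (x₂ / y) q := by
  have h1 := H.t_ne_zero
  have h2 := H.t_sub_one_ne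
  have h3 := H.one_sub_t_ne
  rw [bC, rootB, H.rtC_eq_gΔ x₁ x₂ hy q h0, gB]
  have : H.zC x₁ x₂ q + H.v x₁ x₂ y - H.w x₁ x₂ y - y / (1 - H.t) * H.g₁ x₁ x₂ (x₁ / y) (x₂ / y)
      = 2 * H.c₃ x₁ x₂ + H.u x₁ x₂ * (1 - q) := by
    rw [zC, v, w, g₁, c₃, u]
    field_simp
    ring
  rw [← sub_sub, this]
  field_simp
  ring

/-- The quantities entering the integrand are close to their values at `x₁ = x₂ = 0`. -/
structure Near (δ : ℝ) (x₁ x₂ y q : ℂ) : Prop where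
  y_ne : y ≠ 0
  x₁_lt : ‖x₁‖ < δ
  x₂_lt : ‖x₂‖ < δ
  u_lt : ‖H.u x₁ x₂‖ < δ
  gQ_lt : ‖H.gQ x₁ x₂ (x₁ / y) (x₂ / y) q - 1‖ < δ
  g₁_lt : ‖H.g₁ x₁ x₂ (x₁ / y) (x₂ / y) - 1‖ < δ
  gA_lt : ‖H.gA x₁ x₂ (x₁ / y) (x₂ / y) q - 1‖ < δ
  gB_lt : ‖H.gB x₁ x₂ (x₁ / y) (x₂ / y) q - 1‖ < δ

theorem eventually_near (f : (ℂ × ℂ × ℂ × ℂ) × ℂ → ℂ)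
    (hf : ∀ q, ContinuousAt f (0, q)) (h1 : ∀ q, f (0, q) = 1) {δ : ℝ} (hδ : 0 < δ) :
    ∀ᶠ p in 𝓝 (0 : ℂ × ℂ × ℂ × ℂ), ∀ q ∈ Metric.closedBall (0 : ℂ) 1, ‖f (p, q) - 1‖ < δ := by
  refine (isCompact_closedBall (0 : ℂ) 1).eventually_forall_of_forall_eventually fun q _ => ?_
  have := (Metric.continuousAt_iff'.mp (hf q)) δ hδ
  filter_upwards [this] with z hz
  rwa [h1, dist_eq_norm] at hz

theorem exists_near {δ : ℝ} (hδ : 0 < δ) : ∃ ε : ℝ, 0 < ε ∧ ε ≤ δ ∧ ∀ x₁ x₂ y : ℂ,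
    ‖x₁‖ < ε → ‖x₂‖ < ε → ‖x₁‖ < ε * ‖y‖ → ‖x₂‖ < ε * ‖y‖ →
    ∀ q ∈ Metric.closedBall (0 : ℂ) 1, H.Near δ x₁ x₂ y q := by
  have ht := H.t_ne_zero
  have ht1 := H.t_sub_one_ne
  have ht2 := H.one_sub_t_ne
  have cg : Continuous fun z : (ℂ × ℂ × ℂ × ℂ) × ℂ => H.g₁ z.1.1 z.1.2.1 z.1.2.2.1 z.1.2.2.2 := by
    simp only [g₁, u]; fun_prop
  have cS0 : Continuous fun z : (ℂ × ℂ × ℂ × ℂ) × ℂ => H.S₀ z.1.1 z.1.2.1 z.2 := by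
    simp only [S₀, u]; fun_prop
  have cS1 : Continuous fun z : (ℂ × ℂ × ℂ × ℂ) × ℂ => H.S₁ z.1.1 z.1.2.1 := by
    simp only [S₁]; fun_prop
  have cQ : Continuous fun z : (ℂ × ℂ × ℂ × ℂ) × ℂ =>
      H.gQ z.1.1 z.1.2.1 z.1.2.2.1 z.1.2.2.2 z.2 := by
    simp only [gQ]; fun_prop
  have cu : Continuous fun z : (ℂ × ℂ × ℂ × ℂ) × ℂ => H.u z.1.1 z.1.2.1 := by
    simp only [u]; fun_prop
  have cc2 : Continuous fun z : (ℂ × ℂ × ℂ × ℂ) × ℂ => H.c₂ z.1.1 z.1.2.1 := by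
    simp only [c₂]; fun_prop
  have cc3 : Continuous fun z : (ℂ × ℂ × ℂ × ℂ) × ℂ => H.c₃ z.1.1 z.1.2.1 := by
    simp only [c₃]; fun_prop
  have g0 : H.g₁ 0 0 0 0 = 1 := by simp [g₁, u]
  have Q0 : ∀ q, H.gQ 0 0 0 0 q = 1 := by simp [gQ, g0]
  have D0 : ∀ q, H.gΔ 0 0 0 0 q = 0 := by simp [gΔ, u]
  have A0 : ∀ q, H.gA 0 0 0 0 q = 1 := by simp [gA, D0, u]
  have B0 : ∀ q, H.gB 0 0 0 0 q = 1 := by simp [gB, D0, u]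
  have c20 : H.c₂ 0 0 ≠ 0 := by simp [c₂, ht2]
  have c30 : H.c₃ 0 0 ≠ 0 := by simp [c₃, ht, ht1]
  have cD : ∀ q, ContinuousAt (fun z : (ℂ × ℂ × ℂ × ℂ) × ℂ =>
      H.gΔ z.1.1 z.1.2.1 z.1.2.2.1 z.1.2.2.2 z.2) (0, q) := by
    intro q
    simp only [gΔ]
    refine ContinuousAt.div (by fun_prop) (ContinuousAt.add (ContinuousAt.cpow
      cQ.continuousAt continuousAt_const ?_) cg.continuousAt) ?_
    · simp [Q0]
    · simp only [Prod.fst_zero, Prod.snd_zero, Q0, g0]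
      norm_num
  have e1 := eventually_near _ (fun q => cQ.continuousAt) (fun q => Q0 q) hδ
  have e2 := eventually_near _ (fun q => cg.continuousAt) (fun q => g0) hδ
  have e3 := eventually_near (fun z => H.gA z.1.1 z.1.2.1 z.1.2.2.1 z.1.2.2.2 z.2)
    (fun q => by
      simp only [gA]
      exact continuousAt_const.add (ContinuousAt.div (ContinuousAt.add (by fun_prop) (cD q))
        (continuous_const.mul cc2).continuousAt (by simp [c20]))) (fun q => A0 q) hδ
  have e4 := eventually_near (fun z => H.gB z.1.1 z.1.2.1 z.1.2.2.1 z.1.2.2.2 z.2)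
    (fun q => by
      simp only [gB]
      exact continuousAt_const.add (ContinuousAt.div (ContinuousAt.sub (by fun_prop) (cD q))
        (continuous_const.mul cc3).continuousAt (by simp [c30]))) (fun q => B0 q) hδ
  have e5 := eventually_near (fun z => 1 + H.u z.1.1 z.1.2.1)
    (fun q => (continuous_const.add cu).continuousAt) (fun q => by simp [u]) hδ
  obtain ⟨ε, hε, he⟩ := Metric.eventually_nhds_iff.mp (e1.and (e2.and (e3.and (e4.and e5))))
  refine ⟨min ε δ, lt_min hε hδ, min_le_right _ _, fun x₁ x₂ y h1 h2 h3 h4 q hq => ?_⟩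
  have hy : y ≠ 0 := by
    rintro rfl
    rw [norm_zero, mul_zero] at h3
    exact absurd h3 (norm_nonneg _).not_gt
  have hy' : 0 < ‖y‖ := norm_pos_iff.mpr hy
  have h5 : ‖x₁ / y‖ < min ε δ := by rwa [norm_div, div_lt_iff₀ hy']
  have h6 : ‖x₂ / y‖ < min ε δ := by rwa [norm_div, div_lt_iff₀ hy']
  have hd : dist ((x₁, x₂, x₁ / y, x₂ / y) : ℂ × ℂ × ℂ × ℂ) 0 < ε := by
    rw [dist_zero_right, Prod.norm_def, Prod.norm_def, Prod.norm_def]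
    have hm := min_le_left ε δ
    exact max_lt (h1.trans_le hm) (max_lt (h2.trans_le hm) (max_lt (h5.trans_le hm)
      (h6.trans_le hm)))
  obtain ⟨k1, k2, k3, k4, k5⟩ := he hd
  refine ⟨hy, h1.trans_le (min_le_right _ _), h2.trans_le (min_le_right _ _), ?_, k1 q hq, k2 q hq,
    k3 q hq, k4 q hq⟩
  simpa using k5 q hq

variable {H} {δ : ℝ} {x₁ x₂ y q : ℂ}

theorem re_pos_of_near {z : ℂ} (h : ‖z - 1‖ < δ) (hδ : δ ≤ 1) : 0 < z.re := by
  have := (Complex.abs_re_le_norm (z - 1)).trans_lt h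
  rw [Complex.sub_re, Complex.one_re, abs_lt] at this
  linarith

theorem mem_slitPlane_of_near {z : ℂ} (h : ‖z - 1‖ < δ) (hδ : δ ≤ 1) : z ∈ Complex.slitPlane :=
  Or.inl (re_pos_of_near h hδ)

theorem re_cpow_half_pos {z : ℂ} (hz : 0 < z.re) : 0 < (z ^ (1 / 2 : ℂ)).re := by
  have hz0 : z ≠ 0 := by rintro rfl; simp at hz
  rw [Complex.cpow_def_of_ne_zero hz0, Complex.exp_re]
  refine mul_pos (Real.exp_pos _) (Real.cos_pos_of_mem_Ioo ?_)
  have him : (Complex.log z * (1 / 2)).im = z.arg / 2 := by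
    rw [show (1 / 2 : ℂ) = ((1 / 2 : ℝ) : ℂ) by push_cast; ring, Complex.im_mul_ofReal, Complex.log_im]
    ring
  have := Complex.abs_arg_lt_pi_div_two_iff.mpr (Or.inl hz)
  rw [abs_lt] at this
  rw [him]
  constructor <;> linarith [Real.pi_pos]

/-- The radius inside of which the coordinates stay away from the singular points. -/
def rad (H : HeunParams) : ℝ := min 1 ‖H.t‖ / 2

variable (H) in
theorem rad_pos : 0 < H.rad := by
  have := norm_pos_iff.mpr H.t_ne_zero
  rw [rad]
  positivity

theorem ne_of_lt_rad {x : ℂ} (hx : ‖x‖ < H.rad) : x - 1 ≠ 0 ∧ x - H.t ≠ 0 := by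
  have h1 := min_le_left 1 ‖H.t‖
  have h2 := min_le_right 1 ‖H.t‖
  have ht := norm_pos_iff.mpr H.t_ne_zero
  rw [rad] at hx
  constructor <;> intro h <;> rw [sub_eq_zero.mp h] at hx
  · rw [norm_one] at hx; linarith
  · linarith

theorem Near.sum_ne (hn : H.Near δ x₁ x₂ y q) (hδ : δ ≤ 1) :
    H.gQ x₁ x₂ (x₁ / y) (x₂ / y) q ^ (1 / 2 : ℂ) + H.g₁ x₁ x₂ (x₁ / y) (x₂ / y) ≠ 0 := by
  intro h
  have h1 := re_cpow_half_pos (re_pos_of_near hn.gQ_lt hδ)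
  have h2 := re_pos_of_near hn.g₁_lt hδ
  have := congrArg Complex.re h
  rw [Complex.add_re, Complex.zero_re] at this
  linarith

theorem Near.c₂_ne (hn : H.Near δ x₁ x₂ y q) (hδ' : δ ≤ H.rad) : H.c₂ x₁ x₂ ≠ 0 :=
  div_ne_zero (mul_ne_zero (ne_of_lt_rad (hn.x₁_lt.trans_le hδ')).1
    (ne_of_lt_rad (hn.x₂_lt.trans_le hδ')).1) H.one_sub_t_ne

theorem Near.c₃_ne (hn : H.Near δ x₁ x₂ y q) (hδ' : δ ≤ H.rad) : H.c₃ x₁ x₂ ≠ 0 :=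
  div_ne_zero (mul_ne_zero (ne_of_lt_rad (hn.x₁_lt.trans_le hδ')).2
    (ne_of_lt_rad (hn.x₂_lt.trans_le hδ')).2) (mul_ne_zero H.t_ne_zero H.t_sub_one_ne)

theorem Near.aC_lt (hn : H.Near δ x₁ x₂ y q) (hδ : δ ≤ 1) (hδ' : δ ≤ H.rad) :
    ‖H.aC x₁ x₂ y q / H.c₂ x₁ x₂ - 1‖ < δ := by
  rw [H.aC_eq_gA x₁ x₂ hn.y_ne q (hn.c₂_ne hδ') (hn.sum_ne hδ)]
  exact hn.gA_lt

theorem Near.bC_lt (hn : H.Near δ x₁ x₂ y q) (hδ : δ ≤ 1) (hδ' : δ ≤ H.rad) :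
    ‖H.bC x₁ x₂ y q / H.c₃ x₁ x₂ - 1‖ < δ := by
  rw [H.bC_eq_gB x₁ x₂ hn.y_ne q (hn.c₃_ne hδ') (hn.sum_ne hδ)]
  exact hn.gB_lt

theorem Near.good {r : ℝ} (hn : H.Near δ x₁ x₂ y q) (hδ : δ ≤ 1) (hδ' : δ ≤ H.rad) (hr : δ ≤ r)
    (hq : ‖q‖ ≤ 1) : H.Good r x₁ x₂ y q where
  y_ne := hn.y_ne
  x₁_ne_one := (ne_of_lt_rad (hn.x₁_lt.trans_le hδ')).1
  x₁_ne_t := (ne_of_lt_rad (hn.x₁_lt.trans_le hδ')).2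
  x₂_ne_one := (ne_of_lt_rad (hn.x₂_lt.trans_le hδ')).1
  x₂_ne_t := (ne_of_lt_rad (hn.x₂_lt.trans_le hδ')).2
  disc_mem := by
    rw [H.disc_eq_gQ x₁ x₂ hn.y_ne]
    exact mem_slitPlane_of_near hn.gQ_lt hδ
  a_mem := mem_slitPlane_of_near (hn.aC_lt hδ hδ') hδ
  b_mem := mem_slitPlane_of_near (hn.bC_lt hδ hδ') hδ
  u_lt := by
    rw [norm_mul]
    exact (mul_le_of_le_one_right (norm_nonneg _) hq).trans_lt (hn.u_lt.trans_le hr)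

theorem Near.at_one (hn : H.Near δ x₁ x₂ y 1) (hδ : δ ≤ 1) (hδ' : δ ≤ H.rad) :
    H.aC x₁ x₂ y 1 = H.c₂ x₁ x₂ ∧ H.bC x₁ x₂ y 1 = H.c₃ x₁ x₂ := by
  have hD : H.gΔ x₁ x₂ (x₁ / y) (x₂ / y) 1 = 0 := by simp [gΔ]
  constructor
  · have := H.aC_eq_gA x₁ x₂ hn.y_ne 1 (hn.c₂_ne hδ') (hn.sum_ne hδ)
    rw [gA, hD] at this
    simpa [div_eq_one_iff_eq (hn.c₂_ne hδ')] using this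
  · have := H.bC_eq_gB x₁ x₂ hn.y_ne 1 (hn.c₃_ne hδ') (hn.sum_ne hδ)
    rw [gB, hD] at this
    simpa [div_eq_one_iff_eq (hn.c₃_ne hδ')] using this

set_option maxHeartbeats 4000000 in
/-- The coefficient of the hypergeometric function in `flux` vanishes at `q = 1`. -/
theorem lam_boundary {m n t x x₂ y a b v w Δ Z : ℂ} (ht : t ≠ 0) (ht1 : t - 1 ≠ 0) (hx1 : x - 1 ≠ 0)
    (hxt : x - t ≠ 0) (hx1' : x₂ - 1 ≠ 0)
    (hxt' : x₂ - t ≠ 0) (hΔ : Δ ≠ 0)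
    (hZ : Z = 1 - x₂ / t * x) (ha : a = -((x - 1) * (x₂ - 1) / (t - 1)))
    (hb : b = (x - t) * (x₂ - t) / (t * (t - 1)))
    (hv : v = -a * (y - 1) / (t - 1))
    (hw : w = b * (y - t) / (t - 1))
    (hD : Δ = (y * (1 - x * x₂ / t) - (x + x₂) + x * x₂ / t * (1 + t)) / -(t - 1)) :
    (x - y) * (Z * logD m n a b v w Δ 1 0 0 - (m + n))
    + 2 * ((x - 1) * (x - t)) * (logD m n a b v w Δ 0 (v / (x - 1)) (w / (x - t))
      - m / (x - 1) - n / (x - t))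
    + ((m + 1) * (x - t) + (n + 1) * (x - 1))
    - x₂ / t * ((x - 1) * (x - t)) * logD m n a b v w Δ 1 0 0 = 0 := by
  have hA : a ≠ 0 := by rw [ha]; exact neg_ne_zero.mpr (div_ne_zero (mul_ne_zero hx1 hx1') ht1)
  have hB : b ≠ 0 := by rw [hb]; exact div_ne_zero (mul_ne_zero hxt hxt') (mul_ne_zero ht ht1)
  have e1 : (x - y) * Z + x₂ / t * ((x - 1) * (x - t)) = (t - 1) * Δ := by
    rw [hZ, hD]; field_simp; ring
  have eL1 : logD m n a b v w Δ 1 0 0 * Δ = m * ((a + v) / a) - n * ((b + w) / b)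
      - (a + b + v + w) / Δ := by
    simp only [logD, deltaD, aD, bD]; field_simp; ring
  have eA : aD a b v Δ (-(x₂ / t)) (v / (x - 1)) (w / (x - t)) = a / (x - 1) := by
    rw [aD, div_eq_iff hΔ, hD, hv, hw, ha, hb]; field_simp; ring
  have eB : bD a b w Δ (-(x₂ / t)) (v / (x - 1)) (w / (x - t)) = b / (x - t) := by
    rw [bD, div_eq_iff hΔ, hD, hv, hw, ha, hb]; field_simp; ring
  have eL : logD m n a b v w Δ (-(x₂ / t)) (v / (x - 1)) (w / (x - t)) =
      m / (x - 1) + n / (x - t) - (a / (x - 1) - b / (x - t) + v / (x - 1) - w / (x - t)) / Δ := by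
    rw [logD, deltaD, eA, eB]; field_simp
  have lin := logD_lin m n a b v w Δ (-(x₂ / t)) (v / (x - 1)) (w / (x - t))
  have lin' := logD_lin m n a b v w Δ 0 (v / (x - 1)) (w / (x - t))
  have k1 : (a + v) / a = 1 - (y - 1) / (t - 1) := by rw [hv]; field_simp; ring
  have k2 : (b + w) / b = 1 + (y - t) / (t - 1) := by rw [hw]; field_simp
  have k3 : ((x - t) + (x - 1)) = (t - 1) * ((a + b + v + w) / Δ) + 2 * ((x - 1) * (x - t)) *
      ((a / (x - 1) - b / (x - t) + v / (x - 1) - w / (x - t)) / Δ) := by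
    rw [← mul_div_assoc, ← mul_div_assoc, ← add_div, eq_div_iff hΔ, hD, hv, hw, ha, hb]
    field_simp
    ring
  have k4 : (t - 1) * (1 - (y - 1) / (t - 1)) = t - y := by field_simp; ring
  have k5 : (t - 1) * (1 + (y - t) / (t - 1)) = y - 1 := by field_simp; ring
  rw [k1, k2] at eL1
  linear_combination logD m n a b v w Δ 1 0 0 * e1 + (t - 1) * eL1 + k3
    + 2 * ((x - 1) * (x - t)) * (lin' - lin + eL) + m * k4 - n * k5
theorem Near.flux_one (hn : H.Near δ x₁ x₂ y 1) (hδ : δ ≤ 1) (hδ' : δ ≤ H.rad) :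
    H.flux x₁ x₂ y 1 = -(1 - H.t) * pser (dcoef H.hc) (H.u x₁ x₂) := by
  obtain ⟨ha, hb⟩ := hn.at_one hδ hδ'
  have g := hn.good hδ hδ' le_rfl (by simp)
  have hΔ0 := g.rt_ne
  have hΔ := H.rtC_eq x₁ x₂ y 1
  rw [ha, hb] at hΔ
  have h2 := g.c₂_ne
  have h3 := g.c₃_ne
  have hx1 := g.x₁_ne_one
  have hxt := g.x₁_ne_t
  have hx1' := g.x₂_ne_one
  have hxt' := g.x₂_ne_t
  have ht := H.t_ne_zero
  have ht1 := H.t_sub_one_ne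
  have ht2 := H.one_sub_t_ne
  have hnu : H.nu x₁ x₂ y 1 = -(1 - H.t) * H.rtC x₁ x₂ y 1 := by
    rw [hΔ, nu, zC, u, c₂, c₃, v, w]
    field_simp
    ring
  have hlam : H.lam x₁ x₂ y 1 = 0 := by
    have hvX : H.vX x₂ y = H.v x₁ x₂ y / (x₁ - 1) := by rw [vX, v]; field_simp
    have hwX : H.wX x₂ y = H.w x₁ x₂ y / (x₁ - H.t) := by rw [wX, w]; field_simp
    have := lam_boundary (m := H.s₂ - 1) (n := H.s₃ - 1) (Z := H.zC x₁ x₂ 1) (a := H.c₂ x₁ x₂)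
      (b := H.c₃ x₁ x₂) (v := H.v x₁ x₂ y) (w := H.w x₁ x₂ y) (y := y) ht ht1 hx1 hxt hx1' hxt' hΔ0
      (by rw [zC, u]; ring) (by rw [c₂, ← neg_sub H.t 1]; field_simp) (by rw [c₃])
      (by rw [v, c₂, ← neg_sub H.t 1]; field_simp) (by rw [w, c₃]; field_simp)
      (by rw [hΔ, v, w, c₂, c₃, neg_sub]; field_simp; ring)
    rw [lam, lD, lD, ha, hb, hvX, hwX]
    linear_combination this
  rw [flux, eC, ha, hb, div_self h2, div_self h3, hnu, hlam]
  simp only [Complex.one_cpow, mul_one]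
  field_simp
  ring

theorem Near.fC_zero (hn : H.Near δ 0 x₂ y q) (hδ : δ ≤ 1) (hδ' : δ ≤ H.rad) :
    H.fC 0 x₂ y q = (1 - H.t) / (y - x₂) := by
  have hu : H.u 0 x₂ = 0 := by simp [u]
  have hD : H.gΔ 0 x₂ (0 / y) (x₂ / y) q = 0 := by simp [gΔ, hu]
  have hA : H.aC 0 x₂ y q / H.c₂ 0 x₂ = 1 := by
    rw [H.aC_eq_gA 0 x₂ hn.y_ne q (hn.c₂_ne hδ') (hn.sum_ne hδ), gA, hD, hu]
    simp
  have hB : H.bC 0 x₂ y q / H.c₃ 0 x₂ = 1 := by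
    rw [H.bC_eq_gB 0 x₂ hn.y_ne q (hn.c₃_ne hδ') (hn.sum_ne hδ), gB, hD, hu]
    simp
  have hy := hn.y_ne
  rw [fC, eC, hA, hB, hu, H.rtC_eq_gΔ 0 x₂ hy q (hn.sum_ne hδ), hD, g₁, hu, zero_mul, pser_zero,
    hc, hypCoef_zero]
  simp only [Complex.one_cpow, zero_div, zero_mul, sub_zero, add_zero, one_mul, div_mul_eq_mul_div,
    one_div_div]
  rw [mul_sub, mul_one, mul_div_cancel₀ _ hy]

end HeunParams

end

noncomputable section

namespace HeunParams

open Filter Topology MeasureTheory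

/-- Differentiation under a weighted integral over the unit interval. -/
theorem hasDerivAt_weighted {σ : ℂ} (hσ : -1 < σ.re) {U : Set ℂ} (hU : IsOpen U)
    {f f' f'' : ℂ → ℝ → ℂ} {C : ℝ} (hC : ∀ z ∈ U, ∀ q ∈ Set.Icc (0 : ℝ) 1, ‖f z q‖ ≤ C)
    (hm : ∀ z ∈ U, ContinuousOn (f z) (Set.Icc (0 : ℝ) 1))
    (h1 : ∀ z ∈ U, ∀ q ∈ Set.Icc (0 : ℝ) 1, HasDerivAt (fun z => f z q) (f' z q) z)
    (h2 : ∀ z ∈ U, ∀ q ∈ Set.Icc (0 : ℝ) 1, HasDerivAt (fun z => f' z q) (f'' z q) z)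
    {z₀ : ℂ} (hz₀ : z₀ ∈ U) :
    IntervalIntegrable (fun q : ℝ => (q : ℂ) ^ σ * f z₀ q) volume 0 1 ∧
    IntervalIntegrable (fun q : ℝ => (q : ℂ) ^ σ * f' z₀ q) volume 0 1 ∧
    IntervalIntegrable (fun q : ℝ => (q : ℂ) ^ σ * f'' z₀ q) volume 0 1 ∧
    HasDerivAt (fun z => ∫ q in (0 : ℝ)..1, (q : ℂ) ^ σ * f z q)
      (∫ q in (0 : ℝ)..1, (q : ℂ) ^ σ * f' z₀ q) z₀ ∧
    HasDerivAt (fun z => ∫ q in (0 : ℝ)..1, (q : ℂ) ^ σ * f' z q)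
      (∫ q in (0 : ℝ)..1, (q : ℂ) ^ σ * f'' z₀ q) z₀ := by
  have hI : IntervalIntegrable (fun q : ℝ => (q : ℂ) ^ σ) volume 0 1 :=
    intervalIntegral.intervalIntegrable_cpow' hσ
  have hb : Integrable (fun q : ℝ => ‖(q : ℂ) ^ σ‖ * C) (volume.restrict (Set.Ioc 0 1)) :=
    ((intervalIntegrable_iff_integrableOn_Ioc_of_le zero_le_one).mp hI).norm.mul_const C
  have hsub : Set.Ioc (0 : ℝ) 1 ⊆ Set.Icc 0 1 := Set.Ioc_subset_Icc_self
  have hmem : ∀ᵐ q ∂(volume.restrict (Set.Ioc (0 : ℝ) 1)), q ∈ Set.Icc (0 : ℝ) 1 :=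
    (ae_restrict_mem measurableSet_Ioc).mono fun q hq => hsub hq
  have hmeas : ∀ z ∈ U, AEStronglyMeasurable (fun q : ℝ => (q : ℂ) ^ σ * f z q)
      (volume.restrict (Set.Ioc 0 1)) := fun z hz =>
    ((intervalIntegrable_iff_integrableOn_Ioc_of_le zero_le_one).mp hI).aestronglyMeasurable.mul
      (((hm z hz).mono hsub).aestronglyMeasurable measurableSet_Ioc)
  have hd : ∀ z ∈ U, ∀ q ∈ Set.Icc (0 : ℝ) 1,
      HasDerivAt (fun z => (q : ℂ) ^ σ * f z q) ((q : ℂ) ^ σ * f' z q) z :=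
    fun z hz q hq => (h1 z hz q hq).const_mul _
  have hdiff : ∀ᵐ q : ℝ ∂(volume.restrict (Set.Ioc (0 : ℝ) 1)),
      DifferentiableOn ℂ (fun z => (q : ℂ) ^ σ * f z q) U :=
    hmem.mono fun q hq z hz => (hd z hz q hq).differentiableAt.differentiableWithinAt
  have hle : ∀ᵐ q : ℝ ∂(volume.restrict (Set.Ioc (0 : ℝ) 1)), ∀ z ∈ U,
      ‖(q : ℂ) ^ σ * f z q‖ ≤ ‖(q : ℂ) ^ σ‖ * C := hmem.mono fun q hq z hz => by
    rw [norm_mul]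
    exact mul_le_mul_of_nonneg_left (hC z hz q hq) (norm_nonneg _)
  have hderiv : ∀ z ∈ U, ∀ q ∈ Set.Icc (0 : ℝ) 1,
      deriv (fun z => (q : ℂ) ^ σ * f z q) z = (q : ℂ) ^ σ * f' z q :=
    fun z hz q hq => (hd z hz q hq).deriv
  have hderiv2 : ∀ q ∈ Set.Icc (0 : ℝ) 1,
      deriv (deriv (fun z => (q : ℂ) ^ σ * f z q)) z₀ = (q : ℂ) ^ σ * f'' z₀ q := by
    intro q hq
    have : deriv (fun z => (q : ℂ) ^ σ * f z q) =ᶠ[𝓝 z₀] fun z => (q : ℂ) ^ σ * f' z q := by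
      filter_upwards [hU.mem_nhds hz₀] with z hz using hderiv z hz q hq
    rw [this.deriv_eq]
    exact ((h2 z₀ hz₀ q hq).const_mul _).deriv
  have r1 := fun z (hz : z ∈ U) => hasDerivAt_integral_of_holomorphic hU hb hmeas hdiff hle hz
  have r2 := hasDerivAt_deriv_integral_of_holomorphic hU hb hmeas hdiff hle hz₀
  have e1 : ∀ z ∈ U, (∫ q in Set.Ioc (0 : ℝ) 1, deriv (fun z => (q : ℂ) ^ σ * f z q) z) =
      ∫ q in Set.Ioc (0 : ℝ) 1, (q : ℂ) ^ σ * f' z q := fun z hz =>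
    integral_congr_ae (hmem.mono fun q hq => hderiv z hz q hq)
  have e2 : (∫ q in Set.Ioc (0 : ℝ) 1, deriv (deriv (fun z => (q : ℂ) ^ σ * f z q)) z₀) =
      ∫ q in Set.Ioc (0 : ℝ) 1, (q : ℂ) ^ σ * f'' z₀ q :=
    integral_congr_ae (hmem.mono fun q hq => hderiv2 q hq)
  simp only [intervalIntegrable_iff_integrableOn_Ioc_of_le zero_le_one,
    intervalIntegral.integral_of_le zero_le_one]
  refine ⟨hb.mono' (hmeas z₀ hz₀) (hle.mono fun q hq => hq z₀ hz₀),
    (r1 z₀ hz₀).1.congr (hmem.mono fun q hq => hderiv z₀ hz₀ q hq),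
    r2.1.congr (hmem.mono fun q hq => hderiv2 q hq),
    (r1 z₀ hz₀).2.congr_deriv (e1 z₀ hz₀), ?_⟩
  refine (r2.2.congr_deriv e2).congr_of_eventuallyEq ?_
  filter_upwards [hU.mem_nhds hz₀] with z hz
  rw [(r1 z hz).2.deriv, e1 z hz]

variable (H : HeunParams)

/-- The domain of convergence of the kernel. -/
def Dom (ε : ℝ) (x₁ x₂ y : ℂ) : Prop :=
  ‖x₁‖ < ε ∧ ‖x₂‖ < ε ∧ ‖x₁‖ < ε * ‖y‖ ∧ ‖x₂‖ < ε * ‖y‖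

theorem isOpen_dom_x (ε : ℝ) (x₂ y : ℂ) : IsOpen {x₁ | Dom ε x₁ x₂ y} := by
  simp only [Dom]
  exact (isOpen_lt (by fun_prop) (by fun_prop)).and ((isOpen_lt (by fun_prop) (by fun_prop)).and
    ((isOpen_lt (by fun_prop) (by fun_prop)).and (isOpen_lt (by fun_prop) (by fun_prop))))

theorem isOpen_dom_y (ε : ℝ) (x₁ x₂ : ℂ) : IsOpen {y | Dom ε x₁ x₂ y} := by
  simp only [Dom]
  exact (isOpen_lt (by fun_prop) (by fun_prop)).and ((isOpen_lt (by fun_prop) (by fun_prop)).and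
    ((isOpen_lt (by fun_prop) (by fun_prop)).and (isOpen_lt (by fun_prop) (by fun_prop))))

/-- On the domain of convergence the integrand is holomorphic and bounded. -/
structure Ctl (ε r C : ℝ) : Prop where
  pos : 0 < ε
  r_le : r ≤ 1
  sumOn : SumOn H.hc r
  good : ∀ x₁ x₂ y q, Dom ε x₁ x₂ y → ‖q‖ ≤ 1 → H.Good r x₁ x₂ y q
  norm_le : ∀ x₁ x₂ y q, Dom ε x₁ x₂ y → ‖q‖ ≤ 1 → ‖H.fC x₁ x₂ y q‖ ≤ C / ‖y‖
  flux_one : ∀ x₁ x₂ y, Dom ε x₁ x₂ y →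
    H.flux x₁ x₂ y 1 = -(1 - H.t) * pser (dcoef H.hc) (H.u x₁ x₂)
  fC_zero : ∀ x₂ y q, Dom ε 0 x₂ y → ‖q‖ ≤ 1 → H.fC 0 x₂ y q = (1 - H.t) / (y - x₂)

theorem norm_cpow_le_of_near {z : ℂ} (h : ‖z - 1‖ < 1 / 2) (m : ℂ) :
    ‖z ^ m‖ ≤ Real.exp ‖m‖ := by
  have hz0 : z ≠ 0 := by
    rintro rfl
    norm_num at h
  rw [Complex.cpow_def_of_ne_zero hz0]
  refine (Complex.norm_exp_le_exp_norm _).trans (Real.exp_le_exp.mpr ?_)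
  have := Complex.norm_log_one_add_half_le_self h.le
  rw [add_sub_cancel] at this
  rw [norm_mul]
  refine mul_le_of_le_one_left (norm_nonneg _) ?_
  linarith

theorem norm_pser_le {a : ℕ → ℂ} {M : ℝ} (hM : 0 < M) (ha : ∀ n, ‖a n‖ ≤ M ^ n) {z : ℂ}
    (hz : M * ‖z‖ ≤ 1 / 2) : ‖pser a z‖ ≤ 2 := by
  have hle : ∀ n, ‖a n * z ^ n‖ ≤ (1 / 2) ^ n := by
    intro n
    rw [norm_mul, norm_pow]
    calc ‖a n‖ * ‖z‖ ^ n ≤ M ^ n * ‖z‖ ^ n := by gcongr; exact ha n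
      _ = (M * ‖z‖) ^ n := by rw [mul_pow]
      _ ≤ (1 / 2) ^ n := by gcongr
  exact tsum_of_norm_bounded hasSum_geometric_two hle

theorem exists_ctl (hs : 1 < H.s₁.re) {δ : ℝ} (hδ : 0 < δ) : ∃ ε r C : ℝ, H.Ctl ε r C ∧ ε ≤ δ ∧
    ∀ x₁ x₂ y q, Dom ε x₁ x₂ y → ‖q‖ ≤ 1 → H.Near δ x₁ x₂ y q := by
  obtain ⟨M, hM1, hM⟩ := exists_hypCoef_bound (H.r₁ - 1) (H.r₂ - 1) (c := H.s₁ - 1)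
    (by simpa using hs)
  have hM0 : 0 < M := by linarith
  have hsum : SumOn H.hc (1 / M) := sumOn_of_le (C := 1) hM0 (fun n => by simpa [hc] using hM n)
  have hr1 : 1 / M ≤ 1 := by rw [div_le_one hM0]; exact hM1
  set δ' := min (min δ (1 / 2)) (min H.rad (1 / (2 * M))) with hδ'
  have hδ'0 : 0 < δ' := lt_min (lt_min hδ (by norm_num)) (lt_min H.rad_pos (by positivity))
  have h1 : δ' ≤ δ := (min_le_left _ _).trans (min_le_left _ _)
  have h2 : δ' ≤ 1 / 2 := (min_le_left _ _).trans (min_le_right _ _)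
  have h3 : δ' ≤ H.rad := (min_le_right _ _).trans (min_le_left _ _)
  have h4 : δ' ≤ 1 / (2 * M) := (min_le_right _ _).trans (min_le_right _ _)
  have h5 : 1 / (2 * M) ≤ 1 / M := by gcongr; linarith
  obtain ⟨ε, hε, hεδ, hn⟩ := H.exists_near hδ'0
  have hn' : ∀ x₁ x₂ y q, Dom ε x₁ x₂ y → ‖q‖ ≤ 1 → H.Near δ' x₁ x₂ y q := fun x₁ x₂ y q hd hq =>
    hn x₁ x₂ y hd.1 hd.2.1 hd.2.2.1 hd.2.2.2 q (by simpa using hq)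
  refine ⟨ε, 1 / M, 2 * (Real.exp ‖H.s₂ - 1‖ * Real.exp ‖H.s₃ - 1‖ * (2 * ‖1 - H.t‖)),
    ⟨hε, hr1, hsum, ?_, ?_, ?_, ?_⟩, hεδ.trans h1, ?_⟩
  · exact fun x₁ x₂ y q hd hq => (hn' x₁ x₂ y q hd hq).good (by linarith) h3 (h4.trans h5) hq
  · intro x₁ x₂ y q hd hq
    have near := hn' x₁ x₂ y q hd hq
    have ha := norm_cpow_le_of_near ((near.aC_lt (by linarith) h3).trans_le h2) (H.s₂ - 1)
    have hb := norm_cpow_le_of_near ((near.bC_lt (by linarith) h3).trans_le h2) (H.s₃ - 1)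
    have hF : ‖pser H.hc (H.u x₁ x₂ * q)‖ ≤ 2 := by
      refine norm_pser_le hM0 hM ?_
      have : ‖H.u x₁ x₂ * q‖ ≤ 1 / (2 * M) := by
        rw [norm_mul]
        exact (mul_le_of_le_one_right (norm_nonneg _) hq).trans (near.u_lt.le.trans h4)
      calc M * ‖H.u x₁ x₂ * q‖ ≤ M * (1 / (2 * M)) := by gcongr
        _ = 1 / 2 := by field_simp
    have hy := norm_pos_iff.mpr near.y_ne
    have hG : 1 / 2 ≤ ‖H.gQ x₁ x₂ (x₁ / y) (x₂ / y) q ^ (1 / 2 : ℂ)‖ := by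
      set G := H.gQ x₁ x₂ (x₁ / y) (x₂ / y) q
      have hsq : (G ^ (1 / 2 : ℂ)) ^ 2 = G := by
        rw [← Complex.cpow_nat_mul]
        norm_num
      have h6 : 1 / 2 ≤ ‖G‖ := by
        have h7 := near.gQ_lt.trans_le h2
        have h8 : ‖(1 : ℂ)‖ ≤ ‖G‖ + ‖G - 1‖ := by
          calc ‖(1 : ℂ)‖ = ‖G - (G - 1)‖ := by ring_nf
            _ ≤ _ := norm_sub_le _ _
        rw [norm_one] at h8
        linarith
      rw [← hsq, norm_pow] at h6
      nlinarith [norm_nonneg (G ^ (1 / 2 : ℂ))]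
    have hR : ‖(H.rtC x₁ x₂ y q)⁻¹‖ ≤ 2 * ‖1 - H.t‖ / ‖y‖ := by
      have ht2 := norm_pos_iff.mpr H.one_sub_t_ne
      rw [H.rtC_eq_gQ x₁ x₂ near.y_ne, norm_inv, norm_mul, norm_div,
        inv_le_comm₀ (by positivity) (by positivity)]
      calc (2 * ‖1 - H.t‖ / ‖y‖)⁻¹ = ‖y‖ / ‖1 - H.t‖ * (1 / 2) := by field_simp
        _ ≤ _ := by gcongr
    rw [fC, eC, div_eq_mul_inv, norm_mul, norm_mul, norm_mul]
    calc _ ≤ 2 * (Real.exp ‖H.s₂ - 1‖ * Real.exp ‖H.s₃ - 1‖ * (2 * ‖1 - H.t‖ / ‖y‖)) := by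
          gcongr
      _ = _ := by ring
  · exact fun x₁ x₂ y hd => (hn' x₁ x₂ y 1 hd (by simp)).flux_one (by linarith) h3
  · exact fun x₂ y q hd hq => (hn' 0 x₂ y q hd hq).fC_zero (by linarith) h3
  · intro x₁ x₂ y q hd hq
    obtain ⟨k1, k2, k3, k4, k5, k6, k7, k8⟩ := hn' x₁ x₂ y q hd hq
    exact ⟨k1, k2.trans_le h1, k3.trans_le h1, k4.trans_le h1, k5.trans_le h1, k6.trans_le h1,
      k7.trans_le h1, k8.trans_le h1⟩

/-- The one-dimensional integral with the constant factors moved inside. -/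
def rInt (x₁ x₂ y : ℂ) : ℂ := ∫ q in (0 : ℝ)..1, (q : ℂ) ^ (H.s₁ - 2) * H.fC x₁ x₂ y q

/-- The `x₁`-derivative of `rInt`. -/
def rIntX (x₁ x₂ y : ℂ) : ℂ := ∫ q in (0 : ℝ)..1, (q : ℂ) ^ (H.s₁ - 2) * H.fX x₁ x₂ y q
/-- The second `x₁`-derivative of `rInt`. -/
def rIntXX (x₁ x₂ y : ℂ) : ℂ := ∫ q in (0 : ℝ)..1, (q : ℂ) ^ (H.s₁ - 2) * H.fXX x₁ x₂ y q
/-- The `y`-derivative of `rInt`. -/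
def rIntY (x₁ x₂ y : ℂ) : ℂ := ∫ q in (0 : ℝ)..1, (q : ℂ) ^ (H.s₁ - 2) * H.fY x₁ x₂ y q
/-- The second `y`-derivative of `rInt`. -/
def rIntYY (x₁ x₂ y : ℂ) : ℂ := ∫ q in (0 : ℝ)..1, (q : ℂ) ^ (H.s₁ - 2) * H.fYY x₁ x₂ y q

variable {H} {ε r C : ℝ} {x₁ x₂ y q : ℂ}

theorem Dom.y_ne (hd : Dom ε x₁ x₂ y) : y ≠ 0 := by
  rintro rfl
  have := hd.2.2.1
  rw [norm_zero, mul_zero] at this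
  exact absurd this (norm_nonneg _).not_gt

theorem Good.continuousAt_fC (hr : SumOn H.hc r) (h : H.Good r x₁ x₂ y q) :
    ContinuousAt (fun q => H.fC x₁ x₂ y q) q := by
  have he := (h.hasDerivAt_path (hasDerivAt_const q x₁) (hasDerivAt_const q y)
    (hasDerivAt_id q) (Z' := -(x₂ / H.t * x₁)) (v' := 0) (w' := 0) (by simp) (by simp)
    (by simp)).2.2.2.2.2
  exact ((hasDerivAt_pser_q hr h).fun_mul he).continuousAt

theorem norm_ofReal_le_one {q : ℝ} (hq : q ∈ Set.Icc (0 : ℝ) 1) : ‖(q : ℂ)‖ ≤ 1 := by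
  rw [Complex.norm_real, Real.norm_of_nonneg hq.1]
  exact hq.2

theorem Ctl.continuousOn_fC (hc : H.Ctl ε r C) (hd : Dom ε x₁ x₂ y) :
    ContinuousOn (fun q : ℝ => H.fC x₁ x₂ y q) (Set.Icc (0 : ℝ) 1) := fun q hq =>
  (((hc.good x₁ x₂ y q hd (norm_ofReal_le_one hq)).continuousAt_fC hc.sumOn).comp
    Complex.continuous_ofReal.continuousAt).continuousWithinAt

theorem Ctl.hasDerivAt_rInt_x (hs : 1 < H.s₁.re) (hc : H.Ctl ε r C) (hd : Dom ε x₁ x₂ y) :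
    IntervalIntegrable (fun q : ℝ => (q : ℂ) ^ (H.s₁ - 2) * H.fC x₁ x₂ y q) volume 0 1 ∧
    IntervalIntegrable (fun q : ℝ => (q : ℂ) ^ (H.s₁ - 2) * H.fX x₁ x₂ y q) volume 0 1 ∧
    IntervalIntegrable (fun q : ℝ => (q : ℂ) ^ (H.s₁ - 2) * H.fXX x₁ x₂ y q) volume 0 1 ∧
    HasDerivAt (fun x => H.rInt x x₂ y) (H.rIntX x₁ x₂ y) x₁ ∧
    HasDerivAt (fun x => H.rIntX x x₂ y) (H.rIntXX x₁ x₂ y) x₁ := by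
  refine hasDerivAt_weighted (σ := H.s₁ - 2) (by simp; linarith) (isOpen_dom_x ε x₂ y)
    (f := fun x q => H.fC x x₂ y q) (f' := fun x q => H.fX x x₂ y q)
    (f'' := fun x q => H.fXX x x₂ y q) (C := C / ‖y‖) ?_ ?_ ?_ ?_ hd
  · exact fun x hx q hq => hc.norm_le x x₂ y q hx (norm_ofReal_le_one hq)
  · exact fun x hx => hc.continuousOn_fC hx
  · exact fun x hx q hq => (hc.good x x₂ y q hx (norm_ofReal_le_one hq)).hasDerivAt_fC_x hc.sumOn
  · exact fun x hx q hq => (hc.good x x₂ y q hx (norm_ofReal_le_one hq)).hasDerivAt_fX hc.sumOn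

theorem Ctl.hasDerivAt_rInt_y (hs : 1 < H.s₁.re) (hc : H.Ctl ε r C) (hd : Dom ε x₁ x₂ y) :
    IntervalIntegrable (fun q : ℝ => (q : ℂ) ^ (H.s₁ - 2) * H.fC x₁ x₂ y q) volume 0 1 ∧
    IntervalIntegrable (fun q : ℝ => (q : ℂ) ^ (H.s₁ - 2) * H.fY x₁ x₂ y q) volume 0 1 ∧
    IntervalIntegrable (fun q : ℝ => (q : ℂ) ^ (H.s₁ - 2) * H.fYY x₁ x₂ y q) volume 0 1 ∧
    HasDerivAt (fun y => H.rInt x₁ x₂ y) (H.rIntY x₁ x₂ y) y ∧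
    HasDerivAt (fun y => H.rIntY x₁ x₂ y) (H.rIntYY x₁ x₂ y) y := by
  have hy := norm_pos_iff.mpr hd.y_ne
  refine hasDerivAt_weighted (σ := H.s₁ - 2) (by simp; linarith)
    ((isOpen_dom_y ε x₁ x₂).inter (isOpen_lt (continuous_const (y := ‖y‖ / 2)) continuous_norm))
    (f := fun y q => H.fC x₁ x₂ y q) (f' := fun y q => H.fY x₁ x₂ y q)
    (f'' := fun y q => H.fYY x₁ x₂ y q) (C := |C| / (‖y‖ / 2)) ?_ ?_ ?_ ?_
    ⟨hd, show ‖y‖ / 2 < ‖y‖ by linarith⟩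
  · intro y' hy' q hq
    refine (hc.norm_le x₁ x₂ y' q hy'.1 (norm_ofReal_le_one hq)).trans ?_
    have h2 : ‖y‖ / 2 < ‖y'‖ := hy'.2
    gcongr
    exact le_abs_self C
  · exact fun y' hy' => hc.continuousOn_fC hy'.1
  · exact fun y' hy' q hq => (hc.good x₁ x₂ y' q hy'.1 (norm_ofReal_le_one hq)).hasDerivAt_fC_y
  · exact fun y' hy' q hq => (hc.good x₁ x₂ y' q hy'.1 (norm_ofReal_le_one hq)).hasDerivAt_fY

/-- The Heun operator in `x₁` minus its adjoint in `y`, applied to `rInt`, does not depend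
on `y`. -/
theorem Ctl.pde_rInt (hs : 1 < H.s₁.re) (hc : H.Ctl ε r C) (hd : Dom ε x₁ x₂ y) (hy1 : y - 1 ≠ 0)
    (hyt : y - H.t ≠ 0) :
    H.cubic x₁ * H.rIntXX x₁ x₂ y + H.quad x₁ * H.rIntX x₁ x₂ y
        + H.r₁ * H.r₂ * x₁ * H.rInt x₁ x₂ y
      - (H.cubic y * H.rIntYY x₁ x₂ y + H.adjLin y * H.rIntY x₁ x₂ y
        + H.adjZero y * H.rInt x₁ x₂ y) = -(1 - H.t) * pser (dcoef H.hc) (H.u x₁ x₂) := by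
  obtain ⟨i0, i1, i2, -, -⟩ := hc.hasDerivAt_rInt_x hs hd
  obtain ⟨-, j1, j2, -, -⟩ := hc.hasDerivAt_rInt_y hs hd
  have hgood := fun (q : ℝ) (hq : q ∈ Set.Icc (0 : ℝ) 1) =>
    hc.good x₁ x₂ y q hd (norm_ofReal_le_one hq)
  have hI := ((((i2.const_mul (H.cubic x₁)).add (i1.const_mul (H.quad x₁))).add
    (i0.const_mul (H.r₁ * H.r₂ * x₁))).sub (((j2.const_mul (H.cubic y)).add
      (j1.const_mul (H.adjLin y))).add (i0.const_mul (H.adjZero y))))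
  have hval : H.cubic x₁ * H.rIntXX x₁ x₂ y + H.quad x₁ * H.rIntX x₁ x₂ y
        + H.r₁ * H.r₂ * x₁ * H.rInt x₁ x₂ y
      - (H.cubic y * H.rIntYY x₁ x₂ y + H.adjLin y * H.rIntY x₁ x₂ y
        + H.adjZero y * H.rInt x₁ x₂ y) = ∫ q in (0 : ℝ)..1, (H.cubic x₁ * ((q : ℂ) ^ (H.s₁ - 2) * H.fXX x₁ x₂ y q)
        + H.quad x₁ * ((q : ℂ) ^ (H.s₁ - 2) * H.fX x₁ x₂ y q)
        + H.r₁ * H.r₂ * x₁ * ((q : ℂ) ^ (H.s₁ - 2) * H.fC x₁ x₂ y q)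
      - (H.cubic y * ((q : ℂ) ^ (H.s₁ - 2) * H.fYY x₁ x₂ y q)
        + H.adjLin y * ((q : ℂ) ^ (H.s₁ - 2) * H.fY x₁ x₂ y q)
        + H.adjZero y * ((q : ℂ) ^ (H.s₁ - 2) * H.fC x₁ x₂ y q))) := by
    simp only [rInt, rIntX, rIntXX, rIntY, rIntYY, ← intervalIntegral.integral_const_mul]
    rw [← intervalIntegral.integral_add (i2.const_mul _) (i1.const_mul _),
      ← intervalIntegral.integral_add ((i2.const_mul _).add (i1.const_mul _)) (i0.const_mul _),
      ← intervalIntegral.integral_add (j2.const_mul _) (j1.const_mul _),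
      ← intervalIntegral.integral_add ((j2.const_mul _).add (j1.const_mul _)) (i0.const_mul _),
      ← intervalIntegral.integral_sub (((i2.const_mul _).add (i1.const_mul _)).add
        (i0.const_mul _)) (((j2.const_mul _).add (j1.const_mul _)).add (i0.const_mul _))]
  have hFTC : ∀ q ∈ Set.Ioo (0 : ℝ) 1,
      HasDerivAt (fun q : ℝ => (q : ℂ) ^ (H.s₁ - 1) * H.flux x₁ x₂ y q)
      (H.cubic x₁ * ((q : ℂ) ^ (H.s₁ - 2) * H.fXX x₁ x₂ y q)
        + H.quad x₁ * ((q : ℂ) ^ (H.s₁ - 2) * H.fX x₁ x₂ y q)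
        + H.r₁ * H.r₂ * x₁ * ((q : ℂ) ^ (H.s₁ - 2) * H.fC x₁ x₂ y q)
      - (H.cubic y * ((q : ℂ) ^ (H.s₁ - 2) * H.fYY x₁ x₂ y q)
        + H.adjLin y * ((q : ℂ) ^ (H.s₁ - 2) * H.fY x₁ x₂ y q)
        + H.adjZero y * ((q : ℂ) ^ (H.s₁ - 2) * H.fC x₁ x₂ y q))) q := by
    intro q hq
    have g := hgood q (Set.Ioo_subset_Icc_self hq)
    have hpde := g.pde hc.sumOn hc.r_le (by simpa using hs) hy1 hyt
    have hsl : (q : ℂ) ∈ Complex.slitPlane := Or.inl (by simpa using hq.1)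
    have h1 := ((hasDerivAt_id (q : ℂ)).cpow_const (c := H.s₁ - 1) hsl).fun_mul
      (g.hasDerivAt_flux hc.sumOn)
    refine (h1.comp_ofReal).congr_deriv ?_
    have hq0 : (q : ℂ) ≠ 0 := by exact_mod_cast hq.1.ne'
    have hpow : (q : ℂ) ^ (H.s₁ - 1) = (q : ℂ) ^ (H.s₁ - 2) * q := by
      rw [show H.s₁ - 1 = (H.s₁ - 2) + 1 by ring, Complex.cpow_add _ _ hq0, Complex.cpow_one]
    simp only [id]
    rw [hpow, show H.s₁ - 1 - 1 = H.s₁ - 2 by ring]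
    linear_combination (-(q : ℂ) ^ (H.s₁ - 2)) * hpde
  have hcont : ContinuousOn (fun q : ℝ => (q : ℂ) ^ (H.s₁ - 1) * H.flux x₁ x₂ y q)
      (Set.Icc 0 1) := by
    intro q hq
    refine ContinuousAt.continuousWithinAt ?_
    exact (Complex.continuousAt_ofReal_cpow_const q (H.s₁ - 1) (Or.inl (by simpa using hs))).mul
      (((hgood q hq).hasDerivAt_flux hc.sumOn).continuousAt.comp
        Complex.continuous_ofReal.continuousAt)
  have hne : H.s₁ - 1 ≠ 0 := by
    intro h
    have := congrArg Complex.re h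
    simp at this
    linarith
  rw [hval, intervalIntegral.integral_eq_sub_of_hasDerivAt_of_le zero_le_one hcont hFTC hI]
  simp only [Complex.ofReal_one, Complex.one_cpow, Complex.ofReal_zero, Complex.zero_cpow hne,
    zero_mul, sub_zero, one_mul]
  exact hc.flux_one x₁ x₂ y hd

theorem Ctl.norm_rInt_le (hs : 1 < H.s₁.re) (hc : H.Ctl ε r C) (hd : Dom ε x₁ x₂ y) :
    ‖H.rInt x₁ x₂ y‖ ≤ (∫ q in (0 : ℝ)..1, ‖(q : ℂ) ^ (H.s₁ - 2)‖) * C / ‖y‖ := by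
  have hI : IntervalIntegrable (fun q : ℝ => (q : ℂ) ^ (H.s₁ - 2)) volume 0 1 :=
    intervalIntegral.intervalIntegrable_cpow' (by simp; linarith)
  rw [rInt, mul_div_assoc, ← intervalIntegral.integral_mul_const]
  refine intervalIntegral.norm_integral_le_of_norm_le zero_le_one ?_ (hI.norm.mul_const _)
  refine Filter.Eventually.of_forall fun q hq => ?_
  rw [norm_mul]
  exact mul_le_mul_of_nonneg_left (hc.norm_le x₁ x₂ y q hd
    (norm_ofReal_le_one (Set.Ioc_subset_Icc_self hq))) (norm_nonneg _)

end HeunParams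

end

noncomputable section

namespace HeunParams

open Filter Topology

variable (H : HeunParams)

/-- The effect of the Heun operator on the coefficients of a power series. -/
def heunCoef (a : ℕ → ℂ) (n : ℕ) : ℂ :=
  H.upCoeff n * a (n + 1) - H.midCoeff n * a n + shiftRight (fun n => H.lowCoeff n * a n) n

/-- The effect of the adjoint Heun operator on the coefficients of a power series in `1/y`. -/
def adjCoef (b : ℕ → ℂ) (k : ℕ) : ℂ :=
  shiftRight (fun n => H.upCoeff n * b n) k - H.midCoeff k * b k + H.lowCoeff k * b (k + 1)

variable {r : ℝ} {x y η : ℂ}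

theorem heun_pser {a : ℕ → ℂ} (ha : SumOn a r) (hx : ‖x‖ < r) :
    H.cubic x * pser (dcoef (dcoef a)) x + H.quad x * pser (dcoef a) x
      + H.r₁ * H.r₂ * x * pser a x = pser (H.heunCoef a) x := by
  have a0 := ha.hasSum hx
  have a1 := ha.hasSum_shiftRight hx
  have b0 := ha.dcoef.hasSum hx
  have b1 := ha.dcoef.hasSum_shiftRight hx
  have b2 := ha.dcoef.shiftRight.hasSum_shiftRight hx
  have d1 := ha.dcoef.dcoef.hasSum_shiftRight hx
  have d2 := ha.dcoef.dcoef.shiftRight.hasSum_shiftRight hx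
  have d3 := ha.dcoef.dcoef.shiftRight.shiftRight.hasSum_shiftRight hx
  rw [pser_shiftRight ha.dcoef.dcoef.shiftRight hx] at d3
  rw [pser_shiftRight ha.dcoef.dcoef hx] at d2 d3
  rw [pser_shiftRight ha.dcoef hx] at b2
  have h := ((d3.add (d2.mul_left (-(1 + H.t)))).add (d1.mul_left H.t)).add
    (((b2.mul_left (H.s₁ + H.s₂ + H.s₃)).add
      (b1.mul_left (-(H.s₁ * (1 + H.t) + H.s₂ * H.t + H.s₃)))).add
      ((b0.mul_left (H.s₁ * H.t)).add (a1.mul_left (H.r₁ * H.r₂))))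
  refine Eq.trans ?_ (h.congr_fun (g := fun n => H.heunCoef a n * x ^ n) fun n => ?_).tsum_eq.symm
  · rw [cubic, quad]
    ring
  · have hf := H.fuchs
    rcases n with _ | _ | _ | n <;>
      simp only [heunCoef, upCoeff, midCoeff, lowCoeff, dcoef, shiftRight_succ, shiftRight_zero] <;>
      push_cast
    · ring
    · ring
    · linear_combination x ^ 2 * a 1 * hf
    · linear_combination x ^ (n + 3) * (n + 2) * a (n + 2) * hf

theorem adj_pser {b : ℕ → ℂ} (hb : SumOn b r) (hη : ‖η‖ < r) (hyη : y * η = 1) :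
    H.cubic y * (2 * η ^ 3 * pser b η + 4 * η ^ 4 * pser (dcoef b) η
        + η ^ 5 * pser (dcoef (dcoef b)) η)
      - H.adjLin y * (η ^ 2 * pser b η + η ^ 3 * pser (dcoef b) η) + H.adjZero y * (η * pser b η)
    = η * pser (H.adjCoef b) η + (H.r₁ - 1) * (H.r₂ - 1) * b 0 := by
  have g0 := hb.hasSum hη
  have g1 := hb.hasSum_shiftRight hη
  have d1 := hb.dcoef.hasSum_shiftRight hη
  have d2 := hb.dcoef.shiftRight.hasSum_shiftRight hη
  have d3 := hb.dcoef.shiftRight.shiftRight.hasSum_shiftRight hη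
  have e2 := hb.dcoef.dcoef.shiftRight.hasSum_shiftRight hη
  have e3 := hb.dcoef.dcoef.shiftRight.shiftRight.hasSum_shiftRight hη
  have e4 := hb.dcoef.dcoef.shiftRight.shiftRight.shiftRight.hasSum_shiftRight hη
  have g2 := hb.shiftRight.hasSum_shiftRight hη
  rw [pser_shiftRight hb.dcoef.dcoef.shiftRight.shiftRight hη] at e4
  rw [pser_shiftRight hb.dcoef.dcoef.shiftRight hη] at e3 e4
  rw [pser_shiftRight hb.dcoef.dcoef hη] at e2 e3 e4
  rw [pser_shiftRight hb.dcoef.shiftRight hη] at d3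
  rw [pser_shiftRight hb.dcoef hη] at d2 d3
  rw [pser_shiftRight hb hη] at g2
  set σ₀ := H.s₁ + H.s₂ + H.s₃ with hσ₀
  set σ₁ := H.s₁ * (1 + H.t) + H.s₂ * H.t + H.s₃ with hσ₁
  have h := ((((e2.add (e3.mul_left (-(1 + H.t)))).add (e4.mul_left H.t)).add
    (((d1.mul_left (4 - (6 - σ₀))).add (d2.mul_left (-4 * (1 + H.t) - (-4 * (1 + H.t) + σ₁)))).add
      (d3.mul_left (4 * H.t - (2 * H.t - H.s₁ * H.t))))).add
    (((g0.mul_left (2 - (6 - σ₀) + (6 - 2 * σ₀ + H.r₁ * H.r₂))).add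
      (g1.mul_left (-2 * (1 + H.t) - (-4 * (1 + H.t) + σ₁) + (-2 * (1 + H.t) + σ₁)))).add
      (g2.mul_left (2 * H.t - (2 * H.t - H.s₁ * H.t)))))
  have h' := (hasSum_nat_add_iff' 1).mpr h
  have hy : y ≠ 0 := left_ne_zero_of_mul_eq_one hyη
  have hη0 : η ≠ 0 := right_ne_zero_of_mul_eq_one hyη
  have hf := H.fuchs
  have key := (h'.mul_left y).congr_fun (g := fun k => H.adjCoef b k * η ^ k) fun k => by
    have hp : ∀ k : ℕ, y * η ^ (k + 1) = η ^ k := fun k => by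
      rw [pow_succ, mul_comm (η ^ k), ← mul_assoc, hyη, one_mul]
    rw [← hp k, mul_left_comm]
    congr 1
    rcases k with _ | _ | _ | k <;>
      simp only [adjCoef, upCoeff, midCoeff, lowCoeff, dcoef, shiftRight_succ, shiftRight_zero] <;>
      push_cast
    · linear_combination 0 * hf
    · linear_combination η ^ 2 * b 2 * hf
    · linear_combination 2 * η ^ 3 * b 3 * hf
    · linear_combination (k + 3) * η ^ (k + 4) * b (k + 4) * hf
  have := key.tsum_eq
  change pser (H.adjCoef b) η = _ at this
  rw [this]
  have hη' : η = y⁻¹ := (inv_eq_of_mul_eq_one_right hyη).symm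
  simp only [Finset.range_one, Finset.sum_singleton, shiftRight_zero, pow_zero]
  rw [cubic, adjLin, adjZero, quad, hσ₀, hσ₁, hη']
  field_simp
  linear_combination y ^ 4 * b 0 * hf

end HeunParams
end

noncomputable section

namespace HeunParams

open Filter Topology

theorem pser_swap {L : ℕ → ℕ → ℂ} {C M : ℝ} (hM : 0 < M) (hL : ∀ n k, ‖L n k‖ ≤ C * M ^ n) {x η : ℂ}
    (hx : ‖x‖ < 1 / M) (hη : ‖η‖ < 1) :
    pser (fun n => pser (L n) η) x = pser (fun k => pser (fun n => L n k) x) η := by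
  have hx' : M * ‖x‖ < 1 := by rwa [lt_div_iff₀ hM, mul_comm] at hx
  have hs : Summable fun p : ℕ × ℕ => L p.1 p.2 * x ^ p.1 * η ^ p.2 := by
    refine Summable.of_norm_bounded (((summable_geometric_of_lt_one (by positivity)
      hx').mul_left C).mul_of_nonneg (summable_geometric_of_lt_one (norm_nonneg η) hη) ?_ ?_) ?_
    · intro n
      have := (norm_nonneg _).trans (hL 0 0)
      rw [pow_zero, mul_one] at this
      exact mul_nonneg this (by positivity)
    · intro n
      exact pow_nonneg (norm_nonneg _) _
    · intro p
      rw [norm_mul, norm_mul, norm_pow, norm_pow, mul_pow, ← mul_assoc]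
      gcongr
      exact hL _ _
  calc pser (fun n => pser (L n) η) x = ∑' n, ∑' k, L n k * x ^ n * η ^ k := by
        simp only [pser, ← tsum_mul_right]
        exact tsum_congr fun n => tsum_congr fun k => by ring
    _ = ∑' k, ∑' n, L n k * x ^ n * η ^ k :=
        (Summable.tsum_comm (f := fun n k => L n k * x ^ n * η ^ k) hs).symm
    _ = _ := by simp only [pser, ← tsum_mul_right]

theorem norm_pser_le_of_bounded {a : ℕ → ℂ} {C : ℝ} (ha : ∀ k, ‖a k‖ ≤ C) {η : ℂ} (hη : ‖η‖ < 1) :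
    ‖pser a η‖ ≤ C / (1 - ‖η‖) := by
  rw [div_eq_mul_inv]
  refine tsum_of_norm_bounded ((hasSum_geometric_of_lt_one (norm_nonneg η) hη).mul_left C)
    fun k => ?_
  rw [norm_mul, norm_pow]
  gcongr
  exact ha k

variable (H : HeunParams)

/-- The coefficients `∑_j C_{nj}^k x₂^j`. -/
def lCoef (x₂ : ℂ) (n k : ℕ) : ℂ := pser (fun j => H.structConst n j k) x₂

/-- A bound for the growth of the structure constants. -/
def StructBound (M : ℝ) : Prop := 1 ≤ M ∧ ∀ i j k : ℕ, ‖H.structConst i j k‖ ≤ M ^ (i + j) ∧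
  (i + j < k → H.structConst i j k = 0)

/-- The kernel as an iterated power series. -/
def kSer (x₁ x₂ y : ℂ) : ℂ := y⁻¹ * pser (fun n => pser (H.lCoef x₂ n) y⁻¹) x₁

variable {H} {M : ℝ} {x₂ : ℂ}

theorem StructBound.pos (hM : H.StructBound M) : 0 < M := by linarith [hM.1]

theorem StructBound.sumOn (hM : H.StructBound M) (n k : ℕ) :
    SumOn (fun j => H.structConst n j k) (1 / M) :=
  sumOn_of_le (C := M ^ n) hM.pos fun j => by rw [← pow_add]; exact (hM.2 n j k).1

theorem StructBound.norm_lCoef_le (hM : H.StructBound M) (hx : M * ‖x₂‖ ≤ 1 / 2) (n k : ℕ) :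
    ‖H.lCoef x₂ n k‖ ≤ 2 * M ^ n := by
  rw [mul_comm]
  refine tsum_of_norm_bounded (hasSum_geometric_two.mul_left (M ^ n)) fun j => ?_
  have hM0 := hM.pos
  rw [norm_mul, norm_pow]
  calc _ ≤ M ^ (n + j) * ‖x₂‖ ^ j := by gcongr; exact (hM.2 n j k).1
    _ = M ^ n * (M * ‖x₂‖) ^ j := by rw [pow_add, mul_pow, mul_assoc]
    _ ≤ _ := by gcongr

theorem lCoef_zero (x₂ : ℂ) (k : ℕ) : H.lCoef x₂ 0 k = x₂ ^ k := by
  rw [lCoef, pser, tsum_eq_single k]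
  · simp [structConst_zero]
  · intro j hj
    simp [structConst_zero, hj]

theorem StructBound.lCoef_rec (hM : H.StructBound M) (hx : ‖x₂‖ < 1 / M) (n k : ℕ) :
    H.heunCoef (fun n => H.lCoef x₂ n k) n = H.adjCoef (H.lCoef x₂ n) k := by
  have hs := fun n k => (hM.sumOn n k).hasSum hx
  have shs : ∀ a : ℕ → ℕ → ℂ, (∀ n, HasSum (fun j => a n j * x₂ ^ j) (pser (a n) x₂)) →
      ∀ (c : ℕ → ℂ) (n : ℕ), HasSum (fun j => shiftRight (fun n => c n * a n j) n * x₂ ^ j)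
      (shiftRight (fun n => c n * pser (a n) x₂) n) := by
    intro a ha c n
    cases n with
    | zero => simp
    | succ n =>
      simp only [shiftRight_succ]
      exact ((ha n).mul_left (c n)).congr_fun fun j => by ring
  have h1 := (((hs (n + 1) k).mul_left (H.upCoeff n)).sub ((hs n k).mul_left (H.midCoeff n))).add
    (shs (fun n j => H.structConst n j k) (fun n => hs n k) H.lowCoeff n)
  have h2 := ((shs (fun k j => H.structConst n j k) (fun k => hs n k) H.upCoeff k).sub
    ((hs n k).mul_left (H.midCoeff k))).add ((hs n (k + 1)).mul_left (H.lowCoeff k))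
  refine (h1.congr_fun fun j => ?_).unique h2
  have := H.structConst_succ n j k
  linear_combination (-x₂ ^ j) * this

theorem StructBound.norm_heunCoef_le (hM : H.StructBound M) (hx : M * ‖x₂‖ ≤ 1 / 2) :
    ∃ C, ∀ n k, ‖H.heunCoef (fun n => H.lCoef x₂ n k) n‖ ≤ C * (4 * M) ^ n := by
  obtain ⟨c, hc0, hc⟩ : ∃ c : ℝ, 0 ≤ c ∧ ∀ n : ℕ, ‖H.upCoeff n‖ ≤ c * (n + 1) ^ 2 ∧
      ‖H.midCoeff n‖ ≤ c * (n + 1) ^ 2 ∧ ‖H.lowCoeff n‖ ≤ c * (n + 1) ^ 2 := by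
    have h0 := H.norm_coeffs_le
    refine ⟨‖H.t‖ * (1 + ‖H.s₁‖) + (‖1 + H.t‖ + ‖H.s₁ * (1 + H.t) + H.s₂ * H.t + H.s₃‖)
      + (1 + ‖H.r₁‖) * (1 + ‖H.r₂‖), by positivity, fun n => ?_⟩
    obtain ⟨a1, a2, a3⟩ := h0 n
    have p1 : 0 ≤ ‖H.t‖ * (1 + ‖H.s₁‖) * ((n : ℝ) + 1) ^ 2 := by positivity
    have p2 : 0 ≤ (‖1 + H.t‖ + ‖H.s₁ * (1 + H.t) + H.s₂ * H.t + H.s₃‖) * ((n : ℝ) + 1) ^ 2 := by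
      positivity
    have p3 : 0 ≤ (1 + ‖H.r₁‖) * (1 + ‖H.r₂‖) * ((n : ℝ) + 1) ^ 2 := by positivity
    refine ⟨?_, ?_, ?_⟩ <;> nlinarith
  have h4 : ∀ n : ℕ, ((n : ℝ) + 1) ^ 2 ≤ 4 ^ n := by
    intro n
    induction n with
    | zero => norm_num
    | succ n ih =>
      rw [pow_succ 4 n]
      push_cast
      nlinarith [(Nat.cast_nonneg n : (0 : ℝ) ≤ n)]
  have hM0 := hM.pos
  have hM1 := hM.1
  refine ⟨2 * c * (M + 2), fun n k => ?_⟩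
  have b1 : ‖H.upCoeff n * H.lCoef x₂ (n + 1) k‖ ≤ c * 4 ^ n * (2 * M ^ (n + 1)) := by
    rw [norm_mul]
    exact mul_le_mul ((hc n).1.trans (by gcongr; exact h4 n)) (hM.norm_lCoef_le hx _ _)
      (norm_nonneg _) (by positivity)
  have b2 : ‖H.midCoeff n * H.lCoef x₂ n k‖ ≤ c * 4 ^ n * (2 * M ^ n) := by
    rw [norm_mul]
    exact mul_le_mul ((hc n).2.1.trans (by gcongr; exact h4 n)) (hM.norm_lCoef_le hx _ _)
      (norm_nonneg _) (by positivity)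
  have b3 : ‖shiftRight (fun n => H.lowCoeff n * H.lCoef x₂ n k) n‖ ≤ c * 4 ^ n * (2 * M ^ n) := by
    cases n with
    | zero => simp; positivity
    | succ n =>
      rw [shiftRight_succ, norm_mul]
      refine (mul_le_mul ((hc n).2.2.trans (mul_le_mul_of_nonneg_left (h4 n) hc0))
        (hM.norm_lCoef_le hx _ _) (norm_nonneg _) (by positivity)).trans ?_
      gcongr
      · norm_num
      · omega
      · omega
  calc _ ≤ ‖H.upCoeff n * H.lCoef x₂ (n + 1) k‖ + ‖H.midCoeff n * H.lCoef x₂ n k‖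
        + ‖shiftRight (fun n => H.lowCoeff n * H.lCoef x₂ n k) n‖ :=
        (norm_add_le _ _).trans (add_le_add_left (norm_sub_le _ _) _)
    _ ≤ _ := add_le_add (add_le_add b1 b2) b3
    _ = _ := by rw [mul_pow, pow_succ]; ring

/-- A function of two variables together with its derivatives on which the Heun operator in `x`
minus the adjoint operator in `y` is a function of `x` alone. -/
structure HeunPair (H : HeunParams) (ρ Y : ℝ) (S Sx Sxx Sy Syy : ℂ → ℂ → ℂ) (κ : ℂ → ℂ) :
    Prop where
  hx : ∀ x y, ‖x‖ < ρ → Y < ‖y‖ → HasDerivAt (fun x => S x y) (Sx x y) x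
  hxx : ∀ x y, ‖x‖ < ρ → Y < ‖y‖ → HasDerivAt (fun x => Sx x y) (Sxx x y) x
  hy : ∀ x y, ‖x‖ < ρ → Y < ‖y‖ → HasDerivAt (fun y => S x y) (Sy x y) y
  hyy : ∀ x y, ‖x‖ < ρ → Y < ‖y‖ → HasDerivAt (fun y => Sy x y) (Syy x y) y
  pde : ∀ x y, ‖x‖ < ρ → Y < ‖y‖ →
    H.cubic x * Sxx x y + H.quad x * Sx x y + H.r₁ * H.r₂ * x * S x y
      - (H.cubic y * Syy x y + H.adjLin y * Sy x y + H.adjZero y * S x y) = κ x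

theorem HeunPair.sub_const_mul {ρ Y : ℝ} {S Sx Sxx Sy Syy T Tx Txx Ty Tyy : ℂ → ℂ → ℂ}
    {κ μ : ℂ → ℂ} (hS : H.HeunPair ρ Y S Sx Sxx Sy Syy κ) (hT : H.HeunPair ρ Y T Tx Txx Ty Tyy μ)
    (c : ℂ) : H.HeunPair ρ Y (fun x y => S x y - c * T x y) (fun x y => Sx x y - c * Tx x y)
      (fun x y => Sxx x y - c * Txx x y) (fun x y => Sy x y - c * Ty x y)
      (fun x y => Syy x y - c * Tyy x y) (fun x => κ x - c * μ x) where
  hx x y h1 h2 := (hS.hx x y h1 h2).fun_sub ((hT.hx x y h1 h2).const_mul c)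
  hxx x y h1 h2 := (hS.hxx x y h1 h2).fun_sub ((hT.hxx x y h1 h2).const_mul c)
  hy x y h1 h2 := (hS.hy x y h1 h2).fun_sub ((hT.hy x y h1 h2).const_mul c)
  hyy x y h1 h2 := (hS.hyy x y h1 h2).fun_sub ((hT.hyy x y h1 h2).const_mul c)
  pde x y h1 h2 := by
    linear_combination hS.pde x y h1 h2 - c * hT.pde x y h1 h2

theorem hasDerivAt_inv_mul_pser {b : ℕ → ℂ} {r : ℝ} (hb : SumOn b r) {y : ℂ} (hy : y ≠ 0)
    (hyr : ‖y⁻¹‖ < r) :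
    HasDerivAt (fun y => y⁻¹ * pser b y⁻¹)
      (-(y⁻¹ ^ 2 * pser b y⁻¹ + y⁻¹ ^ 3 * pser (dcoef b) y⁻¹)) y ∧
    HasDerivAt (fun y => -(y⁻¹ ^ 2 * pser b y⁻¹ + y⁻¹ ^ 3 * pser (dcoef b) y⁻¹))
      (2 * y⁻¹ ^ 3 * pser b y⁻¹ + 4 * y⁻¹ ^ 4 * pser (dcoef b) y⁻¹
        + y⁻¹ ^ 5 * pser (dcoef (dcoef b)) y⁻¹) y := by
  have hi := hasDerivAt_inv hy
  have g0 := (hb.hasDerivAt hyr).comp y hi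
  have g1 := (hb.dcoef.hasDerivAt hyr).comp y hi
  constructor
  · refine (hi.fun_mul g0).congr_deriv ?_
    simp only [Function.comp, inv_pow]
    field_simp
    ring
  · refine (((hi.fun_pow 2).fun_mul g0).fun_add ((hi.fun_pow 3).fun_mul g1)).fun_neg.congr_deriv ?_
    simp only [Function.comp, inv_pow]
    push_cast
    field_simp
    ring

theorem StructBound.heunPair (hM : H.StructBound M) (hx₂ : M * ‖x₂‖ ≤ 1 / 2) :
    ∃ Sx Sxx Sy Syy κ, H.HeunPair (1 / (4 * M)) 1 (fun x y => H.kSer x x₂ y) Sx Sxx Sy Syy κ := by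
  have hM0 := hM.pos
  have hx₂' : ‖x₂‖ < 1 / M := by
    rw [lt_div_iff₀ hM0, mul_comm]
    linarith
  have hle : 1 / (4 * M) ≤ 1 / M := by
    gcongr
    linarith
  have hbd := fun n k => hM.norm_lCoef_le hx₂ n k
  have hinv : ∀ y : ℂ, 1 < ‖y‖ → ‖y⁻¹‖ < 1 := fun y hy => by
    rw [norm_inv]
    exact inv_lt_one_of_one_lt₀ hy
  have sX : ∀ y : ℂ, 1 < ‖y‖ → SumOn (fun n => pser (H.lCoef x₂ n) y⁻¹) (1 / M) := fun y hy => by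
    refine sumOn_of_le (C := 2 / (1 - ‖y⁻¹‖)) hM0 fun n => ?_
    refine (norm_pser_le_of_bounded (hbd n) (hinv y hy)).trans (le_of_eq ?_)
    ring
  have hbY : ∀ x : ℂ, ‖x‖ < 1 / (4 * M) → ∀ k, ‖pser (fun n => H.lCoef x₂ n k) x‖ ≤ 2 * 2 := by
    intro x hx k
    refine tsum_of_norm_bounded (hasSum_geometric_two.mul_left 2) fun n => ?_
    have hx' : M * ‖x‖ ≤ 1 / 2 := by
      rw [lt_div_iff₀ (by positivity)] at hx
      nlinarith [norm_nonneg x]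
    rw [norm_mul, norm_pow]
    calc _ ≤ 2 * M ^ n * ‖x‖ ^ n := by gcongr; exact hbd n k
      _ = 2 * (M * ‖x‖) ^ n := by rw [mul_pow, mul_assoc]
      _ ≤ _ := by gcongr
  have sY : ∀ x : ℂ, ‖x‖ < 1 / (4 * M) → SumOn (fun k => pser (fun n => H.lCoef x₂ n k) x) 1 := by
    intro x hx
    have := sumOn_of_le (a := fun k => pser (fun n => H.lCoef x₂ n k) x) (C := 2 * 2) (M := 1)
      one_pos fun k => by rw [one_pow, mul_one]; exact hbY x hx k
    rwa [one_div_one] at this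
  have hsw : ∀ x y : ℂ, ‖x‖ < 1 / (4 * M) → 1 < ‖y‖ →
      H.kSer x x₂ y = y⁻¹ * pser (fun k => pser (fun n => H.lCoef x₂ n k) x) y⁻¹ := by
    intro x y hx hy
    rw [kSer, pser_swap hM0 hbd (hx.trans_le hle) (hinv y hy)]
  obtain ⟨C, hC⟩ := hM.norm_heunCoef_le hx₂
  have hderiv := fun (x y : ℂ) (hx : ‖x‖ < 1 / (4 * M)) (hy : 1 < ‖y‖) =>
    hasDerivAt_inv_mul_pser (sY x hx) (norm_pos_iff.mp (one_pos.trans hy)) (hinv y hy)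
  refine ⟨_, _, _, _, fun x => -((H.r₁ - 1) * (H.r₂ - 1) * pser (fun n => H.lCoef x₂ n 0) x),
    ⟨fun x y hx hy => ((sX y hy).hasDerivAt (hx.trans_le hle)).const_mul y⁻¹,
    fun x y hx hy => ((sX y hy).dcoef.hasDerivAt (hx.trans_le hle)).const_mul y⁻¹,
    fun x y hx hy => ?_, fun x y hx hy => (hderiv x y hx hy).2, ?_⟩⟩
  · refine (hderiv x y hx hy).1.congr_of_eventuallyEq ?_
    filter_upwards [(isOpen_lt continuous_const continuous_norm).mem_nhds hy] with y' hy'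
    exact hsw x y' hx hy'
  · intro x y hx hy
    have hy0 : y ≠ 0 := norm_pos_iff.mp (one_pos.trans hy)
    have h1 := H.heun_pser (sX y hy) (hx.trans_le hle)
    have h2 := H.adj_pser (sY x hx) (hinv y hy) (mul_inv_cancel₀ hy0)
    have hsum : ∀ n, SumOn (H.lCoef x₂ n) 1 := fun n => by
      have := sumOn_of_le (a := H.lCoef x₂ n) (C := 2 * M ^ n) (M := 1) one_pos fun k => by
        rw [one_pow, mul_one]; exact hbd n k
      rwa [one_div_one] at this
    have hsumx : ∀ k, SumOn (fun n => H.lCoef x₂ n k) (1 / M) := fun k =>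
      sumOn_of_le hM0 fun n => hbd n k
    have e1 : H.heunCoef (fun n => pser (H.lCoef x₂ n) y⁻¹) = fun n =>
        pser (fun k => H.heunCoef (fun n => H.lCoef x₂ n k) n) y⁻¹ := by
      funext n
      have hs := fun n => (hsum n).hasSum (hinv y hy)
      have h3 : HasSum (fun k => shiftRight (fun n => H.lowCoeff n * H.lCoef x₂ n k) n * y⁻¹ ^ k)
          (shiftRight (fun n => H.lowCoeff n * pser (H.lCoef x₂ n) y⁻¹) n) := by
        cases n with
        | zero => simp
        | succ n =>
          simp only [shiftRight_succ]
          exact ((hs n).mul_left (H.lowCoeff n)).congr_fun fun j => by ring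
      refine (((((hs (n + 1)).mul_left (H.upCoeff n)).sub ((hs n).mul_left (H.midCoeff n))).add
        h3).congr_fun fun k => ?_).tsum_eq.symm
      change (H.upCoeff n * _ - _ + _) * _ = _
      ring
    have e2 : H.adjCoef (fun k => pser (fun n => H.lCoef x₂ n k) x) = fun k =>
        pser (fun n => H.heunCoef (fun n => H.lCoef x₂ n k) n) x := by
      funext k
      have hs := fun k => (hsumx k).hasSum (hx.trans_le hle)
      have h3 : HasSum (fun n => shiftRight (fun k => H.upCoeff k * H.lCoef x₂ n k) k * x ^ n)
          (shiftRight (fun k => H.upCoeff k * pser (fun n => H.lCoef x₂ n k) x) k) := by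
        cases k with
        | zero => simp
        | succ k =>
          simp only [shiftRight_succ]
          exact ((hs k).mul_left (H.upCoeff k)).congr_fun fun j => by ring
      refine (((h3.sub ((hs k).mul_left (H.midCoeff k))).add
        ((hs (k + 1)).mul_left (H.lowCoeff k))).congr_fun fun n => ?_).tsum_eq.symm
      change H.heunCoef (fun n => H.lCoef x₂ n k) n * x ^ n = _
      rw [hM.lCoef_rec hx₂', adjCoef]
      ring
    rw [e1, pser_swap (L := fun n k => H.heunCoef (fun n => H.lCoef x₂ n k) n) (by positivity) hC hx
      (hinv y hy)] at h1
    rw [e2] at h2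
    rw [← h1] at h2
    have h3 := hsw x y hx hy
    change _ * (y⁻¹ * _) + _ * (y⁻¹ * _) + _ * H.kSer x x₂ y - _ = _
    nth_rewrite 2 [h3]
    rw [kSer]
    linear_combination -h2

end HeunParams

end

noncomputable section

namespace HeunParams

open Filter Topology

/-- Schwarz lemma for a zero of higher order. -/
theorem norm_le_of_eq_pow_mul {f T : ℂ → ℂ} {r A : ℝ} (hr : 0 < r) {n : ℕ}
    (hT : ContinuousOn T (Metric.closedBall 0 r)) (hT' : DifferentiableOn ℂ T (Metric.ball 0 r))
    (hf : ∀ x ∈ Metric.closedBall (0 : ℂ) r, f x = x ^ n * T x)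
    (hA : ∀ x ∈ Metric.closedBall (0 : ℂ) r, ‖f x‖ ≤ A) {x : ℂ} (hx : x ∈ Metric.closedBall 0 r) :
    ‖T x‖ ≤ A / r ^ n := by
  refine Complex.norm_le_of_forall_mem_frontier_norm_le (U := Metric.ball (0 : ℂ) r)
    Metric.isBounded_ball ⟨hT', ?_⟩ ?_ ?_
  · rwa [closure_ball _ hr.ne']
  · intro z hz
    rw [frontier_ball _ hr.ne'] at hz
    have h1 := hA z (Metric.sphere_subset_closedBall hz)
    rw [hf z (Metric.sphere_subset_closedBall hz), norm_mul, norm_pow,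
      mem_sphere_zero_iff_norm.mp hz] at h1
    rw [le_div_iff₀ (by positivity), mul_comm]
    exact h1
  · rwa [closure_ball _ hr.ne']

variable {H : HeunParams} {ρ Y B : ℝ} {S Sx Sxx Sy Syy : ℂ → ℂ → ℂ} {κ : ℂ → ℂ}

/-- The limit of the part of the differential equation in `x` at a zero of order `m + 1`. -/
theorem HeunPair.tendsto_x (hS : H.HeunPair ρ Y S Sx Sxx Sy Syy κ) (hρ : 0 < ρ) {y : ℂ}
    (hy : Y < ‖y‖) {m : ℕ} {T : ℂ → ℂ} (hT : DifferentiableOn ℂ T (Metric.ball 0 ρ))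
    (hST : ∀ x ∈ Metric.ball (0 : ℂ) ρ, S x y = x ^ (m + 1) * T x) :
    Tendsto (fun x => (H.cubic x * Sxx x y + H.quad x * Sx x y + H.r₁ * H.r₂ * x * S x y) / x ^ m)
      (𝓝[≠] 0) (𝓝 (H.upCoeff m * T 0)) := by
  have hopen : IsOpen (Metric.ball (0 : ℂ) ρ) := Metric.isOpen_ball
  have hd1 : ∀ x ∈ Metric.ball (0 : ℂ) ρ, HasDerivAt T (deriv T x) x := fun x hx =>
    (hT.differentiableAt (hopen.mem_nhds hx)).hasDerivAt
  have hT1 : DifferentiableOn ℂ (deriv T) (Metric.ball 0 ρ) := hT.deriv hopen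
  have hd2 : ∀ x ∈ Metric.ball (0 : ℂ) ρ, HasDerivAt (deriv T) (deriv (deriv T) x) x := fun x hx =>
    (hT1.differentiableAt (hopen.mem_nhds hx)).hasDerivAt
  have hT2 : DifferentiableOn ℂ (deriv (deriv T)) (Metric.ball 0 ρ) := hT1.deriv hopen
  have e1 : ∀ x ∈ Metric.ball (0 : ℂ) ρ, Sx x y = (m + 1) * x ^ m * T x + x ^ (m + 1) * deriv T x := by
    intro x hx
    have h1 : HasDerivAt (fun x => S x y) ((m + 1) * x ^ m * T x + x ^ (m + 1) * deriv T x) x := by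
      refine (((hasDerivAt_pow (m + 1) x).fun_mul (hd1 x hx)).congr_deriv ?_).congr_of_eventuallyEq
        ?_
      · push_cast
        simp
      · filter_upwards [hopen.mem_nhds hx] with z hz using hST z hz
    exact (hS.hx x y (mem_ball_zero_iff.mp hx) hy).unique h1
  have e2 : ∀ x ∈ Metric.ball (0 : ℂ) ρ, x * Sxx x y = x ^ m * ((m + 1) * m * T x
      + 2 * (m + 1) * x * deriv T x + x ^ 2 * deriv (deriv T) x) := by
    intro x hx
    have h1 : HasDerivAt (fun x => Sx x y) (((m + 1) * (m * x ^ (m - 1)) * T x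
        + (m + 1) * x ^ m * deriv T x) + ((m + 1) * x ^ m * deriv T x
        + x ^ (m + 1) * deriv (deriv T) x)) x := by
      refine (((((hasDerivAt_pow m x).const_mul ((m : ℂ) + 1)).fun_mul (hd1 x hx)).fun_add
        ((hasDerivAt_pow (m + 1) x).fun_mul (hd2 x hx))).congr_deriv ?_).congr_of_eventuallyEq ?_
      · push_cast
        simp
      · filter_upwards [hopen.mem_nhds hx] with z hz using e1 z hz
    rw [(hS.hxx x y (mem_ball_zero_iff.mp hx) hy).unique h1]
    rcases m with _ | m
    · simp; ring
    · simp only [Nat.add_sub_cancel]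
      push_cast
      ring
  have hG : Tendsto (fun x => (x - 1) * (x - H.t) * ((m + 1) * m * T x
      + 2 * (m + 1) * x * deriv T x + x ^ 2 * deriv (deriv T) x)
      + H.quad x * ((m + 1) * T x + x * deriv T x) + H.r₁ * H.r₂ * x * (x * T x)) (𝓝 0)
      (𝓝 (H.upCoeff m * T 0)) := by
    have h0 : (0 : ℂ) ∈ Metric.ball (0 : ℂ) ρ := Metric.mem_ball_self hρ
    have c0 := (hT.differentiableAt (hopen.mem_nhds h0)).continuousAt
    have c1 := (hT1.differentiableAt (hopen.mem_nhds h0)).continuousAt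
    have c2 := (hT2.differentiableAt (hopen.mem_nhds h0)).continuousAt
    have : ContinuousAt (fun x => (x - 1) * (x - H.t) * ((m + 1) * m * T x
      + 2 * (m + 1) * x * deriv T x + x ^ 2 * deriv (deriv T) x)
      + H.quad x * ((m + 1) * T x + x * deriv T x) + H.r₁ * H.r₂ * x * (x * T x)) 0 := by
      simp only [quad]
      fun_prop
    have h := this.tendsto
    convert h using 2
    simp only [quad, upCoeff]
    ring
  refine (hG.mono_left nhdsWithin_le_nhds).congr' ?_
  filter_upwards [self_mem_nhdsWithin, mem_nhdsWithin_of_mem_nhds (hopen.mem_nhds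
    (Metric.mem_ball_self hρ))] with x hx0 hx
  have hx0' : x ^ m ≠ 0 := pow_ne_zero _ hx0
  rw [eq_div_iff hx0', e1 x hx, hST x hx, cubic]
  linear_combination (-(x - 1) * (x - H.t)) * e2 x hx

/-- The limit of the part of the differential equation in `y` at a zero of order `m + 1`. -/
theorem HeunPair.tendsto_y (hS : H.HeunPair ρ Y S Sx Sxx Sy Syy κ) (hρ : 0 < ρ) (hY : 0 ≤ Y)
    (hB : ∀ x y, ‖x‖ < ρ → Y < ‖y‖ → ‖S x y‖ ≤ B / ‖y‖) {m : ℕ} {T : ℂ → ℂ → ℂ}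
    (hT : ∀ y, Y < ‖y‖ → DifferentiableOn ℂ (T y) (Metric.ball 0 ρ))
    (hST : ∀ y, Y < ‖y‖ → ∀ x ∈ Metric.ball (0 : ℂ) ρ, S x y = x ^ (m + 1) * T y x) {y : ℂ}
    (hy : Y < ‖y‖) :
    Tendsto (fun x => (H.cubic y * Syy x y + H.adjLin y * Sy x y + H.adjZero y * S x y) / x ^ m)
      (𝓝[≠] 0) (𝓝 0) := by
  have hr : 0 < ρ / 2 := by positivity
  have hsub : Metric.closedBall (0 : ℂ) (ρ / 2) ⊆ Metric.ball 0 ρ :=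
    Metric.closedBall_subset_ball (by linarith)
  have hTb : ∀ w, Y < ‖w‖ → ∀ x ∈ Metric.closedBall (0 : ℂ) (ρ / 2),
      ‖T w x‖ ≤ B / ‖w‖ / (ρ / 2) ^ (m + 1) := fun w hw x hx =>
    norm_le_of_eq_pow_mul (f := fun x => S x w) hr ((hT w hw).continuousOn.mono hsub)
      ((hT w hw).mono (Metric.ball_subset_closedBall.trans hsub))
      (fun x hx => hST w hw x (hsub hx))
      (fun x hx => hB x w (mem_ball_zero_iff.mp (hsub hx)) hw) hx
  set e := (‖y‖ - Y) / 3 with he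
  have he0 : 0 < e := by rw [he]; linarith
  have hy0 : 0 < ‖y‖ := hY.trans_lt hy
  have hB0 : 0 ≤ B := by
    have := (norm_nonneg _).trans (hB 0 y (by simpa using hρ) hy)
    rwa [le_div_iff₀ hy0, zero_mul] at this
  have hw : ∀ w, dist w y ≤ 2 * e → Y < ‖w‖ ∧ ‖y‖ / 3 ≤ ‖w‖ := by
    intro w hw
    have h1 : ‖y‖ ≤ ‖w‖ + dist w y := by
      rw [dist_eq_norm, norm_sub_rev]
      calc ‖y‖ = ‖w + (y - w)‖ := by rw [add_sub_cancel]
        _ ≤ _ := norm_add_le _ _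
    constructor <;> linarith
  set A := B / (‖y‖ / 3) / (ρ / 2) ^ (m + 1) with hA
  have hSb : ∀ x ∈ Metric.closedBall (0 : ℂ) (ρ / 2), ∀ w, dist w y ≤ 2 * e →
      ‖S x w‖ ≤ ‖x‖ ^ (m + 1) * A := by
    intro x hx w hwy
    obtain ⟨h1, h2⟩ := hw w hwy
    rw [hST w h1 x (hsub hx), norm_mul, norm_pow]
    refine mul_le_mul_of_nonneg_left ((hTb w h1 x hx).trans ?_) (by positivity)
    rw [hA]
    gcongr
  have hdiff : ∀ x ∈ Metric.closedBall (0 : ℂ) (ρ / 2), ∀ w, dist w y ≤ 2 * e →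
      HasDerivAt (fun y => S x y) (Sy x w) w ∧ HasDerivAt (fun y => Sy x y) (Syy x w) w :=
    fun x hx w hwy => ⟨hS.hy x w (mem_ball_zero_iff.mp (hsub hx)) (hw w hwy).1,
      hS.hyy x w (mem_ball_zero_iff.mp (hsub hx)) (hw w hwy).1⟩
  have hSy : ∀ x ∈ Metric.closedBall (0 : ℂ) (ρ / 2), ∀ w, dist w y ≤ e →
      ‖Sy x w‖ ≤ ‖x‖ ^ (m + 1) * A / e := by
    intro x hx w hwy
    rw [← (hdiff x hx w (by linarith)).1.deriv]
    have hin : ∀ z ∈ Metric.closedBall w e, dist z y ≤ 2 * e := fun z hz => by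
      rw [Metric.mem_closedBall] at hz
      linarith [dist_triangle z w y]
    refine Complex.norm_deriv_le_of_forall_mem_sphere_norm_le he0 ?_ fun z hz =>
      hSb x hx z (hin z (Metric.sphere_subset_closedBall hz))
    exact DifferentiableOn.diffContOnCl fun z hz => (hdiff x hx z (hin z
      (Metric.closure_ball_subset_closedBall hz))).1.differentiableAt.differentiableWithinAt
  have hSyy : ∀ x ∈ Metric.closedBall (0 : ℂ) (ρ / 2),
      ‖Syy x y‖ ≤ ‖x‖ ^ (m + 1) * A / e / e := by
    intro x hx
    rw [← (hdiff x hx y (by rw [dist_self]; linarith)).2.deriv]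
    refine Complex.norm_deriv_le_of_forall_mem_sphere_norm_le he0 ?_ fun z hz =>
      hSy x hx z (Metric.mem_closedBall.mp (Metric.sphere_subset_closedBall hz))
    exact DifferentiableOn.diffContOnCl fun z hz => (hdiff x hx z (by
      have := Metric.mem_closedBall.mp (Metric.closure_ball_subset_closedBall hz)
      linarith)).2.differentiableAt.differentiableWithinAt
  set N := ‖H.cubic y‖ * (A / e / e) + ‖H.adjLin y‖ * (A / e) + ‖H.adjZero y‖ * A with hN
  have hlim : Tendsto (fun x : ℂ => ‖x‖ * N) (𝓝[≠] 0) (𝓝 0) := by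
    have : Tendsto (fun x : ℂ => ‖x‖ * N) (𝓝 0) (𝓝 (‖(0 : ℂ)‖ * N)) :=
      (continuous_norm.mul continuous_const).tendsto 0
    rw [norm_zero, zero_mul] at this
    exact this.mono_left nhdsWithin_le_nhds
  refine squeeze_zero_norm' ?_ hlim
  filter_upwards [self_mem_nhdsWithin, mem_nhdsWithin_of_mem_nhds
    (Metric.closedBall_mem_nhds (0 : ℂ) hr)] with x hx0 hx
  have hxm : 0 < ‖x‖ ^ m := pow_pos (norm_pos_iff.mpr hx0) m
  rw [norm_div, norm_pow, div_le_iff₀ hxm]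
  calc _ ≤ ‖H.cubic y * Syy x y‖ + ‖H.adjLin y * Sy x y‖ + ‖H.adjZero y * S x y‖ :=
        norm_add₃_le
    _ ≤ ‖H.cubic y‖ * (‖x‖ ^ (m + 1) * A / e / e) + ‖H.adjLin y‖ * (‖x‖ ^ (m + 1) * A / e)
        + ‖H.adjZero y‖ * (‖x‖ ^ (m + 1) * A) := by
        simp only [norm_mul]
        gcongr
        · exact hSyy x hx
        · exact hSy x hx y (by rw [dist_self]; exact he0.le)
        · exact hSb x hx y (by rw [dist_self]; linarith)
    _ = _ := by rw [hN]; ring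

/-- A solution of the differential equation that vanishes for `x = 0` and for `y = ∞` is zero. -/
theorem HeunPair.eq_zero (hS : H.HeunPair ρ Y S Sx Sxx Sy Syy κ) (hρ : 0 < ρ) (hY : 0 ≤ Y)
    (hB : ∀ x y, ‖x‖ < ρ → Y < ‖y‖ → ‖S x y‖ ≤ B / ‖y‖) (h0 : ∀ y, Y < ‖y‖ → S 0 y = 0)
    {x y : ℂ} (hx : ‖x‖ < ρ / 2) (hy : Y < ‖y‖) : S x y = 0 := by
  have hopen : IsOpen (Metric.ball (0 : ℂ) ρ) := Metric.isOpen_ball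
  have h0mem : (0 : ℂ) ∈ Metric.ball (0 : ℂ) ρ := Metric.mem_ball_self hρ
  have hr : 0 < ρ / 2 := by positivity
  have hsub : Metric.closedBall (0 : ℂ) (ρ / 2) ⊆ Metric.ball 0 ρ :=
    Metric.closedBall_subset_ball (by linarith)
  have hdsl : ∀ f : ℂ → ℂ, DifferentiableOn ℂ f (Metric.ball 0 ρ) → f 0 = 0 →
      DifferentiableOn ℂ (dslope f 0) (Metric.ball 0 ρ) ∧ ∀ x, f x = x * dslope f 0 x := by
    intro f hf hf0
    refine ⟨(Complex.differentiableOn_dslope (hopen.mem_nhds h0mem)).mpr hf, fun x => ?_⟩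
    have := sub_smul_dslope f 0 x
    rw [hf0, sub_zero, sub_zero, smul_eq_mul] at this
    exact this.symm
  have claim : ∀ n : ℕ, ∃ T : ℂ → ℂ → ℂ,
      (∀ y, Y < ‖y‖ → DifferentiableOn ℂ (T y) (Metric.ball 0 ρ)) ∧
      ∀ y, Y < ‖y‖ → ∀ x ∈ Metric.ball (0 : ℂ) ρ, S x y = x ^ (n + 1) * T y x := by
    intro n
    induction n with
    | zero =>
      have hd : ∀ y : ℂ, Y < ‖y‖ → DifferentiableOn ℂ (fun x => S x y) (Metric.ball 0 ρ) :=
        fun y hy x hx =>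
          (hS.hx x y (mem_ball_zero_iff.mp hx) hy).differentiableAt.differentiableWithinAt
      refine ⟨fun y => dslope (fun x => S x y) 0, fun y hy => (hdsl _ (hd y hy) (h0 y hy)).1,
        fun y hy x _ => ?_⟩
      rw [zero_add, pow_one]
      exact (hdsl _ (hd y hy) (h0 y hy)).2 x
    | succ m ih =>
      obtain ⟨T, hT, hST⟩ := ih
      have hlim : ∀ y : ℂ, Y < ‖y‖ → Tendsto (fun x => κ x / x ^ m) (𝓝[≠] 0)
          (𝓝 (H.upCoeff m * T y 0)) := by
        intro y hy
        have h1 := (hS.tendsto_x hρ hy (hT y hy) (hST y hy)).sub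
          (hS.tendsto_y hρ hY hB hT hST hy)
        rw [sub_zero] at h1
        refine h1.congr' ?_
        filter_upwards [mem_nhdsWithin_of_mem_nhds (hopen.mem_nhds h0mem)] with x hx
        rw [← sub_div, hS.pde x y (mem_ball_zero_iff.mp hx) hy]
      have hT0 : ∀ y : ℂ, Y < ‖y‖ → T y 0 = 0 := by
        intro y hy
        have hbd : ∀ w : ℂ, Y < ‖w‖ → ‖T y 0‖ ≤ B / (ρ / 2) ^ (m + 1) / ‖w‖ := by
          intro w hw
          have := mul_left_cancel₀ (H.upCoeff_ne m) (tendsto_nhds_unique (hlim y hy) (hlim w hw))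
          rw [this, div_right_comm]
          exact norm_le_of_eq_pow_mul (f := fun x => S x w) hr
            ((hT w hw).continuousOn.mono hsub)
            ((hT w hw).mono (Metric.ball_subset_closedBall.trans hsub))
            (fun x hx => hST w hw x (hsub hx))
            (fun x hx => hB x w (mem_ball_zero_iff.mp (hsub hx)) hw)
            (Metric.mem_closedBall_self hr.le)
        have hl : Tendsto (fun N : ℝ => B / (ρ / 2) ^ (m + 1) / N) atTop (𝓝 0) :=
          tendsto_const_nhds.div_atTop tendsto_id
        have : ‖T y 0‖ ≤ 0 := by
          refine ge_of_tendsto hl ?_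
          filter_upwards [eventually_gt_atTop Y] with N hN
          have hn : ‖(N : ℂ)‖ = N := by
            rw [Complex.norm_real, Real.norm_of_nonneg (hY.trans hN.le)]
          have := hbd N (by rwa [hn])
          rwa [hn] at this
        exact norm_le_zero_iff.mp this
      refine ⟨fun y => dslope (T y) 0, fun y hy => (hdsl _ (hT y hy) (hT0 y hy)).1,
        fun y hy x hx => ?_⟩
      rw [hST y hy x hx, (hdsl _ (hT y hy) (hT0 y hy)).2 x]
      ring
  have hbd : ∀ n : ℕ, ‖S x y‖ ≤ B / ‖y‖ * (‖x‖ / (ρ / 2)) ^ (n + 1) := by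
    intro n
    obtain ⟨T, hT, hST⟩ := claim n
    have hxm : x ∈ Metric.closedBall (0 : ℂ) (ρ / 2) := by simpa using hx.le
    have h1 := norm_le_of_eq_pow_mul (f := fun x => S x y) hr ((hT y hy).continuousOn.mono hsub)
      ((hT y hy).mono (Metric.ball_subset_closedBall.trans hsub))
      (fun x hx => hST y hy x (hsub hx))
      (fun x hx => hB x y (mem_ball_zero_iff.mp (hsub hx)) hy) hxm
    rw [hST y hy x (hsub hxm), norm_mul, norm_pow]
    calc _ ≤ ‖x‖ ^ (n + 1) * (B / ‖y‖ / (ρ / 2) ^ (n + 1)) := by gcongr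
      _ = _ := by rw [div_pow (‖x‖)]; generalize (ρ / 2) ^ (n + 1) = z; ring
  have hlt : ‖x‖ / (ρ / 2) < 1 := (div_lt_one hr).mpr hx
  have hl : Tendsto (fun n : ℕ => B / ‖y‖ * (‖x‖ / (ρ / 2)) ^ (n + 1)) atTop (𝓝 0) := by
    have := ((tendsto_pow_atTop_nhds_zero_of_lt_one (by positivity) hlt).comp
      (tendsto_add_atTop_nat 1)).const_mul (B / ‖y‖)
    rwa [mul_zero] at this
  exact norm_le_zero_iff.mp (ge_of_tendsto' hl hbd)

end HeunParams

end

noncomputable section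

namespace HeunParams

open Filter Topology MeasureTheory

variable {H : HeunParams} {M ε r C : ℝ} {x₁ x₂ y : ℂ}

theorem Dom.of_one_lt (hε : 0 < ε) (h1 : ‖x₁‖ < ε) (h2 : ‖x₂‖ < ε) (hy : 1 < ‖y‖) :
    Dom ε x₁ x₂ y :=
  ⟨h1, h2, h1.trans (lt_mul_of_one_lt_right hε hy), h2.trans (lt_mul_of_one_lt_right hε hy)⟩

/-- The general term of the kernel is bounded by a product of geometric sequences. -/
theorem StructBound.norm_kernelTerm_le (hM : H.StructBound M) (hε : 2 * M * ε ≤ 1 / 2)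
    (hd : Dom ε x₁ x₂ y) (m : ℕ × ℕ × ℕ) :
    ‖H.kernelTerm x₁ x₂ y m‖ ≤ (1 / 2) ^ m.1 * ((1 / 2) ^ m.2.1 * (1 / 2) ^ m.2.2) / ‖y‖ := by
  obtain ⟨i, j, k⟩ := m
  have hM0 := hM.pos
  have hy : 0 < ‖y‖ := norm_pos_iff.mpr hd.y_ne
  have hε0 : 0 < ε := (norm_nonneg _).trans_lt hd.1
  simp only [kernelTerm]
  rcases lt_or_ge (i + j) k with h | h
  · rw [(hM.2 i j k).2 h]
    simp only [zero_mul, zero_div, norm_zero]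
    positivity
  set μ := min 1 ‖y‖ with hμ
  have hμ0 : 0 < μ := lt_min one_pos hy
  have hb : ∀ x : ℂ, ‖x‖ < ε → ‖x‖ < ε * ‖y‖ → ‖x‖ ≤ ε * μ := by
    intro x h1 h2
    rcases min_choice 1 ‖y‖ with h' | h' <;> rw [hμ, h']
    · rw [mul_one]; exact h1.le
    · exact h2.le
  have hμk : μ ^ (i + j) ≤ ‖y‖ ^ k :=
    (pow_le_pow_of_le_one hμ0.le (min_le_left _ _) h).trans
      (pow_le_pow_left₀ hμ0.le (min_le_right _ _) k)
  have h2 : (1 : ℝ) ≤ 2 ^ (i + j) * (1 / 2) ^ k := by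
    rw [div_pow, one_pow, mul_one_div, one_le_div (by positivity)]
    exact pow_le_pow_right₀ one_le_two h
  rw [norm_div, norm_mul, norm_mul, norm_pow, norm_pow, norm_pow, pow_succ, ← div_div]
  gcongr
  rw [div_le_iff₀ (by positivity)]
  calc ‖H.structConst i j k‖ * ‖x₁‖ ^ i * ‖x₂‖ ^ j
      ≤ M ^ (i + j) * (ε * μ) ^ i * (ε * μ) ^ j := by
        gcongr
        · exact (hM.2 i j k).1
        · exact hb _ hd.1 hd.2.2.1
        · exact hb _ hd.2.1 hd.2.2.2
    _ = (M * ε) ^ (i + j) * 1 * μ ^ (i + j) := by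
        simp only [mul_pow, pow_add]
        ring
    _ ≤ (M * ε) ^ (i + j) * (2 ^ (i + j) * (1 / 2) ^ k) * ‖y‖ ^ k := by gcongr
    _ = (2 * M * ε) ^ (i + j) * (1 / 2) ^ k * ‖y‖ ^ k := by
        simp only [mul_pow]
        ring
    _ ≤ (1 / 2) ^ (i + j) * (1 / 2) ^ k * ‖y‖ ^ k := by gcongr
    _ = _ := by rw [pow_add]; ring

theorem summable_geometric_triple :
    Summable fun m : ℕ × ℕ × ℕ => (1 / 2 : ℝ) ^ m.1 * ((1 / 2) ^ m.2.1 * (1 / 2) ^ m.2.2) := by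
  have h := summable_geometric_two
  have h2 : Summable fun m : ℕ × ℕ => (1 / 2 : ℝ) ^ m.1 * (1 / 2) ^ m.2 :=
    h.mul_of_nonneg h (fun n => by positivity) (fun n => by positivity)
  exact h.mul_of_nonneg h2 (fun n => by positivity) (fun n => by positivity)

theorem StructBound.summable_kernelTerm (hM : H.StructBound M) (hε : 2 * M * ε ≤ 1 / 2)
    (hd : Dom ε x₁ x₂ y) : Summable (H.kernelTerm x₁ x₂ y) :=
  Summable.of_norm_bounded (summable_geometric_triple.div_const ‖y‖)
    (hM.norm_kernelTerm_le hε hd)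

theorem StructBound.kernel_eq_kSer (hM : H.StructBound M) (hε : 2 * M * ε ≤ 1 / 2)
    (hd : Dom ε x₁ x₂ y) : H.kernel x₁ x₂ y = H.kSer x₁ x₂ y := by
  have hs := hM.summable_kernelTerm hε hd
  rw [kernel, hs.tsum_prod, kSer, pser, ← tsum_mul_left]
  refine tsum_congr fun i => ?_
  have hsi : Summable fun p : ℕ × ℕ => H.kernelTerm x₁ x₂ y (i, p) := hs.prod_factor i
  have e : ∀ k, ∑' j, H.kernelTerm x₁ x₂ y (i, j, k) =
      y⁻¹ * (H.lCoef x₂ i k * y⁻¹ ^ k * x₁ ^ i) := by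
    intro k
    rw [lCoef, pser, ← tsum_mul_right, ← tsum_mul_right, ← tsum_mul_left]
    refine tsum_congr fun j => ?_
    simp only [kernelTerm]
    rw [div_eq_mul_inv, pow_succ, mul_inv, inv_pow]
    ring
  calc ∑' p : ℕ × ℕ, H.kernelTerm x₁ x₂ y (i, p)
      = ∑' j, ∑' k, H.kernelTerm x₁ x₂ y (i, j, k) := hsi.tsum_prod
    _ = ∑' k, ∑' j, H.kernelTerm x₁ x₂ y (i, j, k) :=
        (Summable.tsum_comm (f := fun j k => H.kernelTerm x₁ x₂ y (i, j, k)) hsi).symm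
    _ = _ := by
        simp only [e]
        rw [tsum_mul_left, pser, ← tsum_mul_right]

theorem StructBound.differentiableOn_kernel (hM : H.StructBound M) (hε : 2 * M * ε ≤ 1 / 2) :
    DifferentiableOn ℂ (fun y => H.kernel x₁ x₂ y) {y | Dom ε x₁ x₂ y} := by
  intro y hy
  have hy0 : 0 < ‖y‖ := norm_pos_iff.mpr (Dom.y_ne hy)
  set U := {y | Dom ε x₁ x₂ y} ∩ {z | ‖y‖ / 2 < ‖z‖} with hU
  have hopen : IsOpen U := (isOpen_dom_y ε x₁ x₂).inter (isOpen_lt continuous_const continuous_norm)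
  have hyU : y ∈ U := ⟨hy, show ‖y‖ / 2 < ‖y‖ by linarith⟩
  have hd : DifferentiableOn ℂ (fun y => ∑' m, H.kernelTerm x₁ x₂ y m) U := by
    refine Complex.differentiableOn_tsum_of_summable_norm
      (summable_geometric_triple.div_const (‖y‖ / 2)) (fun m z hz => ?_) hopen fun m z hz => ?_
    · have hz0 : z ≠ 0 := hz.1.y_ne
      simp only [kernelTerm]
      exact DifferentiableAt.differentiableWithinAt (by fun_prop (disch := simp [hz0]))
    · refine (hM.norm_kernelTerm_le hε hz.1 m).trans ?_
      have := hz.2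
      gcongr
      exact le_of_lt this
  exact (hd.differentiableAt (hopen.mem_nhds hyU)).differentiableWithinAt

theorem Ctl.rInt_zero (hs : 1 < H.s₁.re) (hc : H.Ctl ε r C) (hd : Dom ε 0 x₂ y) :
    (H.s₁ - 1) / (1 - H.t) * H.rInt 0 x₂ y = (y - x₂)⁻¹ := by
  have hne : H.s₁ - 1 ≠ 0 := by
    intro h
    have := congrArg Complex.re h
    simp at this
    linarith
  have : H.rInt 0 x₂ y = ∫ q in (0 : ℝ)..1, (q : ℂ) ^ (H.s₁ - 2) * ((1 - H.t) / (y - x₂)) := by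
    refine intervalIntegral.integral_congr fun q hq => ?_
    rw [Set.uIcc_of_le zero_le_one] at hq
    rw [hc.fC_zero x₂ y q hd (norm_ofReal_le_one hq)]
  have hI := integral_cpow (a := 0) (b := 1) (r := H.s₁ - 2) (Or.inl (by simp; linarith))
  have h21 : H.s₁ - 2 + 1 = H.s₁ - 1 := by ring
  rw [h21, Complex.ofReal_one, Complex.one_cpow, Complex.ofReal_zero, Complex.zero_cpow hne] at hI
  rw [this, intervalIntegral.integral_mul_const, hI]
  have := H.one_sub_t_ne
  field_simp
  ring

theorem kSer_zero (hy : ‖x₂‖ < ‖y‖) : H.kSer 0 x₂ y = (y - x₂)⁻¹ := by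
  have hy0 : 0 < ‖y‖ := (norm_nonneg _).trans_lt hy
  have hy1 : y ≠ 0 := norm_pos_iff.mp hy0
  rw [kSer, pser_zero, pser]
  simp only [lCoef_zero, ← mul_pow]
  rw [tsum_geometric_of_norm_lt_one, ← mul_inv, mul_sub, mul_one, mul_left_comm,
    mul_inv_cancel₀ hy1, mul_one]
  rw [norm_mul, norm_inv, ← div_eq_mul_inv, div_lt_one hy0]
  exact hy

/-- The identification of the kernel with the one-dimensional integral for large `y`. -/
theorem Ctl.kSer_eq (hs : 1 < H.s₁.re) (hc : H.Ctl ε r C) (hM : H.StructBound M)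
    (hε : ε ≤ 1 / (4 * M)) (h1 : ‖x₁‖ < ε / 2) (h2 : ‖x₂‖ < ε) (hy : 2 + ‖H.t‖ < ‖y‖) :
    H.kSer x₁ x₂ y = (H.s₁ - 1) / (1 - H.t) * H.rInt x₁ x₂ y := by
  have hM0 := hM.pos
  have hM1 := hM.1
  have ht := norm_nonneg H.t
  have hx₂ : M * ‖x₂‖ ≤ 1 / 2 := by
    have : ‖x₂‖ ≤ 1 / (4 * M) := (h2.trans_le hε).le
    calc M * ‖x₂‖ ≤ M * (1 / (4 * M)) := by gcongr
      _ = 1 / 4 := by field_simp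
      _ ≤ 1 / 2 := by norm_num
  obtain ⟨Sx, Sxx, Sy, Syy, κ, hK⟩ := hM.heunPair hx₂
  have hK' : H.HeunPair ε (2 + ‖H.t‖) (fun x y => H.kSer x x₂ y) Sx Sxx Sy Syy κ :=
    ⟨fun x y hx hy => hK.hx x y (hx.trans_le hε) (by linarith),
     fun x y hx hy => hK.hxx x y (hx.trans_le hε) (by linarith),
     fun x y hx hy => hK.hy x y (hx.trans_le hε) (by linarith),
     fun x y hx hy => hK.hyy x y (hx.trans_le hε) (by linarith),
     fun x y hx hy => hK.pde x y (hx.trans_le hε) (by linarith)⟩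
  have hdom : ∀ x y : ℂ, ‖x‖ < ε → 2 + ‖H.t‖ < ‖y‖ → Dom ε x x₂ y := fun x y hx hy =>
    Dom.of_one_lt hc.pos hx h2 (by linarith)
  have hR : H.HeunPair ε (2 + ‖H.t‖) (fun x y => H.rInt x x₂ y) (fun x y => H.rIntX x x₂ y)
      (fun x y => H.rIntXX x x₂ y) (fun x y => H.rIntY x x₂ y) (fun x y => H.rIntYY x x₂ y)
      (fun x => -(1 - H.t) * pser (dcoef H.hc) (H.u x x₂)) :=
    ⟨fun x y hx hy => (hc.hasDerivAt_rInt_x hs (hdom x y hx hy)).2.2.2.1,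
     fun x y hx hy => (hc.hasDerivAt_rInt_x hs (hdom x y hx hy)).2.2.2.2,
     fun x y hx hy => (hc.hasDerivAt_rInt_y hs (hdom x y hx hy)).2.2.2.1,
     fun x y hx hy => (hc.hasDerivAt_rInt_y hs (hdom x y hx hy)).2.2.2.2,
     fun x y hx hy => by
      refine hc.pde_rInt hs (hdom x y hx hy) ?_ ?_ <;> intro h <;>
        rw [sub_eq_zero.mp h] at hy
      · rw [norm_one] at hy; linarith
      · linarith⟩
  have hD := hK'.sub_const_mul hR ((H.s₁ - 1) / (1 - H.t))
  have hbK : ∀ x y : ℂ, ‖x‖ < ε → 2 + ‖H.t‖ < ‖y‖ → ‖H.kSer x x₂ y‖ ≤ 8 / ‖y‖ := by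
    intro x y hx hy
    have hη : ‖y⁻¹‖ ≤ 1 / 2 := by
      rw [norm_inv, one_div]
      exact inv_anti₀ two_pos (by linarith)
    have hin : ∀ n, ‖pser (H.lCoef x₂ n) y⁻¹‖ ≤ 4 * M ^ n := by
      intro n
      refine (norm_pser_le_of_bounded (hM.norm_lCoef_le hx₂ n) (hη.trans_lt (by norm_num))).trans ?_
      rw [div_le_iff₀ (by linarith)]
      have : 0 < M ^ n := by positivity
      nlinarith
    have hMx : M * ‖x‖ ≤ 1 / 2 := by
      calc M * ‖x‖ ≤ M * (1 / (4 * M)) := by gcongr; exact (hx.trans_le hε).le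
        _ = 1 / 4 := by field_simp
        _ ≤ 1 / 2 := by norm_num
    rw [kSer, norm_mul, norm_inv, inv_mul_eq_div]
    gcongr
    have : ‖pser (fun n => pser (H.lCoef x₂ n) y⁻¹) x‖ ≤ 4 * 2 := by
      refine tsum_of_norm_bounded (hasSum_geometric_two.mul_left 4) fun n => ?_
      rw [norm_mul, norm_pow]
      calc _ ≤ 4 * M ^ n * ‖x‖ ^ n := by gcongr; exact hin n
        _ = 4 * (M * ‖x‖) ^ n := by rw [mul_pow, mul_assoc]
        _ ≤ _ := by gcongr
    linarith
  have := hD.eq_zero (B := 8 + ‖(H.s₁ - 1) / (1 - H.t)‖ *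
      ((∫ q in (0 : ℝ)..1, ‖(q : ℂ) ^ (H.s₁ - 2)‖) * C)) hc.pos (by linarith) ?_ ?_ h1 hy
  · exact sub_eq_zero.mp this
  · intro x y hx hy
    refine (norm_sub_le _ _).trans ?_
    rw [norm_mul, add_div, mul_div_assoc]
    gcongr
    · exact hbK x y hx hy
    · exact hc.norm_rInt_le hs (hdom x y hx hy)
  · intro y hy
    have h0 : ‖(0 : ℂ)‖ < ε := by rw [norm_zero]; exact hc.pos
    have h3 : ‖x₂‖ < ‖y‖ := by
      have : 1 / (4 * M) ≤ 1 := by rw [div_le_one (by positivity)]; linarith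
      linarith
    rw [hc.rInt_zero hs (hdom 0 y h0 hy), kSer_zero h3, sub_self]

theorem isPreconnected_dom_y (ε : ℝ) (x₁ x₂ : ℂ) : IsPreconnected {y | Dom ε x₁ x₂ y} := by
  by_cases hx : ‖x₁‖ < ε ∧ ‖x₂‖ < ε
  · have hε : 0 < ε := (norm_nonneg _).trans_lt hx.1
    have e : {y | Dom ε x₁ x₂ y} = (fun p : ℝ × ℝ => (p.1 : ℂ) * Complex.exp (p.2 * Complex.I)) ''
        (Set.Ioi (max ‖x₁‖ ‖x₂‖ / ε) ×ˢ Set.univ) := by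
      ext y
      simp only [Set.mem_ofPred_eq, Set.mem_image, Set.mem_prod, Set.mem_Ioi, Set.mem_univ, and_true,
        Prod.exists, Dom, hx.1, hx.2, true_and]
      constructor
      · rintro ⟨h1, h2⟩
        refine ⟨‖y‖, y.arg, ?_, Complex.norm_mul_exp_arg_mul_I y⟩
        rw [div_lt_iff₀' hε]
        exact max_lt h1 h2
      · rintro ⟨a, b, hab, rfl⟩
        rw [div_lt_iff₀' hε] at hab
        have ha : 0 < a := by
          have := ((norm_nonneg x₁).trans (le_max_left _ _)).trans_lt hab
          exact pos_of_mul_pos_right this hε.le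
        rw [norm_mul, Complex.norm_exp_ofReal_mul_I, mul_one, Complex.norm_real,
          Real.norm_of_nonneg ha.le]
        exact ⟨(le_max_left _ _).trans_lt hab, (le_max_right _ _).trans_lt hab⟩
    rw [e]
    refine IsPreconnected.image ?_ _ (by fun_prop)
    exact ((convex_Ioi _).prod convex_univ).isPreconnected
  · have : {y | Dom ε x₁ x₂ y} = ∅ := by
      ext y
      simp only [Set.mem_ofPred_eq, Set.mem_empty_iff_false, iff_false]
      exact fun h => hx ⟨h.1, h.2.1⟩
    rw [this]
    exact isPreconnected_empty

/-- The one-dimensional integral representation. -/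
theorem Ctl.kernel_eq (hs : 1 < H.s₁.re) (hc : H.Ctl ε r C) (hM : H.StructBound M)
    (hε : ε ≤ 1 / (4 * M)) (h1 : ‖x₁‖ < ε / 2) (hd : Dom ε x₁ x₂ y) :
    H.kernel x₁ x₂ y = (H.s₁ - 1) / (1 - H.t) * H.rInt x₁ x₂ y := by
  have hM0 := hM.pos
  have hε' : 2 * M * ε ≤ 1 / 2 := by
    calc 2 * M * ε ≤ 2 * M * (1 / (4 * M)) := by gcongr
      _ = 1 / 2 := by field_simp; norm_num
  have hopen := isOpen_dom_y ε x₁ x₂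
  have hK : AnalyticOnNhd ℂ (fun y => H.kernel x₁ x₂ y) {y | Dom ε x₁ x₂ y} :=
    (hM.differentiableOn_kernel hε').analyticOnNhd hopen
  have hR : AnalyticOnNhd ℂ (fun y => (H.s₁ - 1) / (1 - H.t) * H.rInt x₁ x₂ y)
      {y | Dom ε x₁ x₂ y} := by
    refine DifferentiableOn.analyticOnNhd (fun y hy => ?_) hopen
    exact (((hc.hasDerivAt_rInt_y hs hy).2.2.2.1.const_mul _).differentiableAt).differentiableWithinAt
  set y₀ : ℂ := ((3 + ‖H.t‖ : ℝ) : ℂ) with hy₀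
  have hn0 : ‖y₀‖ = 3 + ‖H.t‖ := by
    rw [hy₀, Complex.norm_real, Real.norm_of_nonneg (by positivity)]
  have hy0 : y₀ ∈ {y | Dom ε x₁ x₂ y} :=
    Dom.of_one_lt hc.pos hd.1 hd.2.1 (by rw [hn0]; linarith [norm_nonneg H.t])
  refine hK.eqOn_of_preconnected_of_eventuallyEq hR (isPreconnected_dom_y ε x₁ x₂) hy0 ?_ hd
  have hnhds : {y : ℂ | 2 + ‖H.t‖ < ‖y‖} ∈ 𝓝 y₀ :=
    (isOpen_lt continuous_const continuous_norm).mem_nhds (by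
      change 2 + ‖H.t‖ < ‖y₀‖
      rw [hn0]; linarith)
  filter_upwards [hnhds, hopen.mem_nhds hy0] with z hz hz'
  rw [hM.kernel_eq_kSer hε' hz', hc.kSer_eq hs hM hε h1 hd.2.1 hz]

end HeunParams

end

noncomputable section

namespace HeunParams

open Filter Topology MeasureTheory

variable {H : HeunParams} {ε r C M δ : ℝ} {x₁ x₂ y : ℂ}

theorem Dom.mono {ε' : ℝ} (h : ε' ≤ ε) (hd : Dom ε' x₁ x₂ y) : Dom ε x₁ x₂ y := by
  have : ε' * ‖y‖ ≤ ε * ‖y‖ := by gcongr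
  exact ⟨hd.1.trans_le h, hd.2.1.trans_le h, hd.2.2.1.trans_le this, hd.2.2.2.trans_le this⟩

theorem Ctl.mono {ε' : ℝ} (h : ε' ≤ ε) (h0 : 0 < ε') (hc : H.Ctl ε r C) : H.Ctl ε' r C where
  pos := h0
  r_le := hc.r_le
  sumOn := hc.sumOn
  good x₁ x₂ y q hd := hc.good x₁ x₂ y q (hd.mono h)
  norm_le x₁ x₂ y q hd := hc.norm_le x₁ x₂ y q (hd.mono h)
  flux_one x₁ x₂ y hd := hc.flux_one x₁ x₂ y (hd.mono h)
  fC_zero x₂ y q hd := hc.fC_zero x₂ y q (hd.mono h)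

variable (H) in
/-- There is a range of the variables where all quantities are controlled and the kernel is given
by the one-dimensional integral. -/
theorem exists_region (hs : 1 < H.s₁.re) {δ : ℝ} (hδ : 0 < δ) : ∃ ε r C : ℝ, H.Ctl ε r C ∧
    ∀ x₁ x₂ y, Dom ε x₁ x₂ y → (∀ q, ‖q‖ ≤ 1 → H.Near δ x₁ x₂ y q) ∧
      Summable (H.kernelTerm x₁ x₂ y) ∧
      H.kernel x₁ x₂ y = (H.s₁ - 1) / (1 - H.t) * H.rInt x₁ x₂ y := by
  obtain ⟨ε, r, C, hc, -, hnear⟩ := H.exists_ctl hs hδ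
  obtain ⟨M, hM⟩ := H.exists_structConst_bound hs
  have hM' : H.StructBound M := hM
  have hM0 := hM'.pos
  have h4 : 0 < 1 / (4 * M) := by positivity
  have h0 : 0 < min ε (1 / (4 * M)) := lt_min hc.pos h4
  have hle : min ε (1 / (4 * M)) / 2 ≤ min ε (1 / (4 * M)) := by linarith
  refine ⟨min ε (1 / (4 * M)) / 2, r, C, hc.mono (hle.trans (min_le_left _ _)) (by linarith),
    fun x₁ x₂ y hd => ⟨fun q => hnear x₁ x₂ y q (hd.mono (hle.trans (min_le_left _ _))), ?_, ?_⟩⟩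
  · refine hM'.summable_kernelTerm ?_ (hd.mono hle)
    calc 2 * M * min ε (1 / (4 * M)) ≤ 2 * M * (1 / (4 * M)) := by gcongr; exact min_le_right _ _
      _ = 1 / 2 := by field_simp; norm_num
  · exact (hc.mono (min_le_left _ _) h0).kernel_eq hs hM' (min_le_right _ _) hd.1 (hd.mono hle)

section Conversion

variable (H x₁ x₂ y)

theorem disc_eq_Q (q : ℝ) : disc (H.zC x₁ x₂ q) (H.v x₁ x₂ y) (H.w x₁ x₂ y) = H.Q x₁ x₂ y q := by
  rw [disc, Q, zC]
  ring

theorem sqrtQ_eq (q : ℝ) : H.sqrtQ x₁ x₂ y q = H.rtC x₁ x₂ y q := by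
  rw [sqrtQ, rtC, rootDisc, disc_eq_Q, one_div_div]

theorem A_eq (q : ℝ) : H.A x₁ x₂ y q = 2 * H.aC x₁ x₂ y q := by
  rw [A, sqrtQ_eq, aC, rootA, zC]
  ring

theorem B_eq (q : ℝ) : H.B x₁ x₂ y q = 2 * H.bC x₁ x₂ y q := by
  rw [B, sqrtQ_eq, bC, rootB, zC]
  ring

end Conversion

theorem branchPow_eq {ℓ z : ℂ} (hz : z ≠ 0) (e : ℂ) :
    branchPow ℓ z e = Complex.exp (e * ℓ) * (z / Complex.exp ℓ) ^ e := by
  rw [branchPow, Complex.cpow_def_of_ne_zero (div_ne_zero hz (Complex.exp_ne_zero _)),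
    ← Complex.exp_add]
  ring_nf

theorem Ctl.continuousOn_sqrtQ (hc : H.Ctl ε r C) (h1 : ‖x₁‖ < ε) (h2 : ‖x₂‖ < ε) {q : ℝ}
    (hq : q ∈ Set.Icc (0 : ℝ) 1) : ContinuousOn (fun y => H.sqrtQ x₁ x₂ y q)
      {y | ‖x₁‖ < ε * ‖y‖ ∧ ‖x₂‖ < ε * ‖y‖} := by
  intro y hy
  refine ContinuousAt.continuousWithinAt ?_
  simp only [sqrtQ_eq]
  exact (Good.hasDerivAt_path (hasDerivAt_const y x₁) (hasDerivAt_id y)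
    (hasDerivAt_const y (q : ℂ)) (hc.good x₁ x₂ y q ⟨h1, h2, hy⟩ (norm_ofReal_le_one hq))
    rfl rfl rfl).2.2.1.continuousAt

theorem v_sub_w (H : HeunParams) (x₁ x₂ : ℂ) {y : ℂ} (hy : y ≠ 0) :
    H.v x₁ x₂ y - H.w x₁ x₂ y = y / (1 - H.t) *
      (1 - H.u x₁ x₂ + (1 - H.t) * (H.v x₁ x₂ 0 - H.w x₁ x₂ 0) * y⁻¹) := by
  have h1 := H.t_ne_zero
  have h2 := H.t_sub_one_ne
  have h3 := H.one_sub_t_ne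
  simp only [v, w, u]
  field_simp
  ring

theorem tendsto_sqrtQ (H : HeunParams) (x₁ x₂ : ℂ) (hu : ‖H.u x₁ x₂‖ < 1) (q : ℝ) :
    Tendsto (fun y => H.sqrtQ x₁ x₂ y q / (H.v x₁ x₂ y - H.w x₁ x₂ y))
      (Bornology.cobounded ℂ) (𝓝 1) := by
  have hre : 0 < (1 - H.u x₁ x₂).re := by
    have := (Complex.re_le_norm (H.u x₁ x₂)).trans_lt hu
    simp only [Complex.sub_re, Complex.one_re]
    linarith
  have hne : 1 - H.u x₁ x₂ ≠ 0 := fun h => by simp [h] at hre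
  have hroot : ((1 - H.u x₁ x₂) ^ 2) ^ (1 / 2 : ℂ) = 1 - H.u x₁ x₂ := by
    have harg := Complex.abs_arg_lt_pi_div_two_iff.mpr (Or.inl hre)
    rw [abs_lt] at harg
    have := Complex.pow_cpow_nat_inv (n := 2) (x := 1 - H.u x₁ x₂) (by norm_num)
      (by push_cast; linarith) (by push_cast; linarith)
    simpa using this
  have hmem : (1 - H.u x₁ x₂) ^ 2 ∈ Complex.slitPlane := by
    rw [Complex.mem_slitPlane_iff]
    by_cases him : (1 - H.u x₁ x₂).im = 0
    · left
      rw [pow_two, Complex.mul_re, him]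
      nlinarith
    · right
      rw [pow_two, Complex.mul_im]
      intro h
      exact (mul_ne_zero hre.ne' him) (by linarith)
  have hinv : Tendsto (fun y : ℂ => y⁻¹) (Bornology.cobounded ℂ) (𝓝 0) :=
    tendsto_inv₀_cobounded
  have hcont : Continuous fun s : ℂ => H.gQ x₁ x₂ (x₁ * s) (x₂ * s) q := by
    simp only [gQ, g₁, S₀, S₁, u]
    fun_prop
  have h0 : H.gQ x₁ x₂ (x₁ * 0) (x₂ * 0) q = (1 - H.u x₁ x₂) ^ 2 := by
    simp [gQ, g₁]
  have hg : Tendsto (fun y => H.gQ x₁ x₂ (x₁ / y) (x₂ / y) q ^ (1 / 2 : ℂ))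
      (Bornology.cobounded ℂ) (𝓝 (1 - H.u x₁ x₂)) := by
    have h1 := (hcont.tendsto 0).comp hinv
    rw [h0] at h1
    have h2 := (continuousAt_cpow_const (b := (1 / 2 : ℂ)) hmem).tendsto.comp h1
    rw [hroot] at h2
    refine h2.congr fun y => ?_
    simp [div_eq_mul_inv]
  have hd : Tendsto (fun y : ℂ =>
      1 - H.u x₁ x₂ + (1 - H.t) * (H.v x₁ x₂ 0 - H.w x₁ x₂ 0) * y⁻¹)
      (Bornology.cobounded ℂ) (𝓝 (1 - H.u x₁ x₂)) := by
    simpa using (hinv.const_mul ((1 - H.t) * (H.v x₁ x₂ 0 - H.w x₁ x₂ 0))).const_add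
      (1 - H.u x₁ x₂)
  have := hg.div hd hne
  rw [div_self hne] at this
  refine this.congr' ?_
  filter_upwards [Filter.le_cofinite_iff_eventually_ne.mp (Bornology.le_cofinite ℂ) 0] with y hy
  rw [sqrtQ_eq, H.rtC_eq_gQ x₁ x₂ hy, v_sub_w H x₁ x₂ hy,
    Pi.div_apply, mul_div_mul_left _ _ (div_ne_zero hy H.one_sub_t_ne)]

theorem Good.integrand₁_eq {q : ℝ} {ℓ₂ ℓ₃ : ℂ} (h : H.Good r x₁ x₂ y q)
    (e₂ : Complex.exp ℓ₂ = 2 * (x₁ - 1) * (x₂ - 1) / (1 - H.t))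
    (e₃ : Complex.exp ℓ₃ = 2 * (x₁ - H.t) * (x₂ - H.t) / (H.t * (H.t - 1))) :
    H.integrand₁ ℓ₂ ℓ₃ x₁ x₂ y q = Complex.exp ((H.s₂ - 1) * ℓ₂) * Complex.exp ((H.s₃ - 1) * ℓ₃)
      * ((q : ℂ) ^ (H.s₁ - 2) * H.fC x₁ x₂ y q) := by
  have a0 := h.a_ne
  have b0 := h.b_ne
  have ha : 2 * H.aC x₁ x₂ y q / Complex.exp ℓ₂ = H.aC x₁ x₂ y q / H.c₂ x₁ x₂ := by
    rw [e₂, c₂, mul_assoc, mul_div_assoc 2 (_ * _), mul_div_mul_left _ _ two_ne_zero]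
  have hb : 2 * H.bC x₁ x₂ y q / Complex.exp ℓ₃ = H.bC x₁ x₂ y q / H.c₃ x₁ x₂ := by
    rw [e₃, c₃, mul_assoc, mul_div_assoc 2 (_ * _), mul_div_mul_left _ _ two_ne_zero]
  rw [integrand₁, A_eq, B_eq, branchPow_eq (mul_ne_zero two_ne_zero a0),
    branchPow_eq (mul_ne_zero two_ne_zero b0), ha, hb, sqrtQ_eq, ordinaryHypergeometric_eq_pser,
    fC, eC, hc]
  ring

/-- The one-dimensional integral representation in terms of the chosen logarithms. -/
theorem Ctl.integrand₁ (hs : 1 < H.s₁.re) (hc : H.Ctl ε r C) (hd : Dom ε x₁ x₂ y) {ℓ₂ ℓ₃ : ℂ}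
    (e₂ : Complex.exp ℓ₂ = 2 * (x₁ - 1) * (x₂ - 1) / (1 - H.t))
    (e₃ : Complex.exp ℓ₃ = 2 * (x₁ - H.t) * (x₂ - H.t) / (H.t * (H.t - 1))) :
    IntervalIntegrable (H.integrand₁ ℓ₂ ℓ₃ x₁ x₂ y) volume 0 1 ∧
      Complex.exp ((1 - H.s₂) * ℓ₂) * Complex.exp ((1 - H.s₃) * ℓ₃)
        * ∫ q in (0 : ℝ)..1, H.integrand₁ ℓ₂ ℓ₃ x₁ x₂ y q = H.rInt x₁ x₂ y := by
  have hEq : Set.EqOn (fun q : ℝ => Complex.exp ((H.s₂ - 1) * ℓ₂) * Complex.exp ((H.s₃ - 1) * ℓ₃)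
      * ((q : ℂ) ^ (H.s₁ - 2) * H.fC x₁ x₂ y q)) (H.integrand₁ ℓ₂ ℓ₃ x₁ x₂ y)
      (Set.uIcc 0 1) := by
    intro q hq
    rw [Set.uIcc_of_le zero_le_one] at hq
    exact ((hc.good x₁ x₂ y q hd (norm_ofReal_le_one hq)).integrand₁_eq e₂ e₃).symm
  refine ⟨?_, ?_⟩
  · exact ((hc.hasDerivAt_rInt_x hs hd).1.const_mul _).congr
      fun q hq => hEq (Set.uIoc_subset_uIcc hq)
  · rw [← intervalIntegral.integral_congr hEq, intervalIntegral.integral_const_mul, rInt,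
      ← mul_assoc, ← Complex.exp_add, ← Complex.exp_add, ← Complex.exp_add]
    ring_nf
    simp

end HeunParams

end

noncomputable section

namespace HeunParams

open Filter Topology MeasureTheory

theorem choose_add_sub_one (a : ℂ) (n : ℕ) :
    Ring.choose (a + n - 1) n = (n.factorial : ℂ)⁻¹ * (ascPochhammer ℂ n).eval a := by
  have h := Ring.factorial_nsmul_multichoose_eq_ascPochhammer a n
  rw [Polynomial.ascPochhammer_smeval_eq_eval, Ring.multichoose_eq, nsmul_eq_mul] at h
  rw [← h, inv_mul_cancel_left₀ (by exact_mod_cast n.factorial_ne_zero)]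

theorem betaIntegral_add_one {u v : ℂ} (hu : 0 < u.re) (hv : 0 < v.re) :
    Complex.betaIntegral (u + 1) v * (u + v) = Complex.betaIntegral u v * u := by
  have hu0 : u ≠ 0 := fun h => by simp [h] at hu
  have huv : u + v ≠ 0 := fun h => by
    have := congrArg Complex.re h
    simp only [Complex.add_re, Complex.zero_re] at this
    linarith
  have hg : Complex.Gamma (u + v) ≠ 0 :=
    Complex.Gamma_ne_zero_of_re_pos (by simp only [Complex.add_re]; linarith)
  rw [Complex.betaIntegral_eq_Gamma_mul_div _ _ (by simp only [Complex.add_re, Complex.one_re]; linarith) hv,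
    Complex.betaIntegral_eq_Gamma_mul_div _ _ hu hv, Complex.Gamma_add_one _ hu0,
    add_right_comm, Complex.Gamma_add_one _ huv]
  field_simp

theorem betaIntegral_add_natCast {u v : ℂ} (hu : 0 < u.re) (hv : 0 < v.re) (n : ℕ) :
    Complex.betaIntegral (u + n) v * (ascPochhammer ℂ n).eval (u + v) =
      Complex.betaIntegral u v * (ascPochhammer ℂ n).eval u := by
  induction n with
  | zero => simp
  | succ n ih =>
    have hun : 0 < (u + n).re := by
      simp only [Complex.add_re, Complex.natCast_re]
      positivity
    have h1 := betaIntegral_add_one hun hv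
    simp only [ascPochhammer_succ_eval]
    push_cast
    rw [← add_assoc]
    linear_combination (ascPochhammer ℂ n).eval (u + v) * h1 + (u + n) * ih

theorem ascPochhammer_eval_ne {c : ℂ} (hc : 0 < c.re) (n : ℕ) :
    (ascPochhammer ℂ n).eval c ≠ 0 := by
  induction n with
  | zero => simp
  | succ n ih =>
    rw [ascPochhammer_succ_eval]
    exact mul_ne_zero ih (add_natCast_ne hc n)

theorem hasSum_one_sub_cpow (a : ℂ) {z : ℂ} (hz : ‖z‖ < 1) :
    Summable (fun n : ℕ => ‖Ring.choose (a + n - 1) n * z ^ n‖) ∧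
      HasSum (fun n : ℕ => Ring.choose (a + n - 1) n * z ^ n) ((1 - z) ^ (-a)) := by
  have hf := Complex.one_div_one_sub_cpow_hasFPowerSeriesOnBall_zero a
  have hz' : z ∈ Metric.eball (0 : ℂ) 1 := by
    rw [Metric.mem_eball, edist_zero_right, ← ofReal_norm]
    exact ENNReal.ofReal_lt_one.mpr hz
  have h1 := FormalMultilinearSeries.summable_norm_apply _ (Metric.eball_subset_eball hf.r_le hz')
  have h2 := hf.hasSum hz'
  simp only [FormalMultilinearSeries.ofScalars_apply_eq, smul_eq_mul, zero_add] at h1 h2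
  refine ⟨h1, ?_⟩
  rwa [Complex.cpow_neg, ← one_div]

/-- Euler's integral for the hypergeometric function. -/
theorem euler_integral (a : ℂ) {b c z : ℂ} (hb : 0 < b.re) (hbc : b.re < c.re) (hz : ‖z‖ < 1) :
    ∫ p in (0 : ℝ)..1, (p : ℂ) ^ (b - 1) * (1 - (p : ℂ)) ^ (c - b - 1) * (1 - p * z) ^ (-a) =
      Complex.betaIntegral b (c - b) * pser (hypCoef b a c) z := by
  have hcb : 0 < (c - b).re := by
    rw [Complex.sub_re]
    linarith
  have hc : 0 < c.re := hb.trans hbc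
  obtain ⟨hsum, -⟩ := hasSum_one_sub_cpow a hz
  have hint := Complex.betaIntegral_convergent hb hcb
  have hbn : ∀ n : ℕ, 0 < (b + n).re := fun n => by
    simp only [Complex.add_re, Complex.natCast_re]
    positivity
  have key := intervalIntegral.hasSum_integral_of_dominated_convergence (μ := volume)
    (a := 0) (b := 1)
    (F := fun (n : ℕ) (p : ℝ) => Ring.choose (a + n - 1) n * z ^ n *
      ((p : ℂ) ^ (b + n - 1) * (1 - (p : ℂ)) ^ (c - b - 1)))
    (f := fun p : ℝ => (p : ℂ) ^ (b - 1) * (1 - (p : ℂ)) ^ (c - b - 1) * (1 - p * z) ^ (-a))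
    (fun n p => ‖Ring.choose (a + n - 1) n * z ^ n‖ *
      ‖(p : ℂ) ^ (b - 1) * (1 - (p : ℂ)) ^ (c - b - 1)‖) ?_ ?_ ?_ ?_ ?_
  · rw [← key.tsum_eq, pser, ← tsum_mul_left]
    refine tsum_congr fun n => ?_
    have h := betaIntegral_add_natCast hb hcb n
    rw [add_sub_cancel] at h
    rw [intervalIntegral.integral_const_mul, ← Complex.betaIntegral, hypCoef,
      ordinaryHypergeometricCoefficient, choose_add_sub_one]
    have := ascPochhammer_eval_ne hc n
    have hn : (n.factorial : ℂ) ≠ 0 := by exact_mod_cast n.factorial_ne_zero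
    field_simp
    linear_combination (z ^ n * (ascPochhammer ℂ n).eval a) * h
  · intro n
    have := (Complex.betaIntegral_convergent (hbn n) hcb).const_mul (Ring.choose (a + n - 1) n * z ^ n)
    rw [Set.uIoc_of_le zero_le_one]
    exact ((intervalIntegrable_iff_integrableOn_Ioc_of_le zero_le_one).mp this).aestronglyMeasurable
  · refine fun n => Eventually.of_forall fun p hp => ?_
    rw [Set.uIoc_of_le zero_le_one] at hp
    have hp0 : (p : ℂ) ≠ 0 := by exact_mod_cast hp.1.ne'
    rw [add_sub_right_comm b, Complex.cpow_add _ _ hp0, Complex.cpow_natCast, norm_mul]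
    refine mul_le_mul_of_nonneg_left ?_ (norm_nonneg _)
    rw [mul_right_comm, norm_mul _ ((p : ℂ) ^ n)]
    refine mul_le_of_le_one_right (norm_nonneg _) ?_
    rw [norm_pow]
    exact pow_le_one₀ (norm_nonneg _) (norm_ofReal_le_one ⟨hp.1.le, hp.2⟩)
  · exact Eventually.of_forall fun p _ => hsum.mul_right _
  · simp only [tsum_mul_right]
    exact hint.norm.const_mul _
  · refine Eventually.of_forall fun p hp => ?_
    rw [Set.uIoc_of_le zero_le_one] at hp
    have hp0 : (p : ℂ) ≠ 0 := by exact_mod_cast hp.1.ne'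
    have hpz : ‖(p : ℂ) * z‖ < 1 := by
      rw [norm_mul]
      exact (mul_le_of_le_one_left (norm_nonneg _)
        (norm_ofReal_le_one ⟨hp.1.le, hp.2⟩)).trans_lt hz
    refine ((hasSum_one_sub_cpow a hpz).2.mul_left
      ((p : ℂ) ^ (b - 1) * (1 - (p : ℂ)) ^ (c - b - 1))).congr_fun fun n => ?_
    rw [add_sub_right_comm b, Complex.cpow_add _ _ hp0, Complex.cpow_natCast]
    ring

end HeunParams

end

noncomputable section

namespace HeunParams

open Filter Topology MeasureTheory

variable {H : HeunParams} {r δ : ℝ} {x₁ x₂ y : ℂ} {p q : ℝ} {ℓ₁ ℓ₂ ℓ₃ : ℂ}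

variable (H) in
/-- `1 - p q u`. -/
def nC (x₁ x₂ p q : ℂ) : ℂ := 1 - p * q * H.u x₁ x₂

theorem q₁_eq (H : HeunParams) (x₁ x₂ y : ℂ) (p q : ℝ) :
    H.q₁ x₁ x₂ y p q = H.aC x₁ x₂ y q / H.nC x₁ x₂ p q := by
  rw [HeunParams.q₁, A_eq, mul_div_mul_left _ _ two_ne_zero, nC]

theorem q₂_eq (H : HeunParams) (x₁ x₂ y : ℂ) (p q : ℝ) :
    H.q₂ x₁ x₂ y p q = H.bC x₁ x₂ y q / H.nC x₁ x₂ p q := by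
  rw [HeunParams.q₂, B_eq, mul_div_mul_left _ _ two_ne_zero, nC]

theorem hasDerivAt_nC_left (H : HeunParams) (x₁ x₂ p q : ℂ) :
    HasDerivAt (fun p => H.nC x₁ x₂ p q) (-(q * H.u x₁ x₂)) p := by
  have := (((hasDerivAt_id p).mul_const q).mul_const (H.u x₁ x₂)).const_sub 1
  simpa [nC] using this

theorem hasDerivAt_nC_right (H : HeunParams) (x₁ x₂ p q : ℂ) :
    HasDerivAt (fun q => H.nC x₁ x₂ p q) (-(p * H.u x₁ x₂)) q := by
  have := (((hasDerivAt_id q).const_mul p).mul_const (H.u x₁ x₂)).const_sub 1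
  simpa [nC] using this

/-- The Jacobian of `(p, q) ↦ (q₁, q₂)`. -/
theorem Good.pullback_eq (h : H.Good r x₁ x₂ y q) (hn : H.nC x₁ x₂ p q ≠ 0) (g : ℂ → ℂ → ℂ) :
    H.pullback x₁ x₂ y g (p, q) = g (H.q₁ x₁ x₂ y p q) (H.q₂ x₁ x₂ y p q) *
      (q * H.u x₁ x₂ ^ 2 * (H.aC x₁ x₂ y q * H.bC x₁ x₂ y q)
        / (H.rtC x₁ x₂ y q * H.nC x₁ x₂ p q ^ 3)) := by
  obtain ⟨-, -, -, ha, hb, -⟩ := Good.hasDerivAt_path (hasDerivAt_const (q : ℂ) x₁)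
    (hasDerivAt_const (q : ℂ) y) (hasDerivAt_id (q : ℂ)) h (Z' := -H.u x₁ x₂) (v' := 0) (w' := 0)
    (by rw [u]; ring) (by ring) (by ring)
  have hΔ := h.rt_ne
  have hroot := H.root_equation x₁ x₂ h.y_ne q
  have d1 : HasDerivAt (fun p : ℝ => H.q₁ x₁ x₂ y p q)
      (H.aC x₁ x₂ y q * (q * H.u x₁ x₂) / H.nC x₁ x₂ p q ^ 2) p := by
    simp only [q₁_eq]
    refine HasDerivAt.comp_ofReal (e := fun p => H.aC x₁ x₂ y q / H.nC x₁ x₂ p q) ?_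
    refine (((hasDerivAt_const (p : ℂ) (H.aC x₁ x₂ y q)).fun_div
      (H.hasDerivAt_nC_left x₁ x₂ p q) hn)).congr_deriv ?_
    ring
  have d2 : HasDerivAt (fun p : ℝ => H.q₂ x₁ x₂ y p q)
      (H.bC x₁ x₂ y q * (q * H.u x₁ x₂) / H.nC x₁ x₂ p q ^ 2) p := by
    simp only [q₂_eq]
    refine HasDerivAt.comp_ofReal (e := fun p => H.bC x₁ x₂ y q / H.nC x₁ x₂ p q) ?_
    refine (((hasDerivAt_const (p : ℂ) (H.bC x₁ x₂ y q)).fun_div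
      (H.hasDerivAt_nC_left x₁ x₂ p q) hn)).congr_deriv ?_
    ring
  have d3 : HasDerivAt (fun q : ℝ => H.q₁ x₁ x₂ y p q)
      (((-(H.aC x₁ x₂ y q + H.v x₁ x₂ y) * H.u x₁ x₂ / H.rtC x₁ x₂ y q) * H.nC x₁ x₂ p q + H.aC x₁ x₂ y q * (p * H.u x₁ x₂)) / H.nC x₁ x₂ p q ^ 2) q := by
    simp only [q₁_eq]
    refine HasDerivAt.comp_ofReal (e := fun q => H.aC x₁ x₂ y q / H.nC x₁ x₂ p q) ?_
    refine (ha.fun_div (H.hasDerivAt_nC_right x₁ x₂ p q) hn).congr_deriv ?_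
    simp only [aD, id]
    ring
  have d4 : HasDerivAt (fun q : ℝ => H.q₂ x₁ x₂ y p q)
      ((((H.bC x₁ x₂ y q + H.w x₁ x₂ y) * H.u x₁ x₂ / H.rtC x₁ x₂ y q) * H.nC x₁ x₂ p q + H.bC x₁ x₂ y q * (p * H.u x₁ x₂)) / H.nC x₁ x₂ p q ^ 2) q := by
    simp only [q₂_eq]
    refine HasDerivAt.comp_ofReal (e := fun q => H.bC x₁ x₂ y q / H.nC x₁ x₂ p q) ?_
    refine (hb.fun_div (H.hasDerivAt_nC_right x₁ x₂ p q) hn).congr_deriv ?_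
    simp only [bD, id]
    ring
  rw [pullback, d1.deriv, d2.deriv, d3.deriv, d4.deriv]
  congr 1
  field_simp
  linear_combination (q : ℂ) * H.u x₁ x₂ ^ 2 * H.nC x₁ x₂ p q * hroot

theorem log_eq_of_exp_eq {z S : ℂ} (h : z = Complex.exp S) (hS : |S.im| < 3) :
    Complex.log z = S := by
  have := Real.pi_gt_three
  rw [abs_lt] at hS
  rw [h, Complex.log_exp (by linarith) (by linarith)]

theorem abs_im_log_lt {z : ℂ} (h : ‖z - 1‖ < 1 / 2) : |(Complex.log z).im| < 3 / 4 := by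
  have := Complex.norm_log_one_add_half_le_self h.le
  rw [add_sub_cancel] at this
  have h2 := Complex.abs_im_le_norm (Complex.log z)
  linarith

theorem ne_zero_of_norm_sub_one_lt {z : ℂ} (h : ‖z - 1‖ < 1 / 2) : z ≠ 0 := by
  rintro rfl
  norm_num at h

variable (H) in
/-- The point `(p, q)` and the values of `a / c₂`, `b / c₃` for which all branches are principal. -/
structure Inner (r : ℝ) (x₁ x₂ y : ℂ) (p q : ℝ) : Prop where
  good : H.Good r x₁ x₂ y q
  p_mem : p ∈ Set.Ioo (0 : ℝ) 1
  q_mem : q ∈ Set.Ioo (0 : ℝ) 1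
  a_lt : ‖H.aC x₁ x₂ y q / H.c₂ x₁ x₂ - 1‖ < 1 / 2
  b_lt : ‖H.bC x₁ x₂ y q / H.c₃ x₁ x₂ - 1‖ < 1 / 2
  n_lt : ‖H.nC x₁ x₂ p q - 1‖ < 1 / 2

theorem Inner.n_ne (h : H.Inner r x₁ x₂ y p q) : H.nC x₁ x₂ p q ≠ 0 :=
  ne_zero_of_norm_sub_one_lt h.n_lt

section Point

variable (H x₁ x₂ y p q)

/-- Logarithm of `a / c₂`. -/
def lA : ℂ := Complex.log (H.aC x₁ x₂ y q / H.c₂ x₁ x₂)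
/-- Logarithm of `b / c₃`. -/
def lB : ℂ := Complex.log (H.bC x₁ x₂ y q / H.c₃ x₁ x₂)
/-- Logarithm of `1 - p q u`. -/
def lN : ℂ := Complex.log (H.nC x₁ x₂ p q)

end Point

theorem Inner.exp_lA (h : H.Inner r x₁ x₂ y p q) (e₂ : Complex.exp ℓ₂ = H.c₂ x₁ x₂) :
    Complex.exp (ℓ₂ + H.lA x₁ x₂ y q) = H.aC x₁ x₂ y q := by
  rw [Complex.exp_add, lA, Complex.exp_log (Complex.slitPlane_ne_zero h.good.a_mem), e₂,
    mul_div_cancel₀ _ h.good.c₂_ne]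

theorem Inner.exp_lB (h : H.Inner r x₁ x₂ y p q) (e₃ : Complex.exp ℓ₃ = H.c₃ x₁ x₂) :
    Complex.exp (ℓ₃ + H.lB x₁ x₂ y q) = H.bC x₁ x₂ y q := by
  rw [Complex.exp_add, lB, Complex.exp_log (Complex.slitPlane_ne_zero h.good.b_mem), e₃,
    mul_div_cancel₀ _ h.good.c₃_ne]

theorem Inner.exp_lN (h : H.Inner r x₁ x₂ y p q) :
    Complex.exp (H.lN x₁ x₂ p q) = H.nC x₁ x₂ p q := Complex.exp_log h.n_ne

theorem Inner.q₁_eq_exp (h : H.Inner r x₁ x₂ y p q) (e₂ : Complex.exp ℓ₂ = H.c₂ x₁ x₂) :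
    H.q₁ x₁ x₂ y p q = Complex.exp (ℓ₂ + (H.lA x₁ x₂ y q - H.lN x₁ x₂ p q)) := by
  rw [q₁_eq, ← add_sub_assoc, Complex.exp_sub, h.exp_lA e₂, h.exp_lN]

theorem Inner.q₂_eq_exp (h : H.Inner r x₁ x₂ y p q) (e₃ : Complex.exp ℓ₃ = H.c₃ x₁ x₂) :
    H.q₂ x₁ x₂ y p q = Complex.exp (ℓ₃ + (H.lB x₁ x₂ y q - H.lN x₁ x₂ p q)) := by
  rw [q₂_eq, ← add_sub_assoc, Complex.exp_sub, h.exp_lB e₃, h.exp_lN]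

theorem exp_log_ofReal (hp : 0 < p) : Complex.exp ((Real.log p : ℝ) : ℂ) = p := by
  rw [← Complex.ofReal_exp, Real.exp_log hp]

theorem Inner.one_sub_eq_exp (h : H.Inner r x₁ x₂ y p q)
    (e₁ : Complex.exp ℓ₁ = H.u x₁ x₂) :
    1 - H.q₁ x₁ x₂ y p q - H.q₂ x₁ x₂ y p q = Complex.exp (ℓ₁ +
      ((Real.log q : ℝ) + (Real.log (1 - p) : ℝ) - H.lN x₁ x₂ p q)) := by
  have hn := h.n_ne
  rw [Complex.exp_add, Complex.exp_sub, Complex.exp_add, exp_log_ofReal h.q_mem.1,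
    exp_log_ofReal (by linarith [h.p_mem.2]), h.exp_lN, e₁, q₁_eq, q₂_eq, sub_sub, ← add_div,
    aC_add_bC]
  field_simp
  rw [nC, zC]
  push_cast
  ring

theorem Inner.ratio_eq_exp (h : H.Inner r x₁ x₂ y p q) (e₁ : Complex.exp ℓ₁ = H.u x₁ x₂) :
    1 + H.v x₁ x₂ y / H.q₁ x₁ x₂ y p q + H.w x₁ x₂ y / H.q₂ x₁ x₂ y p q =
      Complex.exp (ℓ₁ + ((Real.log p : ℝ) + (Real.log q : ℝ))) := by
  have hn := h.n_ne
  have ha := h.good.a_ne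
  have hb := h.good.b_ne
  have hroot := H.root_equation x₁ x₂ h.good.y_ne q
  rw [Complex.exp_add, Complex.exp_add, exp_log_ofReal h.q_mem.1,
    exp_log_ofReal h.p_mem.1, e₁, q₁_eq, q₂_eq]
  field_simp
  rw [nC] at *
  linear_combination (1 - p * q * H.u x₁ x₂) * hroot

theorem branchPow_exp {S : ℂ} (ℓ e : ℂ) (hS : |S.im| < 3) :
    branchPow ℓ (Complex.exp (ℓ + S)) e = Complex.exp (e * (ℓ + S)) := by
  rw [branchPow, ← Complex.exp_sub, add_sub_cancel_left, log_eq_of_exp_eq rfl hS]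

theorem Inner.im_bounds (h : H.Inner r x₁ x₂ y p q) : |(H.lA x₁ x₂ y q).im| < 3 / 4 ∧
    |(H.lB x₁ x₂ y q).im| < 3 / 4 ∧ |(H.lN x₁ x₂ p q).im| < 3 / 4 :=
  ⟨abs_im_log_lt h.a_lt, abs_im_log_lt h.b_lt, abs_im_log_lt h.n_lt⟩

theorem Inner.integrand₂_eq (h : H.Inner r x₁ x₂ y p q) (e₁ : Complex.exp ℓ₁ = H.u x₁ x₂)
    (e₂ : Complex.exp ℓ₂ = H.c₂ x₁ x₂) (e₃ : Complex.exp ℓ₃ = H.c₃ x₁ x₂) :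
    H.integrand₂ ℓ₁ ℓ₂ ℓ₃ x₁ x₂ y (H.q₁ x₁ x₂ y p q) (H.q₂ x₁ x₂ y p q) =
      Complex.exp ((H.s₂ - 2) * (ℓ₂ + (H.lA x₁ x₂ y q - H.lN x₁ x₂ p q))
        + (H.s₃ - 2) * (ℓ₃ + (H.lB x₁ x₂ y q - H.lN x₁ x₂ p q))
        + (H.s₁ - H.r₁ - 1) * (ℓ₁ +
          ((Real.log q : ℝ) + (Real.log (1 - p) : ℝ) - H.lN x₁ x₂ p q))
        + (H.r₁ - 2) * (ℓ₁ + ((Real.log p : ℝ) + (Real.log q : ℝ)))) := by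
  obtain ⟨hA, hB, hN⟩ := h.im_bounds
  rw [abs_lt] at hA hB hN
  rw [integrand₂, h.one_sub_eq_exp e₁, h.ratio_eq_exp e₁, h.q₁_eq_exp e₂, h.q₂_eq_exp e₃,
    branchPow_exp ℓ₂ _ (by simp only [Complex.sub_im, abs_lt]; constructor <;> linarith),
    branchPow_exp ℓ₃ _ (by simp only [Complex.sub_im, abs_lt]; constructor <;> linarith),
    branchPow_exp ℓ₁ _ (by
      simp only [Complex.sub_im, Complex.add_im, Complex.ofReal_im, abs_lt]
      constructor <;> linarith),
    branchPow_exp ℓ₁ _ (by simp), one_div, one_div, ← Complex.exp_neg, ← Complex.exp_neg]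
  simp only [← Complex.exp_add]
  ring_nf

theorem Inner.auxKernel_eq (h : H.Inner r x₁ x₂ y p q) (e₁ : Complex.exp ℓ₁ = H.u x₁ x₂)
    (e₂ : Complex.exp ℓ₂ = H.c₂ x₁ x₂) (e₃ : Complex.exp ℓ₃ = H.c₃ x₁ x₂) (m₁ m₂ m₃ : ℂ) :
    H.auxKernel m₁ m₂ m₃ ℓ₁ ℓ₂ ℓ₃ x₁ x₂ y (H.q₁ x₁ x₂ y p q) (H.q₂ x₁ x₂ y p q) =
      Complex.exp ((1 - H.s₁) * m₁) * Complex.exp ((1 - H.s₂) * m₂) * Complex.exp ((1 - H.s₃) * m₃)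
        * H.integrand₂ ℓ₁ ℓ₂ ℓ₃ x₁ x₂ y (H.q₁ x₁ x₂ y p q) (H.q₂ x₁ x₂ y p q) := by
  obtain ⟨hA, hB, hN⟩ := h.im_bounds
  rw [abs_lt] at hA hB hN
  have hlast : H.q₁ x₁ x₂ y p q * H.q₂ x₁ x₂ y p q + H.w x₁ x₂ y * H.q₁ x₁ x₂ y p q
      + H.v x₁ x₂ y * H.q₂ x₁ x₂ y p q = Complex.exp ((ℓ₁ + ℓ₂ + ℓ₃) +
        ((H.lA x₁ x₂ y q - H.lN x₁ x₂ p q) + (H.lB x₁ x₂ y q - H.lN x₁ x₂ p q)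
          + ((Real.log p : ℝ) + (Real.log q : ℝ)))) := by
    have hq₁ : H.q₁ x₁ x₂ y p q ≠ 0 := by rw [h.q₁_eq_exp e₂]; exact Complex.exp_ne_zero _
    have hq₂ : H.q₂ x₁ x₂ y p q ≠ 0 := by rw [h.q₂_eq_exp e₃]; exact Complex.exp_ne_zero _
    have e : H.q₁ x₁ x₂ y p q * H.q₂ x₁ x₂ y p q + H.w x₁ x₂ y * H.q₁ x₁ x₂ y p q
      + H.v x₁ x₂ y * H.q₂ x₁ x₂ y p q = H.q₁ x₁ x₂ y p q * H.q₂ x₁ x₂ y p q *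
        (1 + H.v x₁ x₂ y / H.q₁ x₁ x₂ y p q + H.w x₁ x₂ y / H.q₂ x₁ x₂ y p q) := by
      field_simp
      ring
    rw [e, h.ratio_eq_exp e₁, h.q₁_eq_exp e₂, h.q₂_eq_exp e₃, ← Complex.exp_add,
      ← Complex.exp_add]
    ring_nf
  rw [h.integrand₂_eq e₁ e₂ e₃, auxKernel, hlast, h.one_sub_eq_exp e₁, h.q₁_eq_exp e₂,
    h.q₂_eq_exp e₃,
    branchPow_exp ℓ₂ _ (by simp only [Complex.sub_im, abs_lt]; constructor <;> linarith),
    branchPow_exp ℓ₃ _ (by simp only [Complex.sub_im, abs_lt]; constructor <;> linarith),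
    branchPow_exp ℓ₁ _ (by
      simp only [Complex.sub_im, Complex.add_im, Complex.ofReal_im, abs_lt]
      constructor <;> linarith),
    branchPow_exp (ℓ₁ + ℓ₂ + ℓ₃) _ (by
      simp only [Complex.sub_im, Complex.add_im, Complex.ofReal_im, abs_lt]
      constructor <;> linarith)]
  simp only [← Complex.exp_add]
  ring_nf

theorem Inner.pullback_integrand₂ (h : H.Inner r x₁ x₂ y p q) (e₁ : Complex.exp ℓ₁ = H.u x₁ x₂)
    (e₂ : Complex.exp ℓ₂ = H.c₂ x₁ x₂) (e₃ : Complex.exp ℓ₃ = H.c₃ x₁ x₂) :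
    H.pullback x₁ x₂ y (H.integrand₂ ℓ₁ ℓ₂ ℓ₃ x₁ x₂ y) (p, q) =
      Complex.exp ((H.s₁ - 1) * ℓ₁) * Complex.exp ((H.s₂ - 1) * ℓ₂) * Complex.exp ((H.s₃ - 1) * ℓ₃)
        * ((p : ℂ) ^ (H.r₁ - 2) * (1 - (p : ℂ)) ^ (H.s₁ - H.r₁ - 1) * (q : ℂ) ^ (H.s₁ - 2)
        * (H.eC x₁ x₂ y q * H.nC x₁ x₂ p q ^ (1 - H.r₂))) := by
  have hp0 : (p : ℂ) ≠ 0 := by exact_mod_cast h.p_mem.1.ne'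
  have hq0 : (q : ℂ) ≠ 0 := by exact_mod_cast h.q_mem.1.ne'
  have hp1 : (0 : ℝ) < 1 - p := by linarith [h.p_mem.2]
  have hp1' : 1 - (p : ℂ) = ((1 - p : ℝ) : ℂ) := by push_cast; ring
  have hp10 : ((1 - p : ℝ) : ℂ) ≠ 0 := by exact_mod_cast hp1.ne'
  have hΔ := h.good.rt_ne
  have hL : Complex.exp ((H.s₂ - 2) * (ℓ₂ + (H.lA x₁ x₂ y q - H.lN x₁ x₂ p q))
        + (H.s₃ - 2) * (ℓ₃ + (H.lB x₁ x₂ y q - H.lN x₁ x₂ p q))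
        + (H.s₁ - H.r₁ - 1) * (ℓ₁ +
          ((Real.log q : ℝ) + (Real.log (1 - p) : ℝ) - H.lN x₁ x₂ p q))
        + (H.r₁ - 2) * (ℓ₁ + ((Real.log p : ℝ) + (Real.log q : ℝ)))) *
      (q * H.u x₁ x₂ ^ 2 * (H.aC x₁ x₂ y q * H.bC x₁ x₂ y q)) =
      Complex.exp ((H.s₁ - 1) * ℓ₁) * Complex.exp ((H.s₂ - 1) * ℓ₂) * Complex.exp ((H.s₃ - 1) * ℓ₃)
        * ((p : ℂ) ^ (H.r₁ - 2) * (1 - (p : ℂ)) ^ (H.s₁ - H.r₁ - 1) * (q : ℂ) ^ (H.s₁ - 2)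
        * ((H.aC x₁ x₂ y q / H.c₂ x₁ x₂) ^ (H.s₂ - 1) * (H.bC x₁ x₂ y q / H.c₃ x₁ x₂) ^ (H.s₃ - 1)
          * H.nC x₁ x₂ p q ^ (1 - H.r₂))) * H.nC x₁ x₂ p q ^ 3 := by
    rw [hp1', Complex.cpow_def_of_ne_zero hp0, Complex.cpow_def_of_ne_zero hq0,
      Complex.cpow_def_of_ne_zero hp10, Complex.cpow_def_of_ne_zero h.n_ne,
      Complex.cpow_def_of_ne_zero (Complex.slitPlane_ne_zero h.good.a_mem),
      Complex.cpow_def_of_ne_zero (Complex.slitPlane_ne_zero h.good.b_mem),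
      ← Complex.ofReal_log h.p_mem.1.le, ← Complex.ofReal_log h.q_mem.1.le,
      ← Complex.ofReal_log hp1.le, ← lA, ← lB, ← lN, ← h.exp_lA e₂, ← h.exp_lB e₃, ← e₁,
      ← h.exp_lN]
    rw [← exp_log_ofReal h.q_mem.1]
    simp only [← Complex.exp_nat_mul, ← Complex.exp_add]
    congr 1
    push_cast
    linear_combination H.lN x₁ x₂ p q * H.fuchs
  have hn := h.n_ne
  rw [h.good.pullback_eq hn, h.integrand₂_eq e₁ e₂ e₃, ← mul_div_assoc, hL, eC]
  field_simp

end HeunParams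

end

noncomputable section

namespace HeunParams

open Filter Topology MeasureTheory

variable {H : HeunParams} {ε r C δ : ℝ} {x₁ x₂ y : ℂ} {p q : ℝ} {ℓ₁ ℓ₂ ℓ₃ : ℂ}

theorem norm_nC_sub_one_lt (hu : ‖H.u x₁ x₂‖ < δ) (hp : p ∈ Set.Icc (0 : ℝ) 1)
    (hq : q ∈ Set.Icc (0 : ℝ) 1) : ‖H.nC x₁ x₂ p q - 1‖ < δ := by
  rw [nC, sub_sub_cancel_left, norm_neg, norm_mul, norm_mul]
  refine lt_of_le_of_lt (mul_le_of_le_one_left (norm_nonneg _) ?_) hu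
  exact mul_le_one₀ (norm_ofReal_le_one hp) (norm_nonneg _) (norm_ofReal_le_one hq)

theorem Ctl.inner (hc : H.Ctl ε r C) (hd : Dom ε x₁ x₂ y)
    (hn : ∀ q, ‖q‖ ≤ 1 → H.Near δ x₁ x₂ y q) (h1 : δ ≤ 1 / 2) (h2 : δ ≤ H.rad)
    (hp : p ∈ Set.Ioo (0 : ℝ) 1) (hq : q ∈ Set.Ioo (0 : ℝ) 1) : H.Inner r x₁ x₂ y p q := by
  have hq' := norm_ofReal_le_one (Set.Ioo_subset_Icc_self hq)
  have hδ : δ ≤ 1 := by linarith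
  exact
  { good := hc.good x₁ x₂ y q hd hq'
    p_mem := hp
    q_mem := hq
    a_lt := ((hn q hq').aC_lt hδ h2).trans_le h1
    b_lt := ((hn q hq').bC_lt hδ h2).trans_le h1
    n_lt := (norm_nC_sub_one_lt (hn q hq').u_lt (Set.Ioo_subset_Icc_self hp)
      (Set.Ioo_subset_Icc_self hq)).trans_le h1 }

theorem Good.continuousAt_eC (h : H.Good r x₁ x₂ y q) :
    ContinuousAt (fun q : ℝ => H.eC x₁ x₂ y q) q := by
  have := (Good.hasDerivAt_path (hasDerivAt_const (q : ℂ) x₁)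
    (hasDerivAt_const (q : ℂ) y) (hasDerivAt_id (q : ℂ)) h rfl rfl rfl).2.2.2.2.2.continuousAt
  exact ContinuousAt.comp (f := fun q : ℝ => (q : ℂ)) this Complex.continuous_ofReal.continuousAt

variable (H) in
/-- The integrand on the unit square. -/
def sq (x₁ x₂ y : ℂ) (z : ℝ × ℝ) : ℂ :=
  (z.1 : ℂ) ^ (H.r₁ - 2) * (1 - (z.1 : ℂ)) ^ (H.s₁ - H.r₁ - 1) * (z.2 : ℂ) ^ (H.s₁ - 2)
    * (H.eC x₁ x₂ y z.2 * H.nC x₁ x₂ z.1 z.2 ^ (1 - H.r₂))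

theorem Ctl.integrableOn_sq (hc : H.Ctl ε r C) (hd : Dom ε x₁ x₂ y) (hu : ‖H.u x₁ x₂‖ < 1)
    (hr : 1 < H.r₁.re) (hrs : H.r₁.re < H.s₁.re) :
    IntegrableOn (H.sq x₁ x₂ y) (Set.Icc (0 : ℝ) 1 ×ˢ Set.Icc (0 : ℝ) 1) := by
  have hβ := Complex.betaIntegral_convergent (u := H.r₁ - 1) (v := H.s₁ - H.r₁)
    (by simp only [Complex.sub_re, Complex.one_re]; linarith)
    (by simp only [Complex.sub_re]; linarith)
  rw [show H.r₁ - 1 - 1 = H.r₁ - 2 by ring, intervalIntegrable_iff_integrableOn_Icc_of_le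
    zero_le_one] at hβ
  have hq : IntervalIntegrable (fun q : ℝ => (q : ℂ) ^ (H.s₁ - 2)) volume 0 1 :=
    intervalIntegral.intervalIntegrable_cpow' (by
      simp only [Complex.sub_re, Complex.re_ofNat]; linarith)
  rw [intervalIntegrable_iff_integrableOn_Icc_of_le zero_le_one] at hq
  have hprod : IntegrableOn (fun z : ℝ × ℝ =>
      (z.1 : ℂ) ^ (H.r₁ - 2) * (1 - (z.1 : ℂ)) ^ (H.s₁ - H.r₁ - 1) * (z.2 : ℂ) ^ (H.s₁ - 2))
      (Set.Icc (0 : ℝ) 1 ×ˢ Set.Icc (0 : ℝ) 1) := by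
    have := Integrable.mul_prod hβ hq
    rwa [Measure.prod_restrict, ← Measure.volume_eq_prod] at this
  refine hprod.mul_continuousOn ?_ (isCompact_Icc.prod isCompact_Icc)
  rintro ⟨p, q⟩ ⟨hp, hq⟩
  refine ContinuousAt.continuousWithinAt (ContinuousAt.mul ?_ ?_)
  · exact ContinuousAt.comp (f := fun z : ℝ × ℝ => z.2) (x := (p, q))
      (hc.good x₁ x₂ y q hd (norm_ofReal_le_one hq)).continuousAt_eC continuousAt_snd
  · refine ContinuousAt.cpow ?_ continuousAt_const ?_
    · simp only [nC]
      fun_prop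
    · exact mem_slitPlane_of_near (norm_nC_sub_one_lt hu hp hq) le_rfl

/-- Integrating out the first variable by Euler's integral. -/
theorem Ctl.integral_sq (hc : H.Ctl ε r C) (hd : Dom ε x₁ x₂ y) (hu : ‖H.u x₁ x₂‖ < 1)
    (hr : 1 < H.r₁.re) (hrs : H.r₁.re < H.s₁.re) :
    ∫ z in Set.Icc (0 : ℝ) 1 ×ˢ Set.Icc (0 : ℝ) 1, H.sq x₁ x₂ y z =
      Complex.betaIntegral (H.r₁ - 1) (H.s₁ - H.r₁) * H.rInt x₁ x₂ y := by
  have hint := hc.integrableOn_sq hd hu hr hrs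
  rw [IntegrableOn, Measure.volume_eq_prod, ← Measure.prod_restrict] at hint
  rw [Measure.volume_eq_prod, ← Measure.prod_restrict, integral_prod_symm _ hint, rInt,
    ← intervalIntegral.integral_const_mul, intervalIntegral.integral_of_le zero_le_one,
    ← integral_Icc_eq_integral_Ioc]
  refine setIntegral_congr_fun measurableSet_Icc fun q hq => ?_
  have hz : ‖H.u x₁ x₂ * (q : ℂ)‖ < 1 := by
    rw [norm_mul]
    exact (mul_le_of_le_one_right (norm_nonneg _) (norm_ofReal_le_one hq)).trans_lt hu
  have he := euler_integral (H.r₂ - 1) (b := H.r₁ - 1) (c := H.s₁ - 1)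
    (by simp only [Complex.sub_re, Complex.one_re]; linarith)
    (by simp only [Complex.sub_re, Complex.one_re]; linarith) hz
  rw [show H.s₁ - 1 - (H.r₁ - 1) = H.s₁ - H.r₁ by ring] at he
  rw [integral_Icc_eq_integral_Ioc, ← intervalIntegral.integral_of_le zero_le_one]
  simp only [fC, HeunParams.hc]
  rw [show ∀ b e s P : ℂ, b * (e * (P * s)) = b * P * (e * s) by intros; ring, ← he,
    ← intervalIntegral.integral_mul_const]
  refine intervalIntegral.integral_congr fun p _ => ?_
  simp only [sq, nC]
  rw [show H.r₁ - 1 - 1 = H.r₁ - 2 by ring, show -(H.r₂ - 1) = 1 - H.r₂ by ring,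
    show (p : ℂ) * (H.u x₁ x₂ * q) = p * q * H.u x₁ x₂ by ring]
  ring

theorem Ioo_prod_ae_eq : (Set.Ioo (0 : ℝ) 1 ×ˢ Set.Ioo (0 : ℝ) 1 : Set (ℝ × ℝ)) =ᵐ[volume]
    (Set.Icc (0 : ℝ) 1 ×ˢ Set.Icc (0 : ℝ) 1 : Set (ℝ × ℝ)) := by
  rw [Measure.volume_eq_prod]
  exact Measure.set_prod_ae_eq Ioo_ae_eq_Icc Ioo_ae_eq_Icc

/-- A form whose pullback is a multiple of `sq` inside the unit square. -/
theorem Ctl.integralD_eq (hc : H.Ctl ε r C) (hd : Dom ε x₁ x₂ y) (hu : ‖H.u x₁ x₂‖ < 1)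
    (hr : 1 < H.r₁.re) (hrs : H.r₁.re < H.s₁.re) {g : ℂ → ℂ → ℂ} {k : ℂ}
    (hg : ∀ p ∈ Set.Ioo (0 : ℝ) 1, ∀ q ∈ Set.Ioo (0 : ℝ) 1,
      H.pullback x₁ x₂ y g (p, q) = k * H.sq x₁ x₂ y (p, q)) :
    H.IntegrableD x₁ x₂ y g ∧ H.integralD x₁ x₂ y g =
      k * (Complex.betaIntegral (H.r₁ - 1) (H.s₁ - H.r₁) * H.rInt x₁ x₂ y) := by
  have hEq : Set.EqOn (fun z => k * H.sq x₁ x₂ y z) (H.pullback x₁ x₂ y g)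
      (Set.Ioo (0 : ℝ) 1 ×ˢ Set.Ioo (0 : ℝ) 1) := fun z hz => (hg z.1 hz.1 z.2 hz.2).symm
  have hmeas : MeasurableSet (Set.Ioo (0 : ℝ) 1 ×ˢ Set.Ioo (0 : ℝ) 1 : Set (ℝ × ℝ)) :=
    measurableSet_Ioo.prod measurableSet_Ioo
  constructor
  · have hint := (hc.integrableOn_sq hd hu hr hrs).congr_set_ae Ioo_prod_ae_eq
    exact (IntegrableOn.congr_fun (Integrable.const_mul hint k) hEq hmeas).congr_set_ae
      Ioo_prod_ae_eq.symm
  · rw [integralD, ← setIntegral_congr_set Ioo_prod_ae_eq, ← setIntegral_congr_fun hmeas hEq,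
      setIntegral_congr_set Ioo_prod_ae_eq, integral_const_mul, hc.integral_sq hd hu hr hrs]

theorem gamma_mul_beta (H : HeunParams) (hr : 1 < H.r₁.re) (hrs : H.r₁.re < H.s₁.re) :
    Complex.Gamma H.s₁ / (Complex.Gamma (H.r₁ - 1) * Complex.Gamma (H.s₁ - H.r₁) * (1 - H.t))
      * Complex.betaIntegral (H.r₁ - 1) (H.s₁ - H.r₁) = (H.s₁ - 1) / (1 - H.t) := by
  have h1 : 0 < (H.r₁ - 1).re := by simp only [Complex.sub_re, Complex.one_re]; linarith
  have h2 : 0 < (H.s₁ - H.r₁).re := by simp only [Complex.sub_re]; linarith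
  have h3 : 0 < (H.s₁ - 1).re := by simp only [Complex.sub_re, Complex.one_re]; linarith
  have g1 := Complex.Gamma_ne_zero_of_re_pos h1
  have g2 := Complex.Gamma_ne_zero_of_re_pos h2
  have g3 := Complex.Gamma_ne_zero_of_re_pos h3
  have ht := H.one_sub_t_ne
  have hs0 : H.s₁ - 1 ≠ 0 := fun h => by simp [h] at h3
  have hG := Complex.Gamma_add_one _ hs0
  rw [sub_add_cancel] at hG
  rw [Complex.betaIntegral_eq_Gamma_mul_div _ _ h1 h2, hG,
    show H.r₁ - 1 + (H.s₁ - H.r₁) = H.s₁ - 1 by ring]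
  field_simp

end HeunParams

end

theorem theorem5p3p3 (H : HeunParams) (hs : 1 < H.s₁.re) :
    ∃ ε : ℝ, 0 < ε ∧ ∀ x₁ x₂ : ℂ, ‖x₁‖ < ε → ‖x₂‖ < ε →
      -- `sqrtQ` is the continuous square root of `Q` with `Q^{1/2} ∼ v - w` for `y → ∞`
      (∀ q ∈ Set.Icc (0 : ℝ) 1,
        ContinuousOn (fun y => H.sqrtQ x₁ x₂ y q) {y | ‖x₁‖ < ε * ‖y‖ ∧ ‖x₂‖ < ε * ‖y‖} ∧
        (∀ y : ℂ, ‖x₁‖ < ε * ‖y‖ → ‖x₂‖ < ε * ‖y‖ → H.sqrtQ x₁ x₂ y q ^ 2 = H.Q x₁ x₂ y q) ∧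
        Filter.Tendsto (fun y => H.sqrtQ x₁ x₂ y q / (H.v x₁ x₂ y - H.w x₁ x₂ y))
          (Bornology.cobounded ℂ) (nhds 1)) ∧
      ∀ y : ℂ, ‖x₁‖ < ε * ‖y‖ → ‖x₂‖ < ε * ‖y‖ →
        -- the generating series of the structure constants converges
        Summable (H.kernelTerm x₁ x₂ y) ∧
        -- the one-dimensional integral representation
        (∀ ℓ₂ ℓ₃ : ℂ,
          Complex.exp ℓ₂ = 2 * (x₁ - 1) * (x₂ - 1) / (1 - H.t) →
          Complex.exp ℓ₃ = 2 * (x₁ - H.t) * (x₂ - H.t) / (H.t * (H.t - 1)) →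
          IntervalIntegrable (H.integrand₁ ℓ₂ ℓ₃ x₁ x₂ y) MeasureTheory.volume 0 1 ∧
          H.kernel x₁ x₂ y =
            (H.s₁ - 1) / (1 - H.t) * Complex.exp ((1 - H.s₂) * ℓ₂) * Complex.exp ((1 - H.s₃) * ℓ₃)
              * ∫ q in (0 : ℝ)..1, H.integrand₁ ℓ₂ ℓ₃ x₁ x₂ y q) ∧
        -- the two-dimensional integral representations
        (1 < H.r₁.re → H.r₁.re < H.s₁.re → x₁ ≠ 0 → x₂ ≠ 0 →
          ∀ ℓ₁ ℓ₂ ℓ₃ : ℂ,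
            Complex.exp ℓ₁ = x₁ * x₂ / H.t →
            Complex.exp ℓ₂ = (x₁ - 1) * (x₂ - 1) / (1 - H.t) →
            Complex.exp ℓ₃ = (x₁ - H.t) * (x₂ - H.t) / (H.t * (H.t - 1)) →
            (H.IntegrableD x₁ x₂ y (H.integrand₂ ℓ₁ ℓ₂ ℓ₃ x₁ x₂ y) ∧
              H.kernel x₁ x₂ y =
                Complex.exp ((1 - H.s₁) * ℓ₁) * Complex.exp ((1 - H.s₂) * ℓ₂)
                  * Complex.exp ((1 - H.s₃) * ℓ₃)
                  * (Complex.Gamma H.s₁ / (Complex.Gamma (H.r₁ - 1)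
                      * Complex.Gamma (H.s₁ - H.r₁) * (1 - H.t)))
                  * H.integralD x₁ x₂ y (H.integrand₂ ℓ₁ ℓ₂ ℓ₃ x₁ x₂ y)) ∧
            -- the same integral in terms of the kernel with auxiliary integration
            ∀ τ₁ τ₂ τ₃ : ℂ,
              Complex.exp τ₁ = H.t → Complex.exp τ₂ = 1 - H.t →
              Complex.exp τ₃ = H.t * (H.t - 1) →
              H.IntegrableD x₁ x₂ y
                (H.auxKernel (ℓ₁ + τ₁) (ℓ₂ + τ₂) (ℓ₃ + τ₃) ℓ₁ ℓ₂ ℓ₃ x₁ x₂ y) ∧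
              H.kernel x₁ x₂ y =
                Complex.exp ((H.s₁ - 1) * τ₁) * Complex.exp ((H.s₂ - 1) * τ₂)
                  * Complex.exp ((H.s₃ - 1) * τ₃)
                  * (Complex.Gamma H.s₁ / (Complex.Gamma (H.r₁ - 1)
                      * Complex.Gamma (H.s₁ - H.r₁) * (1 - H.t)))
                  * H.integralD x₁ x₂ y
                      (H.auxKernel (ℓ₁ + τ₁) (ℓ₂ + τ₂) (ℓ₃ + τ₃) ℓ₁ ℓ₂ ℓ₃ x₁ x₂ y)) := by
  have hδ : 0 < min (1 / 2) H.rad := lt_min (by norm_num) H.rad_pos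
  obtain ⟨ε, r, C, hc, hreg⟩ := H.exists_region hs hδ
  refine ⟨ε, hc.pos, fun x₁ x₂ h1 h2 => ⟨fun q hq => ⟨hc.continuousOn_sqrtQ h1 h2 hq, ?_, ?_⟩, ?_⟩⟩
  · intro y hy1 hy2
    have hd : HeunParams.Dom ε x₁ x₂ y := ⟨h1, h2, hy1, hy2⟩
    rw [HeunParams.sqrtQ_eq, H.rtC_sq x₁ x₂ hd.y_ne, HeunParams.disc_eq_Q]
  · obtain ⟨y, hy⟩ : ∃ y : ℂ, 1 < ‖y‖ := ⟨2, by simp⟩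
    have hd : HeunParams.Dom ε x₁ x₂ y :=
      HeunParams.Dom.of_one_lt hc.pos h1 h2 hy
    refine HeunParams.tendsto_sqrtQ H x₁ x₂ ?_ q
    exact ((hreg x₁ x₂ y hd).1 0 (by simp)).u_lt.trans_le ((min_le_left _ _).trans (by norm_num))
  · intro y hy1 hy2
    have hd : HeunParams.Dom ε x₁ x₂ y := ⟨h1, h2, hy1, hy2⟩
    obtain ⟨hnear, hsum, hK⟩ := hreg x₁ x₂ y hd
    have hu : ‖H.u x₁ x₂‖ < 1 :=
      (hnear 0 (by simp)).u_lt.trans_le ((min_le_left _ _).trans (by norm_num))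
    refine ⟨hsum, fun ℓ₂ ℓ₃ e₂ e₃ => ?_, fun hr hrs _ _ ℓ₁ ℓ₂ ℓ₃ e₁ e₂ e₃ => ?_⟩
    · obtain ⟨hint, hval⟩ := hc.integrand₁ hs hd e₂ e₃
      refine ⟨hint, ?_⟩
      rw [hK, ← hval]
      ring
    · have hin := fun (p : ℝ) (hp : p ∈ Set.Ioo (0 : ℝ) 1) (q : ℝ) (hq : q ∈ Set.Ioo (0 : ℝ) 1) =>
        hc.inner hd hnear (min_le_left _ _) (min_le_right _ _) hp hq
      have hpull := fun (p : ℝ) (hp : p ∈ Set.Ioo (0 : ℝ) 1) (q : ℝ)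
        (hq : q ∈ Set.Ioo (0 : ℝ) 1) => (hin p hp q hq).pullback_integrand₂ e₁ e₂ e₃
      have hΓ := H.gamma_mul_beta hr hrs
      have hexp : ∀ s ℓ : ℂ, Complex.exp ((1 - s) * ℓ) * Complex.exp ((s - 1) * ℓ) = 1 := by
        intro s ℓ
        rw [← Complex.exp_add, ← Complex.exp_zero]
        ring_nf
      obtain ⟨hint, hval⟩ := hc.integralD_eq hd hu hr hrs hpull
      refine ⟨⟨hint, ?_⟩, fun τ₁ τ₂ τ₃ _ _ _ => ?_⟩
      · rw [hval, hK, ← hΓ, show ∀ a b c G a' b' c' B I : ℂ,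
          a * b * c * G * (a' * b' * c' * (B * I)) = (a * a') * (b * b') * (c * c') * (G * B * I) by
            intros; ring, hexp, hexp, hexp]
        ring
      · obtain ⟨hint', hval'⟩ := hc.integralD_eq hd hu hr hrs
          (g := H.auxKernel (ℓ₁ + τ₁) (ℓ₂ + τ₂) (ℓ₃ + τ₃) ℓ₁ ℓ₂ ℓ₃ x₁ x₂ y)
          (k := Complex.exp ((1 - H.s₁) * τ₁) * Complex.exp ((1 - H.s₂) * τ₂)
            * Complex.exp ((1 - H.s₃) * τ₃)) (by
          intro p hp q hq
          have e : H.pullback x₁ x₂ y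
              (H.auxKernel (ℓ₁ + τ₁) (ℓ₂ + τ₂) (ℓ₃ + τ₃) ℓ₁ ℓ₂ ℓ₃ x₁ x₂ y) (p, q) =
              Complex.exp ((1 - H.s₁) * (ℓ₁ + τ₁)) * Complex.exp ((1 - H.s₂) * (ℓ₂ + τ₂))
                * Complex.exp ((1 - H.s₃) * (ℓ₃ + τ₃))
                * H.pullback x₁ x₂ y (H.integrand₂ ℓ₁ ℓ₂ ℓ₃ x₁ x₂ y) (p, q) := by
            simp only [HeunParams.pullback]
            rw [(hin p hp q hq).auxKernel_eq e₁ e₂ e₃, mul_assoc _ (H.integrand₂ _ _ _ _ _ _ _ _)]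
          rw [e, hpull p hp q hq, ← HeunParams.sq.eq_def H x₁ x₂ y (p, q)]
          simp only [mul_add, Complex.exp_add]
          rw [show ∀ a b c d e f a' b' c' S : ℂ,
            a * b * (c * d) * (e * f) * (a' * b' * c' * S) =
              (a * a') * (c * b') * (e * c') * (b * d * f * S) by intros; ring, hexp, hexp, hexp]
          ring)
        refine ⟨hint', ?_⟩
        rw [hval', hK, ← hΓ, show ∀ a b c G a' b' c' B I : ℂ,
          a * b * c * G * (a' * b' * c' * (B * I)) = (a' * a) * (b' * b) * (c' * c) * (G * B * I) by
            intros; ring, hexp, hexp, hexp]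
        ring
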